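/- **Setting.** Let $V$ be a vertex operator algebra over $\mathbb C$. A weak $V$-module is a complex vector space $W$ with a linear map $a\mapsto Y_W(a,z)=\sum_{n\in\mathbb Z}a_nz^{-n-1}\in(\mathrm{End}\,W)[[z,z^{-1}]]$ satisfying the vacuum axiom, truncation ($a_nu=0$ for $n\gg0$), the $L(-1)$-derivative property and the Jacobi identity; $L(n)$ are the modes of the conformal vector, and $W_h$ denotes the generalized $L(0)$-eigenspace with eigenvalue $h$. Let $\mathcal D$ be one of the following two categories: $\mathcal C(V)$ ($L(0)$ is semisimple, $\dim W_h<\infty$, and $W_{h+n}=0$ for all sufficiently small $n\in\mathbb Z$), or $\mathcal C^1(V)$ ($L(0)$ is locally finite, and the generalized weights lie in a finite union of sets $h_i+\mathbb Z_{\ge0}$). An intertwining operator of type $\binom{W_3}{W_1\,W_2}$ is a linear map $I(\cdot,z):W_1\to(\mathrm{Hom}(W_2,W_3))\{z\}$, $I(w,z)=\sum_{n\in\mathbb C}w_nz^{-n-1}$, satisfying truncation (for every $\alpha\in\mathbb C$, $w_{\alpha+j}u=0$ for all sufficiently large $j\in\mathbb Z$), the $L(-1)$-derivative property and the Jacobi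 identity. A tensor product of $(W_1,W_2)$ in $\mathcal D$ is a pair consisting of an object $M$ of $\mathcal D$ and an intertwining operator of type $\binom{M}{W_1\,W_2}$ that is universal among intertwining operators of type $\binom{W}{W_1\,W_2}$ with $W\in\mathcal D$. The graded dual is $W'=\bigoplus_hW_h^*$. Let $W_1,W_2,W_3\in\mathcal D$, let $(W_{12},F_{12})$ be a tensor product of $(W_1,W_2)$ and $(W_{12,3},F_{12,3})$ a tensor product of $(W_{12},W_3)$ in $\mathcal D$. Assume the convergence and extension property for the iterate of $F_{12}$ and $F_{12,3}$: there is an integer $\tilde N$ such that for all homogeneous $w_i\in W_i$ (of generalized weight $\mathrm{gwt}\,w_i$) and homogeneous $w_4'\in W_{12,3}'$ there are $k\in\mathbb N$, $r_i,s_i\in\mathbb C$ and analytic functions $f_i$ on $|z|<1$ ($1\le i\le k$) with $\mathrm{Re}(\mathrm{gwt}\,w_2+\mathrm{gwt}\,w_3+s_i)>\tilde N$, such that $$\langle w_4',F_{12,3}(F_{12}(w_1,z_1-z_2)w_2,z_2)w_3\rangle$$ converges for $|z_2|>|z_1-z_2|>0$ and is analytically extended to $|z_1|>|z_2|>0$ by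 the multivalued function $\sum_{i=1}^kz_1^{r_i}z_2^{s_i}f_i(z_2/z_1)$. Here powers are taken with principal logarithms, and "extended" means that the two functions agree where $|z_1|>|z_2|>|z_1-z_2|>0$ and $z_2$, $z_1-z_2$ have positive real part. Whenever such an extension exists for given vectors, write $E^{12}$ of the iterate for the formal series $\sum_iz_1^{r_i}z_2^{s_i}f_i(z_2/z_1)$, with $f_i$ replaced by its Taylor series at $0$. A generalized right intertwining operator from $U$ to $W$ is a series $\Phi(z)=\sum_{\alpha\in\mathbb C}\Phi_\alpha z^{-\alpha-1}\in(\mathrm{Hom}(U,W))\{z\}$ such that: for all $\alpha\in\mathbb C$, $u\in U$, $\Phi_{\alpha+j}u=0$ for all sufficiently large $j\in\mathbb Z$; $\Phi(z)L(-1)=\Phi'(z)$; and for every $a\in V$ there is a positive integer $k$ such that $(z_0+z_2)^kY(a,z_0+z_2)\Phi(z_2)u=(z_0+z_2)^k\Phi(z_2)Y(a,z_0)u$ for all $u\in U$. It is homogeneous of generalized weight $h$ if every $\Phi_n$ maps $U_{h_1}$ into $W_{h+h_1-n-1}$ for all $h_1$. Let $G_r^o(U,W)$ be the sum over $h$ of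 the spaces of generalized right intertwining operators that are homogeneous of generalized weight $h$, with the action $$a_m\circ_r\Phi(z_2)=a_m\Phi(z_2)-\mathrm{Res}_{z_0}(z_2+z_0)^m\Phi(z_2)Y(a,z_0).$$ **Proposition.** There are unique series $$\phi(w_2,w_3;z_1,z_2)=\sum_{n\in\mathbb C}\phi_n(w_2,w_3,z_1)z_2^{-n-1}\in(\mathrm{Hom}(W_1,W_{12,3}))\{z_1,z_2\}\qquad(w_2\in W_2,\ w_3\in W_3)$$ such that $$\langle w_4',\phi(w_2,w_3;z_1,z_2)w_1\rangle=E^{12}\langle w_4',F_{12,3}(F_{12}(w_1,z_1-z_2)w_2,z_2)w_3\rangle$$ for all $w_i\in W_i$ and $w_4'\in W_{12,3}'$ (in particular the right-hand side is defined), and for all $w_2,w_3$ there is a real $h$ with $\phi_n(w_2,w_3,z_1)=0$ whenever $\mathrm{Re}\,n>h$. The space $G_r^o(W_1,W_{12,3})$ is a weak $V$-module under $\circ_r$. The linear span $M$ of all $\phi_n(w_2,w_3,z_1)$ ($w_2\in W_2$, $w_3\in W_3$, $n\in\mathbb C$) is contained in $G_r^o(W_1,W_{12,3})$ and is a weak submodule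 of it. The map $I_1(w_1,z)A=A(z)w_1$ ($w_1\in W_1$, $A\in M$) is an intertwining operator of type $\binom{W_{12,3}}{W_1\,M}$. The map $I_2$ defined by $$(I_2(w_2,z_2)w_3)(z_1)=\phi(w_2,w_3;z_1,z_2)$$ is an intertwining operator of type $\binom{M}{W_2\,W_3}$. Consequently $$E^{12}\langle w_4',F_{12,3}(F_{12}(w_1,z_1-z_2)w_2,z_2)w_3\rangle=\langle w_4',I_1(w_1,z_1)I_2(w_2,z_2)w_3\rangle$$ for all $w_i\in W_i$ and $w_4'\in W_{12,3}'$. -/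

import Mathlib

universe u v

noncomputable section

/-!
Conventions.  A formal series `∑ x_n z^{-n-1}` is represented by the family of its
coefficients `n ↦ x_n`; integral exponents give families over `ℤ`, arbitrary complex exponents
families over `ℂ`.  Sums `∑ᶠ` below always have only finitely many nonzero terms, by the
truncation conditions.
-/

/-- The Jacobi identity
`z₀⁻¹ δ((z₁ - z₂)/z₀) Y₃(a,z₁) I(w,z₂) u - z₀⁻¹ δ((z₂ - z₁)/(-z₀)) I(w,z₂) Y₂(a,z₁) u
  = z₂⁻¹ δ((z₁ - z₀)/z₂) I(Y₁(a,z₀)w,z₂) u`,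
written out as equality of the coefficients of `z₀^{-l-1} z₁^{-m-1} z₂^{-n-1}`.  The index set `ι`
of the modes of `I` is `ℤ` (modules) or `ℂ` (intertwining operators). -/
def JacobiIdentity {ι V W₁ W₂ W₃ : Type*} [Ring ι]
    [AddCommGroup V] [Module ℂ V] [AddCommGroup W₁] [Module ℂ W₁]
    [AddCommGroup W₂] [Module ℂ W₂] [AddCommGroup W₃] [Module ℂ W₃]
    (Y₁ : V →ₗ[ℂ] ℤ → Module.End ℂ W₁) (Y₂ : V →ₗ[ℂ] ℤ → Module.End ℂ W₂)
    (Y₃ : V →ₗ[ℂ] ℤ → Module.End ℂ W₃) (I : W₁ →ₗ[ℂ] ι → (W₂ →ₗ[ℂ] W₃)) : Prop :=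
  ∀ (a : V) (w : W₁) (u : W₂) (l m : ℤ) (n : ι),
    (∑ᶠ i : ℕ, ((-1) ^ i * Ring.choose l i : ℤ) •
        (Y₃ a (m + l - i) (I w (n + i) u)
          - ((Int.negOnePow l : ℤˣ) : ℤ) • I w (n + l - i) (Y₂ a (m + i) u)))
      = ∑ᶠ i : ℕ, (Ring.choose m i : ℤ) • I (Y₁ a (l + i) w) (n + m - i) u

/-- Vertex operator algebras over `ℂ`.  `Y a n` is the mode `a_n` of
`Y(a,z) = ∑ a_n z^{-n-1}`, so `L(n) = Y conf (n + 1)`. -/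
class VertexOperatorAlgebra (V : Type v) [AddCommGroup V] [Module ℂ V] where
  /-- the vertex operator map, by modes -/
  Y : V →ₗ[ℂ] ℤ → Module.End ℂ V
  /-- the vacuum vector -/
  vac : V
  /-- the conformal (Virasoro) vector -/
  conf : V
  /-- the central charge (rank) -/
  rank : ℂ
  /-- the weight spaces -/
  grade : ℤ → Submodule ℂ V
  grade_internal : DirectSum.IsInternal grade
  grade_finite : ∀ n, FiniteDimensional ℂ (grade n)
  grade_bounded : ∃ N : ℤ, ∀ n < N, grade n = ⊥
  truncation : ∀ a b : V, ∃ N : ℤ, ∀ n ≥ N, Y a n b = 0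
  vacuum : ∀ n : ℤ, Y vac n = if n = -1 then 1 else 0
  creation : ∀ a : V, Y a (-1) vac = a ∧ ∀ n : ℤ, 0 ≤ n → Y a n vac = 0
  jacobi : JacobiIdentity Y Y Y Y
  virasoro : ∀ m n : ℤ,
    Y conf (m + 1) * Y conf (n + 1) - Y conf (n + 1) * Y conf (m + 1)
      = ((m : ℂ) - n) • Y conf (m + n + 1)
        + (if m + n = 0 then (((m : ℂ) ^ 3 - m) / 12 * rank) • 1 else 0)
  weight : ∀ (n : ℤ), ∀ a ∈ grade n, Y conf 1 a = (n : ℂ) • a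
  derivative : ∀ (a : V) (n : ℤ), Y (Y conf 0 a) n = -(n : ℂ) • Y a (n - 1)

/-- Weak `V`-module structures on the complex vector space `W`; `Y a n` is the mode `a_n`
of `Y_W(a,z) = ∑ a_n z^{-n-1}`. -/
structure WeakModule (V : Type v) [AddCommGroup V] [Module ℂ V] [VertexOperatorAlgebra V]
    (W : Type u) [AddCommGroup W] [Module ℂ W] where
  Y : V →ₗ[ℂ] ℤ → Module.End ℂ W
  vacuum : ∀ n : ℤ, Y VertexOperatorAlgebra.vac n = if n = -1 then 1 else 0
  truncation : ∀ (a : V) (u : W), ∃ N : ℤ, ∀ n ≥ N, Y a n u = 0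
  derivative : ∀ (a : V) (n : ℤ),
    Y (VertexOperatorAlgebra.Y VertexOperatorAlgebra.conf 0 a) n = -(n : ℂ) • Y a (n - 1)
  jacobi : JacobiIdentity VertexOperatorAlgebra.Y Y Y Y

namespace WeakModule

section

variable {V : Type v} [AddCommGroup V] [Module ℂ V] [VertexOperatorAlgebra V]
  {W : Type u} [AddCommGroup W] [Module ℂ W]

/-- The Virasoro operator `L(n)` on a weak module. -/
def L (S : WeakModule V W) (n : ℤ) : Module.End ℂ W :=
  S.Y VertexOperatorAlgebra.conf (n + 1)

/-- The space of generalized weight vectors of generalized weight `h`, together with `0`. -/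
def genWeightSpace (S : WeakModule V W) (h : ℂ) : Submodule ℂ W :=
  Module.End.maxGenEigenspace (S.L 0) h

/-- The category `C(V)`: `L(0)` is semisimple, its eigenspaces `W_h` are finite dimensional, and
`W_{h+n} = 0` for all sufficiently small integers `n`. -/
def IsOrdinary (S : WeakModule V W) : Prop :=
  (⨆ h : ℂ, Module.End.eigenspace (S.L 0) h) = ⊤ ∧
  (∀ h : ℂ, FiniteDimensional ℂ (Module.End.eigenspace (S.L 0) h)) ∧
  (∀ h : ℂ, ∃ N : ℤ, ∀ n : ℤ, n ≤ N → Module.End.eigenspace (S.L 0) (h + n) = ⊥)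

/-- The category `C¹(V)`: `L(0)` is locally finite, and the set of generalized weights is contained
in a finite union of sets `h_i + ℤ₊`. -/
def IsLocallyFinite (S : WeakModule V W) : Prop :=
  (∀ w : W, ∃ U : Submodule ℂ W, FiniteDimensional ℂ U ∧ w ∈ U ∧ ∀ x ∈ U, S.L 0 x ∈ U) ∧
  (∃ s : Finset ℂ, ∀ h : ℂ, S.genWeightSpace h ≠ ⊥ → ∃ c ∈ s, ∃ n : ℕ, h = c + n)

/-- Linear functionals concentrated in a single generalized weight space, that is, the homogeneous
elements of the graded dual `W'`. -/
def IsHomogeneousFunctional (S : WeakModule V W) (f : Module.Dual ℂ W) : Prop :=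
  ∃ h : ℂ, ∀ h' : ℂ, h' ≠ h → ∀ w ∈ S.genWeightSpace h', f w = 0

/-- Membership in the graded dual `W' = ⨁_h (W_h)^*`. -/
def InGradedDual (S : WeakModule V W) (f : Module.Dual ℂ W) : Prop :=
  {h : ℂ | ∃ w ∈ S.genWeightSpace h, f w ≠ 0}.Finite

/-- Homomorphisms of weak modules. -/
def IsHom {W' : Type*} [AddCommGroup W'] [Module ℂ W'] (S : WeakModule V W) (S' : WeakModule V W')
    (f : W →ₗ[ℂ] W') : Prop :=
  ∀ (a : V) (n : ℤ) (w : W), f (S.Y a n w) = S'.Y a n (f w)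

end

end WeakModule

/-- Weak submodules: subspaces stable under all modes. -/
structure WeakSubmodule {V : Type v} [AddCommGroup V] [Module ℂ V] [VertexOperatorAlgebra V]
    {W : Type u} [AddCommGroup W] [Module ℂ W] (S : WeakModule V W) extends Submodule ℂ W where
  stable : ∀ (a : V) (n : ℤ), ∀ w ∈ toSubmodule, S.Y a n w ∈ toSubmodule

namespace WeakSubmodule

/-- The weak module structure induced on a weak submodule. -/
def weakModule {V : Type v} [AddCommGroup V] [Module ℂ V] [VertexOperatorAlgebra V]
    {W : Type u} [AddCommGroup W] [Module ℂ W] {S : WeakModule V W} (N : WeakSubmodule S) :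
    WeakModule V N.toSubmodule where
  Y :=
    { toFun := fun a n => (S.Y a n).restrict (N.stable a n)
      map_add' := fun a b => by ext n x; simp
      map_smul' := fun c a => by ext n x; simp }
  vacuum := fun n => by
    ext x
    simp only [LinearMap.coe_mk, AddHom.coe_mk, LinearMap.coe_restrict_apply, S.vacuum]
    split_ifs <;> simp
  truncation := fun a u => by
    obtain ⟨K, hK⟩ := S.truncation a u
    exact ⟨K, fun n hn => Subtype.ext (by simpa using hK n hn)⟩
  derivative := fun a n => by
    ext x
    simp [S.derivative]
  jacobi := by
    intro a w u l m n
    apply N.toSubmodule.injective_subtype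
    have h := S.jacobi a w (u : W) l m n
    have key : ∀ f : ℕ → N.toSubmodule,
        N.toSubmodule.subtype (∑ᶠ i, f i) = ∑ᶠ i, N.toSubmodule.subtype (f i) := fun f =>
      N.toSubmodule.subtype.toAddMonoidHom.map_finsum_of_injective
        N.toSubmodule.injective_subtype f
    rw [key, key]
    simpa using h

end WeakSubmodule

/-- The two categories of weak modules that are considered. -/
inductive ModuleCategory
  /-- the category `C(V)` of `V`-modules -/
  | ordinary
  /-- the category `C¹(V)` -/
  | locallyFinite

/-- Membership of a weak module in a category. -/
def ModuleCategory.Mem (D : ModuleCategory)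
    {V : Type v} [AddCommGroup V] [Module ℂ V] [VertexOperatorAlgebra V]
    {W : Type u} [AddCommGroup W] [Module ℂ W] (S : WeakModule V W) : Prop :=
  match D with
  | .ordinary => S.IsOrdinary
  | .locallyFinite => S.IsLocallyFinite

section

variable {V : Type v} [AddCommGroup V] [Module ℂ V] [VertexOperatorAlgebra V]

/-- Intertwining operators of type `(W₃; W₁ W₂)`; `mode w n` is the coefficient `w_n` of
`I(w,z) = ∑_{n ∈ ℂ} w_n z^{-n-1}`. -/
structure IntertwiningOperator {W₁ W₂ W₃ : Type*} [AddCommGroup W₁] [Module ℂ W₁]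
    [AddCommGroup W₂] [Module ℂ W₂] [AddCommGroup W₃] [Module ℂ W₃]
    (S₁ : WeakModule V W₁) (S₂ : WeakModule V W₂) (S₃ : WeakModule V W₃) where
  mode : W₁ →ₗ[ℂ] ℂ → (W₂ →ₗ[ℂ] W₃)
  truncation : ∀ (w : W₁) (u : W₂) (α : ℂ), ∃ N : ℤ, ∀ j : ℤ, j ≥ N → mode w (α + j) u = 0
  derivative : ∀ (w : W₁) (n : ℂ), mode (S₁.L (-1) w) n = (-n) • mode w (n - 1)
  jacobi : JacobiIdentity S₁.Y S₂.Y S₃.Y mode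

/-- `(M, F)` is a tensor product of the ordered pair `(W₁, W₂)` in the category `D`. -/
def IsModuleTensorProduct (D : ModuleCategory) {W₁ W₂ M : Type u}
    [AddCommGroup W₁] [Module ℂ W₁] [AddCommGroup W₂] [Module ℂ W₂] [AddCommGroup M] [Module ℂ M]
    {S₁ : WeakModule V W₁} {S₂ : WeakModule V W₂} {SM : WeakModule V M}
    (F : IntertwiningOperator S₁ S₂ SM) : Prop :=
  D.Mem SM ∧
  ∀ (W : Type u) [AddCommGroup W] [Module ℂ W] (S : WeakModule V W), D.Mem S →
    ∀ I : IntertwiningOperator S₁ S₂ S,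
      ∃! ψ : M →ₗ[ℂ] W, SM.IsHom S ψ ∧
        ∀ (w₁ : W₁) (n : ℂ) (w₂ : W₂), I.mode w₁ n w₂ = ψ (F.mode w₁ n w₂)

variable {W₁ W₂ : Type u} [AddCommGroup W₁] [Module ℂ W₁] [AddCommGroup W₂] [Module ℂ W₂]

/-- Generalized right intertwining operators `Φ(z) = ∑_{α ∈ ℂ} Φ_α z^{-α-1}` from `W₁` to `W₂`. -/
structure IsGenRightIntertwining (S₁ : WeakModule V W₁) (S₂ : WeakModule V W₂)
    (Φ : ℂ → (W₁ →ₗ[ℂ] W₂)) : Prop where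
  truncation : ∀ (α : ℂ) (u : W₁), ∃ N : ℤ, ∀ j : ℤ, j ≥ N → Φ (α + j) u = 0
  /-- `Φ(z) L(-1) = Φ'(z)` -/
  derivative : ∀ (n : ℂ) (u : W₁), Φ n (S₁.L (-1) u) = (-n) • Φ (n - 1) u
  /-- `(z₀ + z₂)^k Y(a, z₀ + z₂) Φ(z₂) u = (z₀ + z₂)^k Φ(z₂) Y(a, z₀) u`, binomials being expanded
  in nonnegative powers of `z₂`: equality of the coefficients of `z₀^{-m-1} z₂^{-n-1}`. -/
  associativity : ∀ a : V, ∃ k : ℕ, 0 < k ∧ ∀ (u : W₁) (m : ℤ) (n : ℂ),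
    (∑ᶠ i : ℕ, ((-1) ^ i * Ring.choose m i : ℤ) • S₂.Y a (k + m - i) (Φ (n + i) u))
      = ∑ i ∈ Finset.range (k + 1), (k.choose i : ℤ) • Φ (n + k - i) (S₁.Y a (m + i) u)

/-- `Φ(z)` is homogeneous of generalized weight `h`: each `Φ_n` is a homogeneous operator of
generalized weight `h - n - 1`. -/
def IsHomogeneousOfWeight (S₁ : WeakModule V W₁) (S₂ : WeakModule V W₂) (h : ℂ)
    (Φ : ℂ → (W₁ →ₗ[ℂ] W₂)) : Prop :=
  ∀ n h₁ : ℂ, ∀ w ∈ S₁.genWeightSpace h₁, Φ n w ∈ S₂.genWeightSpace (h - n - 1 + h₁)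

/-- The space `G_r^o(W₁,W₂)`: the sum over `h` of the spaces of generalized right intertwining
operators that are homogeneous of generalized weight `h`. -/
def genRightHomogeneous (S₁ : WeakModule V W₁) (S₂ : WeakModule V W₂) :
    Submodule ℂ (ℂ → (W₁ →ₗ[ℂ] W₂)) :=
  Submodule.span ℂ
    {Φ | IsGenRightIntertwining S₁ S₂ Φ ∧ ∃ h : ℂ, IsHomogeneousOfWeight S₁ S₂ h Φ}

/-- The series `a_m ∘_r Φ(z₂) = a_m Φ(z₂) - Res_{z₀} (z₂ + z₀)^m Φ(z₂) Y(a,z₀)`. -/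
def circRight (S₁ : WeakModule V W₁) (S₂ : WeakModule V W₂) (a : V) (m : ℤ)
    (Φ : ℂ → (W₁ →ₗ[ℂ] W₂)) : ℂ → (W₁ →ₗ[ℂ] W₂) := fun n =>
  (S₂.Y a m).comp (Φ n) -
    { toFun := fun u => ∑ᶠ i : ℕ, (Ring.choose m i : ℤ) • Φ (n + m - i) (S₁.Y a i u)
      map_add' := fun u u' => by
        have fin : ∀ x : W₁, (Function.support
            fun i : ℕ => (Ring.choose m i : ℤ) • Φ (n + m - i) (S₁.Y a i x)).Finite := by
          intro x
          obtain ⟨K, hK⟩ := S₁.truncation a x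
          refine (Set.finite_lt_nat K.toNat).subset fun i hi => ?_
          by_contra hlt
          refine hi ?_
          have : S₁.Y a i x = 0 := hK i (by simp only [Set.mem_ofPred_eq] at hlt; omega)
          simp [this]
        rw [← finsum_add_distrib (fin u) (fin u')]
        simp
      map_smul' := fun c u => by
        rw [RingHom.id_apply, smul_finsum]
        refine finsum_congr fun i => ?_
        rw [map_smul, map_smul, smul_comm] }

end

/-! ### Analytic extension of iterates -/

/-- The data of a multivalued function
`∑_{i=1}^k z₁^{r_i} z₂^{s_i} f_i(z₂/z₁)` on `|z₁| > |z₂| > 0`, with `f_i` analytic on the open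
unit disc. -/
structure MultivaluedSum where
  k : ℕ
  r : Fin k → ℂ
  s : Fin k → ℂ
  f : Fin k → ℂ → ℂ
  analytic : ∀ i, AnalyticOnNhd ℂ (f i) (Metric.ball 0 1)

namespace MultivaluedSum

/-- The value of the branch given by the principal logarithms of `z₁` and `z₂`. -/
def eval (g : MultivaluedSum) (z₁ z₂ : ℂ) : ℂ :=
  ∑ i, z₁ ^ g.r i * z₂ ^ g.s i * g.f i (z₂ / z₁)

/-- The coefficient of `z₁^{-m-1} z₂^{-n-1}` in the formal series
`∑_i z₁^{r_i} z₂^{s_i} f_i(z₂/z₁)`, where `f_i` stands for its Taylor series at `0`. -/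
def coeff (g : MultivaluedSum) (m n : ℂ) : ℂ :=
  open Classical in
  ∑ i, ∑ᶠ j : ℕ, if -m - 1 = g.r i - j ∧ -n - 1 = g.s i + j
    then iteratedDeriv j (g.f i) 0 / (j.factorial : ℂ) else 0

end MultivaluedSum

/-- The term with index `p = (n, m)` of the series `∑ c_{n,m} z₀^{-n-1} z₂^{-m-1}`, `z₀ = z₁ - z₂`,
taken with principal logarithms. -/
def iterateTerm (c : ℂ → ℂ → ℂ) (z₁ z₂ : ℂ) (p : ℂ × ℂ) : ℂ :=
  c p.1 p.2 * (z₁ - z₂) ^ (-p.1 - 1) * z₂ ^ (-p.2 - 1)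

/-- The series `∑ c_{n,m} (z₁ - z₂)^{-n-1} z₂^{-m-1}` is convergent when `|z₂| > |z₁ - z₂| > 0`, and
its sum is analytically extended by the multivalued function `g` to `|z₁| > |z₂| > 0`: the two
functions coincide on the part of the overlap `|z₁| > |z₂| > |z₁ - z₂| > 0` where `z₂` and
`z₁ - z₂` (hence also `z₁`) have positive real part.  This is a nonempty connected open set on which
all the principal logarithms are analytic. -/
def ExtendsIterate (c : ℂ → ℂ → ℂ) (g : MultivaluedSum) : Prop :=
  (∀ z₁ z₂ : ℂ, 0 < ‖z₁ - z₂‖ → ‖z₁ - z₂‖ < ‖z₂‖ → Summable (iterateTerm c z₁ z₂)) ∧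
  (∀ z₁ z₂ : ℂ, 0 < (z₁ - z₂).re → 0 < z₂.re → ‖z₁ - z₂‖ < ‖z₂‖ → ‖z₂‖ < ‖z₁‖ →
    ∑' p, iterateTerm c z₁ z₂ p = g.eval z₁ z₂)

/-- `∑ d_{m,n} z₁^{-m-1} z₂^{-n-1} = E^{12} (∑ c_{n,m} (z₁ - z₂)^{-n-1} z₂^{-m-1})` as formal
series: the right-hand side converges and extends to a multivalued function whose expansion
is the left-hand side. -/
def IsIterateExpansion (c d : ℂ → ℂ → ℂ) : Prop :=
  ∃ g : MultivaluedSum, ExtendsIterate c g ∧ ∀ m n : ℂ, d m n = g.coeff m n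

section

variable {V : Type v} [AddCommGroup V] [Module ℂ V] [VertexOperatorAlgebra V]
  {W₁ W₂ W₃ W₄ W₅ : Type u} [AddCommGroup W₁] [Module ℂ W₁] [AddCommGroup W₂] [Module ℂ W₂]
  [AddCommGroup W₃] [Module ℂ W₃] [AddCommGroup W₄] [Module ℂ W₄] [AddCommGroup W₅] [Module ℂ W₅]
  {S₁ : WeakModule V W₁} {S₂ : WeakModule V W₂} {S₃ : WeakModule V W₃} {S₄ : WeakModule V W₄}
  {S₅ : WeakModule V W₅}

/-- The coefficient of `z₀^{-n-1} z₂^{-m-1}` in `⟨w', 𝒴₄(𝒴₃(w₁,z₀)w₂,z₂)w₃⟩`. -/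
def iterateCoeff (Y3 : IntertwiningOperator S₁ S₂ S₅) (Y4 : IntertwiningOperator S₅ S₃ S₄)
    (w₁ : W₁) (w₂ : W₂) (w₃ : W₃) (w' : Module.Dual ℂ W₄) (n m : ℂ) : ℂ :=
  w' (Y4.mode (Y3.mode w₁ n w₂) m w₃)

/-- The convergence and extension property for the iterate `𝒴₄(𝒴₃(w₁,z₁-z₂)w₂,z₂)w₃` of two
given intertwining operators. -/
def IterateConvergenceExtension (Y3 : IntertwiningOperator S₁ S₂ S₅)
    (Y4 : IntertwiningOperator S₅ S₃ S₄) : Prop :=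
  ∃ N : ℤ, ∀ (h₁ h₂ h₃ : ℂ), ∀ w₁ ∈ S₁.genWeightSpace h₁, ∀ w₂ ∈ S₂.genWeightSpace h₂,
    ∀ w₃ ∈ S₃.genWeightSpace h₃, ∀ w' : Module.Dual ℂ W₄, S₄.IsHomogeneousFunctional w' →
      ∃ g : MultivaluedSum, (∀ i, (N : ℝ) < (h₂ + h₃ + g.s i).re) ∧
        ExtendsIterate (iterateCoeff Y3 Y4 w₁ w₂ w₃ w') g

/-- `φ w₂ w₃ n` is the family of coefficients of `φ_n(w₂,w₃,z₁)`, that is,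
`φ(w₂,w₃;z₁,z₂) = ∑_{m,n} (φ w₂ w₃ n m) z₁^{-m-1} z₂^{-n-1}`, and
`⟨w', φ(w₂,w₃;z₁,z₂)w₁⟩ = E^{12} ⟨w', 𝒴₄(𝒴₃(w₁,z₁-z₂)w₂,z₂)w₃⟩` for all `w'` in the graded dual. -/
def IsIterateExtension (Y3 : IntertwiningOperator S₁ S₂ S₅)
    (Y4 : IntertwiningOperator S₅ S₃ S₄) (φ : W₂ → W₃ → ℂ → ℂ → (W₁ →ₗ[ℂ] W₄)) : Prop :=
  ∀ (w₁ : W₁) (w₂ : W₂) (w₃ : W₃) (w' : Module.Dual ℂ W₄), S₄.InGradedDual w' →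
    IsIterateExpansion (iterateCoeff Y3 Y4 w₁ w₂ w₃ w') (fun m n => w' (φ w₂ w₃ n m w₁))

end

end

noncomputable section

/-! ### Formal calculus of coefficient arrays -/

/-! The coefficients `φ_n(w₂,w₃,z₁)` of the extended iterate are operator-valued series in `z₁`, and
the intermediate module is the space they span. A vertex operator `Y(a,x)` acts on such a series by
acting on its values and removing the contribution of the pole at `x = z₁`; this is `circRight`.
With this choice the final identity holds by definition of `φ`, and the work lies in the existence
of `φ` and in the algebraic properties of `∘_r`, `I₁` and `I₂`.

Formal part. A series in a mode variable `X` and a further variable `z` is an array, and `dif`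
multiplies it by `X - z`. The cancellation principle is `eq_zero_of_dif_pow_eq_zero`: a series
annihilated by a power of `X - z` whose coefficients vanish for large `X`-index is zero. The terms
removed by `circRight` are finite combinations of derivatives of a delta function, hence annihilated
by such a power, while the defects of the desired identities are truncated. This gives stability of
associativity (`AssocAt.circRight`) and the Jacobi identity for `∘_r`
(`IsGenRightIntertwining.circRight_jacobi`). The Jacobi identity of `I₁` is associativity combined
with the definition of `∘_r` (`IsGenRightIntertwining.jacobi_sums`).

Analytic part. `HasExpansion c d` says that the iterate with coefficients `c` extends to a
multivalued sum with coefficients `d`. The series `d` is determined by `c` (`HasExpansion.unique`):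
in logarithmic coordinates the terms are separated by their behaviour under scaling and monodromy,
that is, by linear independence of characters. The relation is stable under multiplication by `z₁`
and powers of `z₂` and under differentiation in `z₁`, so identities between iterates carry over to
`φ`.

Existence of `φ`. Each homogeneous functional gives scalar coefficients, which must come from
vectors of `W₁₂₃` and not only of a completion. Absolute convergence against every homogeneous
functional forces each homogeneous part of the iterate to span a finite dimensional space
(`finiteDimensional_span_iterate`), where a dual basis produces the vectors.

Conclusion. The lower bound on `Re s_i` makes `φ_n` vanish for large `Re n`, uniformly in `w₁`. This
uniformity allows powers of `z₃ - z₂` to be cancelled and gives associativity of each `φ_n`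
(`IsIterateExtension.assocAt`). The Jacobi identity of the iterate, after multiplication by a power
of `z₃ - z₁`, gives that of `I₂` (`IsIterateExtension.jacobi_sums`); its `L(-1)`-property follows
from Euler's homogeneity relation. -/

theorem exists_nat_ge_of_int {p : ℤ → Prop} (h : ∃ N : ℤ, ∀ n ≥ N, p n) (a : ℤ) :
    ∃ K : ℕ, ∀ i : ℕ, K ≤ i → p (a + i) := by
  obtain ⟨N, hN⟩ := h
  exact ⟨(N - a).toNat, fun i hi => hN _ (by omega)⟩

section FinsumNat

variable {E : Type*} [AddCommGroup E]

theorem finsum_eq_sum_range {G : ℕ → E} {K : ℕ} (hG : ∀ i, K ≤ i → G i = 0) :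
    ∑ᶠ i, G i = ∑ i ∈ Finset.range K, G i := by
  refine finsum_eq_sum_of_support_subset _ fun i hi => ?_
  simp only [Finset.coe_range, Set.mem_Iio]
  by_contra h
  exact hi (hG i (not_lt.1 h))

theorem support_finite_of_eventually {G : ℕ → E} {K : ℕ} (hG : ∀ i, K ≤ i → G i = 0) :
    (Function.support G).Finite :=
  (Set.finite_lt_nat K).subset fun i hi => by
    by_contra h
    exact hi (hG i (not_lt.1 h))

theorem finsum_add_of_eventually {G H : ℕ → E} (hG : ∃ K, ∀ i, K ≤ i → G i = 0)
    (hH : ∃ K, ∀ i, K ≤ i → H i = 0) : ∑ᶠ i, (G i + H i) = ∑ᶠ i, G i + ∑ᶠ i, H i := by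
  obtain ⟨K, hK⟩ := hG
  obtain ⟨K', hK'⟩ := hH
  exact finsum_add_distrib (support_finite_of_eventually hK) (support_finite_of_eventually hK')

theorem finsum_sub_of_eventually {G H : ℕ → E} (hG : ∃ K, ∀ i, K ≤ i → G i = 0)
    (hH : ∃ K, ∀ i, K ≤ i → H i = 0) : ∑ᶠ i, (G i - H i) = ∑ᶠ i, G i - ∑ᶠ i, H i := by
  obtain ⟨K, hK⟩ := hG
  obtain ⟨K', hK'⟩ := hH
  exact finsum_sub_distrib (support_finite_of_eventually hK) (support_finite_of_eventually hK')

theorem finsum_eq_zero_of_forall {G : ℕ → E} (h : ∀ i, G i = 0) : ∑ᶠ i, G i = 0 := by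
  simp [h]

theorem map_finsum_of_eventually {E' : Type*} [AddCommGroup E'] (φ : E →+ E') {G : ℕ → E}
    (hG : ∃ K, ∀ i, K ≤ i → G i = 0) : φ (∑ᶠ i, G i) = ∑ᶠ i, φ (G i) := by
  obtain ⟨K, hK⟩ := hG
  exact φ.map_finsum (support_finite_of_eventually hK)

theorem eventually_smul {G : ℕ → E} (c : ℕ → ℤ) (hG : ∃ K, ∀ i, K ≤ i → G i = 0) :
    ∃ K, ∀ i, K ≤ i → c i • G i = 0 := by
  obtain ⟨K, hK⟩ := hG
  exact ⟨K, fun i hi => by rw [hK i hi, smul_zero]⟩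

theorem finsum_choose_zero (G : ℕ → E) : ∑ᶠ i : ℕ, (Ring.choose (0 : ℤ) i : ℤ) • G i = G 0 := by
  rw [finsum_eq_single _ 0]
  · simp
  · intro i hi
    rw [Ring.choose_zero_pos ℤ (Nat.pos_of_ne_zero hi), zero_smul]

/-- Pascal's rule under the summation sign. -/
theorem finsum_choose_succ {G : ℕ → E} (hG : ∃ K, ∀ i, K ≤ i → G i = 0) (l : ℤ) :
    ∑ᶠ i : ℕ, (Ring.choose (l + 1) i : ℤ) • G i
      = ∑ᶠ i : ℕ, (Ring.choose l i : ℤ) • G i + ∑ᶠ i : ℕ, (Ring.choose l i : ℤ) • G (i + 1) := by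
  obtain ⟨K, hK⟩ := hG
  rw [finsum_eq_sum_range (K := K + 1) (fun i hi => by rw [hK i (by omega), smul_zero]),
    finsum_eq_sum_range (K := K + 1) (fun i hi => by rw [hK i (by omega), smul_zero]),
    finsum_eq_sum_range (K := K) (fun i hi => by rw [hK (i + 1) (by omega), smul_zero]),
    Finset.sum_range_succ', Finset.sum_range_succ' (fun i => (Ring.choose l i : ℤ) • G i)]
  simp only [Ring.choose_succ_succ, add_smul, Finset.sum_add_distrib, Ring.choose_zero_right]
  abel

end FinsumNat

section Arrays

variable {ι E : Type*} [Ring ι] [AddCommGroup E]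

/-- Every antidiagonal of the array vanishes far down in the first index. -/
def FinDown (f : ℤ → ι → E) : Prop :=
  ∀ (p : ℤ) (n : ι), ∃ K : ℕ, ∀ i : ℕ, K ≤ i → f (p - i) (n + i) = 0

/-- Every antidiagonal of the array vanishes far up in the first index. -/
def FinUp (f : ℤ → ι → E) : Prop :=
  ∀ (p : ℤ) (n : ι), ∃ K : ℕ, ∀ i : ℕ, K ≤ i → f (p + i) (n - i) = 0

/-- The first sum of the Jacobi identity. -/
def outerSum (f : ℤ → ι → E) (l m : ℤ) (n : ι) : E :=
  ∑ᶠ i : ℕ, ((-1) ^ i * Ring.choose l i : ℤ) • f (m + l - i) (n + i)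

/-- The second sum of the Jacobi identity. -/
def innerSum (f : ℤ → ι → E) (l m : ℤ) (n : ι) : E :=
  ∑ᶠ i : ℕ, ((-1) ^ i * Ring.choose l i : ℤ) •
    ((Int.negOnePow l : ℤˣ) : ℤ) • f (m + i) (n + l - i)

/-- The third sum of the Jacobi identity. -/
def iterSum (f : ℤ → ι → E) (l m : ℤ) (n : ι) : E :=
  ∑ᶠ i : ℕ, (Ring.choose m i : ℤ) • f (l + i) (n + m - i)

theorem FinDown.eventually {f : ℤ → ι → E} (hf : FinDown f) (p : ℤ) (n : ι) (c : ℕ → ℤ) :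
    ∃ K, ∀ i : ℕ, K ≤ i → c i • f (p - i) (n + i) = 0 := by
  obtain ⟨K, hK⟩ := hf p n
  exact ⟨K, fun i hi => by rw [hK i hi, smul_zero]⟩

theorem FinUp.eventually {f : ℤ → ι → E} (hf : FinUp f) (p : ℤ) (n : ι) (c : ℕ → ℤ) :
    ∃ K, ∀ i : ℕ, K ≤ i → c i • f (p + i) (n - i) = 0 := by
  obtain ⟨K, hK⟩ := hf p n
  exact ⟨K, fun i hi => by rw [hK i hi, smul_zero]⟩

theorem FinUp.of_bound {f : ℤ → ι → E} {K : ℤ} (h : ∀ p ≥ K, ∀ n, f p n = 0) : FinUp f :=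
  fun p _ => ⟨(K - p).toNat, fun i hi => h _ (by omega) _⟩

theorem FinDown.of_bound {f : ℤ → ι → E} {K : ℤ} (h : ∀ p < K, ∀ n, f p n = 0) : FinDown f :=
  fun p _ => ⟨(p - K).toNat + 1, fun i hi => h _ (by omega) _⟩

theorem FinDown.sub {f g : ℤ → ι → E} (hf : FinDown f) (hg : FinDown g) :
    FinDown (fun p n => f p n - g p n) := fun p n => by
  obtain ⟨K, hK⟩ := hf p n
  obtain ⟨K', hK'⟩ := hg p n
  exact ⟨max K K', fun i hi => by
    beta_reduce
    rw [hK i (le_trans (le_max_left _ _) hi), hK' i (le_trans (le_max_right _ _) hi), sub_zero]⟩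

theorem FinUp.sub {f g : ℤ → ι → E} (hf : FinUp f) (hg : FinUp g) :
    FinUp (fun p n => f p n - g p n) := fun p n => by
  obtain ⟨K, hK⟩ := hf p n
  obtain ⟨K', hK'⟩ := hg p n
  exact ⟨max K K', fun i hi => by
    beta_reduce
    rw [hK i (le_trans (le_max_left _ _) hi), hK' i (le_trans (le_max_right _ _) hi), sub_zero]⟩

theorem FinDown.map {E' : Type*} [AddCommGroup E'] {f : ℤ → ι → E} (hf : FinDown f)
    (φ : E →+ E') : FinDown (fun p n => φ (f p n)) := fun p n => by
  obtain ⟨K, hK⟩ := hf p n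
  exact ⟨K, fun i hi => by beta_reduce; rw [hK i hi, map_zero]⟩

theorem FinUp.map {E' : Type*} [AddCommGroup E'] {f : ℤ → ι → E} (hf : FinUp f)
    (φ : E →+ E') : FinUp (fun p n => φ (f p n)) := fun p n => by
  obtain ⟨K, hK⟩ := hf p n
  exact ⟨K, fun i hi => by beta_reduce; rw [hK i hi, map_zero]⟩

@[simp] theorem outerSum_zero (f : ℤ → ι → E) (m : ℤ) (n : ι) : outerSum f 0 m n = f m n := by
  rw [outerSum]
  simp only [mul_comm ((-1 : ℤ) ^ _), mul_smul]
  rw [finsum_choose_zero]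
  simp

@[simp] theorem innerSum_zero (f : ℤ → ι → E) (m : ℤ) (n : ι) : innerSum f 0 m n = f m n := by
  rw [innerSum]
  simp only [mul_comm ((-1 : ℤ) ^ _), mul_smul]
  rw [finsum_choose_zero]
  simp

@[simp] theorem iterSum_zero (f : ℤ → ι → E) (l : ℤ) (n : ι) : iterSum f l 0 n = f l n := by
  rw [iterSum, finsum_choose_zero]
  simp

/-- With `f p n` read as the coefficient of `X^{-p-1} z^{-n-1}`, `outerSum` and `innerSum` multiply
by `(X - z)^l`, expanded in powers of `z` and of `X` respectively, and `iterSum` multiplies by `(z₀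
+ z₂)^m`. Splitting off one factor is Pascal's rule. The finiteness hypotheses matter because
`finsum` is zero on infinite supports. -/
theorem outerSum_succ {f : ℤ → ι → E} (hf : FinDown f) (l m : ℤ) (n : ι) :
    outerSum f (l + 1) m n = outerSum f l (m + 1) n - outerSum f l m (n + 1) := by
  have h := finsum_choose_succ (G := fun i : ℕ => (-1 : ℤ) ^ i • f (m + l + 1 - i) (n + i))
    (hf.eventually (m + l + 1) n _) l
  simp only [outerSum, mul_comm ((-1 : ℤ) ^ _), mul_smul]
  rw [show (fun i : ℕ => (Ring.choose (l + 1) i : ℤ) • (-1 : ℤ) ^ i • f (m + (l + 1) - i) (n + i))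
    = fun i : ℕ => (Ring.choose (l + 1) i : ℤ) • (-1 : ℤ) ^ i • f (m + l + 1 - i) (n + i) from
    funext fun i => by rw [add_assoc], h, sub_eq_add_neg, ← finsum_neg_distrib]
  congr 1
  · exact finsum_congr fun i => by rw [show m + l + 1 - (i : ℤ) = m + 1 + l - i by ring]
  · refine finsum_congr fun i => ?_
    rw [pow_succ, mul_neg_one, neg_smul, smul_neg, Nat.cast_succ, Nat.cast_succ,
      show m + l + 1 - ((i : ℤ) + 1) = m + l - i by ring,
      show n + ((i : ι) + 1) = n + 1 + i by abel]

theorem innerSum_succ {f : ℤ → ι → E} (hf : FinUp f) (l m : ℤ) (n : ι) :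
    innerSum f (l + 1) m n = innerSum f l (m + 1) n - innerSum f l m (n + 1) := by
  have h := finsum_choose_succ
    (G := fun i : ℕ => ((-1 : ℤ) ^ i * (Int.negOnePow (l + 1) : ℤˣ)) • f (m + i) (n + l + 1 - i))
    (hf.eventually m (n + l + 1) _) l
  simp only [innerSum, mul_comm ((-1 : ℤ) ^ _), mul_smul]
  simp only [mul_comm ((-1 : ℤ) ^ _), mul_smul] at h
  simp only [smul_comm (((-1 : ℤ) ^ _))]
  rw [show (fun i : ℕ => (Ring.choose (l + 1) i : ℤ) • ((Int.negOnePow (l + 1) : ℤˣ) : ℤ) •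
      (-1 : ℤ) ^ i • f (m + i) (n + (l + 1 : ℤ) - i))
    = fun i : ℕ => (Ring.choose (l + 1) i : ℤ) • ((Int.negOnePow (l + 1) : ℤˣ) : ℤ) •
      (-1 : ℤ) ^ i • f (m + i) (n + l + 1 - i) from
    funext fun i => by push_cast; rw [add_assoc], h, add_comm, sub_eq_add_neg,
    ← finsum_neg_distrib]
  congr 1
  · refine finsum_congr fun i => ?_
    rw [pow_succ, mul_neg_one, neg_smul, smul_neg, Nat.cast_succ, Nat.cast_succ,
      Int.negOnePow_succ, Units.val_neg, neg_smul, neg_neg,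
      show m + ((i : ℤ) + 1) = m + 1 + i by ring,
      show n + l + 1 - ((i : ι) + 1) = n + l - i by abel]
  · refine finsum_congr fun i => ?_
    rw [Int.negOnePow_succ, Units.val_neg, neg_smul, smul_neg,
      show n + (l : ι) + 1 - i = n + 1 + l - i by abel]

theorem iterSum_succ {f : ℤ → ι → E} (hf : FinUp f) (l m : ℤ) (n : ι) :
    iterSum f l (m + 1) n = iterSum f l m (n + 1) + iterSum f (l + 1) m n := by
  have h := finsum_choose_succ (G := fun i : ℕ => f (l + i) (n + m + 1 - i))
    (hf l (n + m + 1)) m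
  simp only [iterSum]
  rw [show (fun i : ℕ => (Ring.choose (m + 1) i : ℤ) • f (l + i) (n + (m + 1 : ℤ) - i))
    = fun i : ℕ => (Ring.choose (m + 1) i : ℤ) • f (l + i) (n + m + 1 - i) from
    funext fun i => by push_cast; rw [add_assoc], h]
  congr 1
  · exact finsum_congr fun i => by rw [show n + (m : ι) + 1 - i = n + 1 + m - i by abel]
  · refine finsum_congr fun i => ?_
    rw [Nat.cast_succ, Nat.cast_succ, show l + ((i : ℤ) + 1) = l + 1 + i by ring,
      show n + m + 1 - ((i : ι) + 1) = n + m - i by abel]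

theorem outerSum_sub {f g : ℤ → ι → E} (hf : FinDown f) (hg : FinDown g) (l m : ℤ) (n : ι) :
    outerSum (fun p n => f p n - g p n) l m n = outerSum f l m n - outerSum g l m n := by
  simp only [outerSum, smul_sub]
  exact finsum_sub_of_eventually (hf.eventually _ _ _) (hg.eventually _ _ _)

theorem innerSum_sub {f g : ℤ → ι → E} (hf : FinUp f) (hg : FinUp g) (l m : ℤ) (n : ι) :
    innerSum (fun p n => f p n - g p n) l m n = innerSum f l m n - innerSum g l m n := by
  simp only [innerSum, smul_sub]
  refine finsum_sub_of_eventually (eventually_smul _ ?_) (eventually_smul _ ?_)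
  exacts [hf.eventually _ _ _, hg.eventually _ _ _]

theorem iterSum_sub {f g : ℤ → ι → E} (hf : FinUp f) (hg : FinUp g) (l m : ℤ) (n : ι) :
    iterSum (fun p n => f p n - g p n) l m n = iterSum f l m n - iterSum g l m n := by
  simp only [iterSum, smul_sub]
  exact finsum_sub_of_eventually (hf.eventually _ _ _) (hg.eventually _ _ _)

theorem map_outerSum {E' : Type*} [AddCommGroup E'] (φ : E →+ E') {f : ℤ → ι → E}
    (hf : FinDown f) (l m : ℤ) (n : ι) :
    φ (outerSum f l m n) = outerSum (fun p n => φ (f p n)) l m n := by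
  simp only [outerSum, map_finsum_of_eventually φ (hf.eventually _ _ _), map_zsmul]

theorem map_innerSum {E' : Type*} [AddCommGroup E'] (φ : E →+ E') {f : ℤ → ι → E}
    (hf : FinUp f) (l m : ℤ) (n : ι) :
    φ (innerSum f l m n) = innerSum (fun p n => φ (f p n)) l m n := by
  simp only [innerSum]
  rw [map_finsum_of_eventually φ (eventually_smul _ (hf.eventually _ _ _))]
  simp only [map_zsmul]

theorem map_iterSum {E' : Type*} [AddCommGroup E'] (φ : E →+ E') {f : ℤ → ι → E}
    (hf : FinUp f) (l m : ℤ) (n : ι) :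
    φ (iterSum f l m n) = iterSum (fun p n => φ (f p n)) l m n := by
  simp only [iterSum, map_finsum_of_eventually φ (hf.eventually _ _ _), map_zsmul]

theorem innerSum_eq_zero {f : ℤ → ι → E} {l m : ℤ} {n : ι}
    (h : ∀ i : ℕ, f (m + i) (n + l - i) = 0) : innerSum f l m n = 0 :=
  finsum_eq_zero_of_forall fun i => by rw [h, smul_zero, smul_zero]

theorem iterSum_eq_zero {f : ℤ → ι → E} {l m : ℤ} {n : ι}
    (h : ∀ i : ℕ, f (l + i) (n + m - i) = 0) : iterSum f l m n = 0 :=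
  finsum_eq_zero_of_forall fun i => by rw [h, smul_zero]

theorem outerSum_eq_zero {f : ℤ → ι → E} {l m : ℤ} {n : ι}
    (h : ∀ i : ℕ, f (m + l - i) (n + i) = 0) : outerSum f l m n = 0 :=
  finsum_eq_zero_of_forall fun i => by rw [h, smul_zero]

/-- For a nonnegative exponent the third sum is finite. -/
theorem iterSum_natCast (f : ℤ → ι → E) (l : ℤ) (k : ℕ) (n : ι) :
    iterSum f l k n = ∑ i ∈ Finset.range (k + 1), (k.choose i : ℤ) • f (l + i) (n + k - i) := by
  rw [iterSum, finsum_eq_sum_range (K := k + 1)]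
  · simp [Ring.choose_natCast]
  · intro i hi
    rw [Ring.choose_natCast, Nat.choose_eq_zero_of_lt hi]
    simp

/-! ### Multiplication by `X - z` and its cancellation. -/

variable (ι E) in
/-- Coefficients of `(X - z) g`, where `X` shifts the first and `z` the second index. -/
def dif : Module.End ℤ (ℤ → ι → E) where
  toFun g := fun p n => g (p + 1) n - g p (n + 1)
  map_add' g h := by ext p n; simp only [Pi.add_apply]; abel
  map_smul' c g := by ext p n; simp [smul_sub]

theorem dif_apply (g : ℤ → ι → E) (p : ℤ) (n : ι) : dif ι E g p n = g (p + 1) n - g p (n + 1) := rfl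

theorem dif_pow_succ (g : ℤ → ι → E) (q : ℕ) : (dif ι E ^ (q + 1)) g = (dif ι E ^ q) (dif ι E g) := by
  rw [pow_succ]; rfl

theorem dif_pow_succ' (g : ℤ → ι → E) (q : ℕ) : (dif ι E ^ (q + 1)) g = dif ι E ((dif ι E ^ q) g) := by
  rw [pow_succ']; rfl

theorem dif_pow_eq_zero_of_le {g : ℤ → ι → E} {q q' : ℕ} (hq : q ≤ q') (h : (dif ι E ^ q) g = 0) :
    (dif ι E ^ q') g = 0 := by
  rw [← Nat.sub_add_cancel hq, pow_add, Module.End.mul_apply, h, map_zero]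

/-- Here `X = z₀ + z`, so `X - z` acts as `z₀` and raises the `z₀`-index `l`. Once `l + q` passes
the truncation bound nothing is left, whence the vanishing lemma that follows. -/
theorem dif_pow_iterSum {f : ℤ → ι → E} (hf : FinUp f) (l : ℤ) (q : ℕ) :
    (dif ι E ^ q) (fun m n => iterSum f l m n) = fun m n => iterSum f (l + q) m n := by
  induction q generalizing l with
  | zero => simp
  | succ q ih =>
    have : dif ι E (fun m n => iterSum f l m n) = fun m n => iterSum f (l + 1) m n := by
      ext m n
      rw [dif_apply, iterSum_succ hf]
      abel
    rw [dif_pow_succ, this, ih]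
    simp only [Nat.cast_succ, add_assoc, add_comm (1 : ℤ)]

theorem dif_pow_iterSum_eq_zero {f : ℤ → ι → E} (hf : FinUp f) {l : ℤ} {q : ℕ}
    (h : ∀ j ≥ l + q, ∀ n, f j n = 0) : (dif ι E ^ q) (fun m n => iterSum f l m n) = 0 := by
  rw [dif_pow_iterSum hf]
  ext m n
  exact iterSum_eq_zero fun i => h _ (by omega) _

/-- `dif` reads only the first indices `p` and `p + 1`, so its powers never look below `p`.
Relations known only on a half-line of first indices can therefore be used there. -/
theorem dif_pow_congr_of_ge {g g' : ℤ → ι → E} {a : ℤ} (h : ∀ p ≥ a, ∀ n, g p n = g' p n) (q : ℕ) :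
    ∀ p ≥ a, ∀ n, (dif ι E ^ q) g p n = (dif ι E ^ q) g' p n := by
  induction q generalizing g g' with
  | zero => simpa using h
  | succ q ih =>
    rw [dif_pow_succ, dif_pow_succ]
    exact ih fun p hp n => by rw [dif_apply, dif_apply, h _ (by omega), h _ hp]

theorem dif_pow_translate (g : ℤ → ι → E) (q : ℕ) (a : ℤ) (b : ι) :
    (dif ι E ^ q) (fun p n => g (p + a) (n + b)) = fun p n => (dif ι E ^ q) g (p + a) (n + b) := by
  induction q generalizing g with
  | zero => simp
  | succ q ih =>
    rw [dif_pow_succ, dif_pow_succ, ← ih]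
    congr 1
    ext p n
    rw [dif_apply, dif_apply, add_right_comm, add_right_comm n]

theorem dif_pow_finsum {F : ℕ → ℤ → ι → E} (hF : ∀ p n, ∃ K, ∀ i, K ≤ i → F i p n = 0) (c : ℕ → ℤ)
    (q : ℕ) : (dif ι E ^ q) (fun p n => ∑ᶠ i, c i • F i p n)
      = fun p n => ∑ᶠ i, c i • (dif ι E ^ q) (F i) p n := by
  induction q generalizing F with
  | zero => simp
  | succ q ih =>
    simp only [dif_pow_succ]
    rw [← ih]
    · congr 1
      ext p n
      simp only [dif_apply, smul_sub]
      exact (finsum_sub_of_eventually (eventually_smul c (hF _ _)) (eventually_smul c (hF _ _))).symm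
    · intro p n
      obtain ⟨K, hK⟩ := hF (p + 1) n
      obtain ⟨K', hK'⟩ := hF p (n + 1)
      exact ⟨max K K', fun i hi => by
        rw [dif_apply, hK i (le_trans (le_max_left _ _) hi),
          hK' i (le_trans (le_max_right _ _) hi), sub_zero]⟩

/-- If `(X - z) g = 0` then `g` is constant along antidiagonals, `g p n = g (p + 1) (n - 1)`, and
following one upwards reaches the region where `g` vanishes. Factors are removed one at a time,
since `dif g` inherits the truncation. -/
theorem eq_zero_of_dif_pow_eq_zero {g : ℤ → ι → E} {q : ℕ} {a : ℤ}
    (hq : ∀ p ≥ a, ∀ n, (dif ι E ^ q) g p n = 0) (hb : ∃ b : ℤ, ∀ p ≥ b, ∀ n, g p n = 0) :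
    ∀ p ≥ a, ∀ n, g p n = 0 := by
  induction q generalizing g with
  | zero => simpa using hq
  | succ q ih =>
    obtain ⟨b, hb⟩ := hb
    have h1 : ∀ p ≥ a, ∀ n, dif ι E g p n = 0 := ih (by simpa only [dif_pow_succ] using hq)
      ⟨b, fun p hp n => by rw [dif_apply, hb _ (by omega), hb _ hp, sub_zero]⟩
    have h2 : ∀ k : ℕ, ∀ p ≥ a, b ≤ p + k → ∀ n, g p n = 0 := by
      intro k
      induction k with
      | zero => intro p _ hk n; exact hb p (by simpa using hk) n
      | succ k ihk =>
        intro p hp hk n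
        have h := h1 p hp (n - 1)
        rw [dif_apply, sub_add_cancel, ihk (p + 1) (by omega) (by push_cast at hk; omega) (n - 1),
          zero_sub, neg_eq_zero] at h
        exact h
    exact fun p hp n => h2 (b - p).toNat p hp (by omega) n

end Arrays

/-! ### Arrays with two mode indices. -/

section Arrays3

variable {κ E : Type*} [Ring κ] [AddCommGroup E]

variable (κ E) in
/-- `dif` with respect to the first and the third index. -/
def difFst : Module.End ℤ (ℤ → ℤ → κ → E) where
  toFun g := fun p s n => g (p + 1) s n - g p s (n + 1)
  map_add' g h := by ext p s n; simp only [Pi.add_apply]; abel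
  map_smul' c g := by ext p s n; simp [smul_sub]

variable (κ E) in
/-- `dif` with respect to the second and the third index. -/
def difSnd : Module.End ℤ (ℤ → ℤ → κ → E) where
  toFun g := fun p s n => g p (s + 1) n - g p s (n + 1)
  map_add' g h := by ext p s n; simp only [Pi.add_apply]; abel
  map_smul' c g := by ext p s n; simp [smul_sub]

theorem difFst_pow_apply (g : ℤ → ℤ → κ → E) (q : ℕ) (p s : ℤ) (n : κ) :
    (difFst κ E ^ q) g p s n = (dif κ E ^ q) (fun p n => g p s n) p n := by
  induction q generalizing g with
  | zero => rfl
  | succ q ih => rw [dif_pow_succ, pow_succ, Module.End.mul_apply, ih]; rfl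

theorem difSnd_pow_apply (g : ℤ → ℤ → κ → E) (q : ℕ) (p s : ℤ) (n : κ) :
    (difSnd κ E ^ q) g p s n = (dif κ E ^ q) (fun s n => g p s n) s n := by
  induction q generalizing g with
  | zero => rfl
  | succ q ih => rw [dif_pow_succ, pow_succ, Module.End.mul_apply, ih]; rfl

theorem difFst_difSnd_commute : Commute (difFst κ E) (difSnd κ E) := by
  refine LinearMap.ext fun g => ?_
  ext p s n
  simp only [Module.End.mul_apply, difFst, difSnd, LinearMap.coe_mk, AddHom.coe_mk]
  abel

/-- Each of the three sums is a locally finite combination of translates of the array, and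
multiplication by `X - z` or `Y - z` commutes with translation; hence annihilation passes to the
sums. -/
theorem difFst_pow_outerSum {f : ℤ → ℤ → κ → E} (hf : ∀ n, FinDown fun p s => f p s n) (l : ℤ)
    {q : ℕ} (h : (difFst κ E ^ q) f = 0) :
    (difFst κ E ^ q) (fun m s n => outerSum (fun p s => f p s n) l m s) = 0 := by
  ext m s n
  rw [difFst_pow_apply]
  have key := dif_pow_finsum (F := fun i p n => f (p + (l - i)) (s + i) (n + 0))
    (fun p n => by simpa only [add_zero, add_sub_assoc] using hf n (p + l) s)
    (fun i => (-1) ^ i * Ring.choose l i) q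
  have h' : ∀ i : ℕ, (dif κ E ^ q) (fun p n => f (p + (l - i)) (s + i) (n + 0)) = 0 := by
    intro i
    rw [dif_pow_translate (fun p n => f p (s + i) n) q (l - i) 0]
    ext p n
    rw [← difFst_pow_apply, h]; rfl
  simp only [add_zero] at key h'
  simp only [outerSum, add_sub_assoc]
  rw [key]
  simp [h']

theorem difSnd_pow_outerSum {f : ℤ → ℤ → κ → E} (hf : ∀ n, FinDown fun p s => f p s n) (l : ℤ)
    {q : ℕ} (h : (difSnd κ E ^ q) f = 0) :
    (difSnd κ E ^ q) (fun m s n => outerSum (fun p s => f p s n) l m s) = 0 := by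
  ext m s n
  rw [difSnd_pow_apply]
  have key := dif_pow_finsum (F := fun i s n => f (m + l - i) (s + i) (n + 0))
    (fun s n => by simpa only [add_zero] using hf n (m + l) s)
    (fun i => (-1) ^ i * Ring.choose l i) q
  have h' : ∀ i : ℕ, (dif κ E ^ q) (fun s n => f (m + l - i) (s + i) (n + 0)) = 0 := by
    intro i
    rw [dif_pow_translate (fun s n => f (m + l - i) s n) q i 0]
    ext s n
    rw [← difSnd_pow_apply, h]; rfl
  simp only [add_zero] at key h'
  simp only [outerSum]
  rw [key]
  simp [h']

theorem difFst_pow_innerSum {f : ℤ → ℤ → κ → E} (hf : ∀ n, FinUp fun p s => f p s n) (l : ℤ)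
    {q : ℕ} (h : (difFst κ E ^ q) f = 0) :
    (difFst κ E ^ q) (fun m s n => innerSum (fun p s => f p s n) l m s) = 0 := by
  ext m s n
  rw [difFst_pow_apply]
  have key := dif_pow_finsum (F := fun i p n => f (p + i) (s + l - i) (n + 0))
    (fun p n => by simpa only [add_zero] using hf n p (s + l))
    (fun i => (-1) ^ i * Ring.choose l i * ((Int.negOnePow l : ℤˣ) : ℤ)) q
  have h' : ∀ i : ℕ, (dif κ E ^ q) (fun p n => f (p + i) (s + l - i) (n + 0)) = 0 := by
    intro i
    rw [dif_pow_translate (fun p n => f p (s + l - i) n) q i 0]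
    ext p n
    rw [← difFst_pow_apply, h]; rfl
  simp only [add_zero, mul_smul _ ((Int.negOnePow l : ℤˣ) : ℤ)] at key h'
  simp only [innerSum, Int.cast_id]
  rw [key]
  simp [h']

theorem difSnd_pow_innerSum {f : ℤ → ℤ → κ → E} (hf : ∀ n, FinUp fun p s => f p s n) (l : ℤ)
    {q : ℕ} (h : (difSnd κ E ^ q) f = 0) :
    (difSnd κ E ^ q) (fun m s n => innerSum (fun p s => f p s n) l m s) = 0 := by
  ext m s n
  rw [difSnd_pow_apply]
  have key := dif_pow_finsum (F := fun i s n => f (m + i) (s + (l - i)) (n + 0))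
    (fun s n => by simpa only [add_zero, add_sub_assoc] using hf n m (s + l))
    (fun i => (-1) ^ i * Ring.choose l i * ((Int.negOnePow l : ℤˣ) : ℤ)) q
  have h' : ∀ i : ℕ, (dif κ E ^ q) (fun s n => f (m + i) (s + (l - i)) (n + 0)) = 0 := by
    intro i
    rw [dif_pow_translate (fun s n => f (m + i) s n) q (l - i) 0]
    ext s n
    rw [← difSnd_pow_apply, h]; rfl
  simp only [add_zero, mul_smul _ ((Int.negOnePow l : ℤˣ) : ℤ)] at key h'
  simp only [innerSum, Int.cast_id, add_sub_assoc]
  rw [key]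
  simp [h']

/-- The third sum starts at first index `l`, so only the slices with index at least `l` need to be
annihilated. A common exponent for these slices exists because all but finitely many of them vanish
in the application. -/
theorem difSnd_pow_iterSum {f : ℤ → ℤ → κ → E} (hf : ∀ n, FinUp fun p s => f p s n) (l : ℤ)
    {q : ℕ} (h : ∀ j ≥ l, (dif κ E ^ q) (f j) = 0) :
    (difSnd κ E ^ q) (fun m s n => iterSum (fun p s => f p s n) l m s) = 0 := by
  ext m s n
  rw [difSnd_pow_apply]
  have key := dif_pow_finsum (F := fun i s n => f (l + i) (s + (m - i)) (n + 0))
    (fun s n => by simpa only [add_zero, add_sub_assoc] using hf n l (s + m))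
    (fun i => Ring.choose m i) q
  have h' : ∀ i : ℕ, (dif κ E ^ q) (fun s n => f (l + i) (s + (m - i)) (n + 0)) = 0 := by
    intro i
    rw [dif_pow_translate (fun s n => f (l + i) s n) q (m - i) 0]
    ext s n
    rw [show (fun s n => f (l + i) s n) = f (l + i) from rfl, h _ (by omega)]; rfl
  simp only [add_zero] at key h'
  simp only [iterSum, Int.cast_id, add_sub_assoc]
  rw [key]
  simp [h']

end Arrays3

/-! ### Pascal recurrences, uniform truncation and the Jacobi identity in sums. -/

noncomputable section

/-- This is the mechanism by which a commutator-type formula (`l = 0`) and associativity (`m ≥ k`)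
imply the full Jacobi identity. Nonnegative `l` follow from `l = 0` by the recurrence. For negative
`l` it is solved as `D l m n = D l (m+1) (n-1) - D (l+1) m (n-1)`, by induction downwards on `m` and
then on `l`. -/
theorem eq_zero_of_pascal {ι E : Type*} [Ring ι] [AddCommGroup E] {D : ℤ → ℤ → ι → E}
    (hD : ∀ l m n, D (l + 1) m n = D l (m + 1) n - D l m (n + 1)) (h0 : ∀ m n, D 0 m n = 0)
    {k : ℤ} (hk : ∀ l n, ∀ m ≥ k, D l m n = 0) (l m : ℤ) (n : ι) : D l m n = 0 := by
  have hnat : ∀ (i : ℕ) m n, D i m n = 0 := by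
    intro i
    induction i with
    | zero => simpa using h0
    | succ i ih => intro m n; rw [Nat.cast_succ, hD, ih, ih, sub_zero]
  have hdown : ∀ (j : ℕ) l n, ∀ m, k ≤ m + j → D l m n = 0 := by
    intro j
    induction j with
    | zero => intro l n m hm; exact hk l n m (by simpa using hm)
    | succ j ih =>
      intro l n m hm
      have step : ∀ (i : ℕ) (l : ℤ) n, 0 ≤ l + i → D l m n = 0 := by
        intro i
        induction i with
        | zero =>
          intro l n hl
          lift l to ℕ using by simpa using hl
          exact hnat l m n
        | succ i ihi =>
          intro l n hl
          have h := hD l m (n - 1)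
          rw [sub_add_cancel, ihi (l + 1) (n - 1) (by push_cast at hl; omega),
            ih l (n - 1) (m + 1) (by push_cast at hm; omega), zero_sub] at h
          exact neg_eq_zero.1 h.symm
      exact step (-l).toNat l n (by omega)
  exact hdown (k - m).toNat l n m (by omega)

theorem exists_forall_lt_of_eventually {p : ℕ → ℤ → Prop} (h : ∀ i, ∃ N : ℤ, ∀ x ≥ N, p i x)
    (I : ℕ) : ∃ N : ℤ, ∀ i < I, ∀ x ≥ N, p i x := by
  choose N hN using h
  induction I with
  | zero => exact ⟨0, fun i hi => absurd hi (Nat.not_lt_zero i)⟩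
  | succ I ih =>
    obtain ⟨M, hM⟩ := ih
    refine ⟨max M (N I), fun i hi x hx => ?_⟩
    rcases Nat.lt_succ_iff_lt_or_eq.1 hi with h | rfl
    · exact hM i h x (le_trans (le_max_left _ _) hx)
    · exact hN _ x (le_trans (le_max_right _ _) hx)

/-- Uniform version of eventual vanishing when all but finitely many members of the family
vanish identically. -/
theorem exists_uniform_of_eventually {p : ℕ → ℤ → Prop} (h : ∀ i, ∃ N : ℤ, ∀ x ≥ N, p i x)
    {I : ℕ} (hI : ∀ i, I ≤ i → ∀ x, p i x) : ∃ N : ℤ, ∀ i, ∀ x ≥ N, p i x := by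
  obtain ⟨N, hN⟩ := exists_forall_lt_of_eventually h I
  exact ⟨N, fun i x hx => (lt_or_ge i I).elim (fun hi => hN i hi x hx) fun hi => hI i hi x⟩

theorem succ_mul_choose_succ (m : ℤ) (i : ℕ) :
    ((i : ℤ) + 1) * Ring.choose m (i + 1) = (m - i) * Ring.choose m i := by
  have h1 := Ring.descPochhammer_eq_factorial_smul_choose m (i + 1)
  have h2 := Ring.descPochhammer_eq_factorial_smul_choose m i
  rw [descPochhammer_succ_right, Polynomial.smeval_mul, h2] at h1
  have hf : (i.factorial : ℤ) ≠ 0 := by exact_mod_cast i.factorial_ne_zero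
  apply mul_left_cancel₀ hf
  rw [Nat.factorial_succ] at h1
  simp [Polynomial.smeval_sub, Polynomial.smeval_X, Polynomial.smeval_natCast] at h1
  linarith

/-- The derivative of `(z + x)^m` under the summation sign. -/
theorem finsum_choose_derivative {E : Type*} [AddCommGroup E] {G : ℕ → E}
    (hG : ∃ K, ∀ i, K ≤ i → G i = 0) (m : ℤ) :
    ∑ᶠ i : ℕ, (Ring.choose m i * i : ℤ) • G (i - 1)
      = ∑ᶠ i : ℕ, (Ring.choose m i * (m - i) : ℤ) • G i := by
  obtain ⟨K, hK⟩ := hG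
  rw [finsum_eq_sum_range (K := K + 1) (fun i hi => by rw [hK (i - 1) (by omega), smul_zero]),
    finsum_eq_sum_range (K := K) (fun i hi => by rw [hK i (by omega), smul_zero]),
    Finset.sum_range_succ']
  simp only [Nat.cast_zero, mul_zero, zero_smul, add_zero, Nat.add_sub_cancel]
  refine Finset.sum_congr rfl fun i _ => ?_
  rw [mul_comm (Ring.choose m i), ← succ_mul_choose_succ]
  push_cast
  rw [mul_comm]

section Jacobi

variable {ι V W₁ W₂ W₃ : Type*} [Ring ι]
    [AddCommGroup V] [Module ℂ V] [AddCommGroup W₁] [Module ℂ W₁]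
    [AddCommGroup W₂] [Module ℂ W₂] [AddCommGroup W₃] [Module ℂ W₃]
    {Y₁ : V →ₗ[ℂ] ℤ → Module.End ℂ W₁} {Y₂ : V →ₗ[ℂ] ℤ → Module.End ℂ W₂}
    {Y₃ : V →ₗ[ℂ] ℤ → Module.End ℂ W₃} {I : W₁ →ₗ[ℂ] ι → (W₂ →ₗ[ℂ] W₃)}

/-- Splitting the sum of differences needs both families to be finite separately. The two hypotheses
are those truncations, and afterwards each sum obeys its own recurrence. -/
theorem jacobi_sums_iff {a : V} {w : W₁} {u : W₂}
    (hd : FinDown fun p n => Y₃ a p (I w n u)) (hu : FinUp fun p n => I w n (Y₂ a p u))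
    (l m : ℤ) (n : ι) :
    (∑ᶠ i : ℕ, ((-1) ^ i * Ring.choose l i : ℤ) •
        (Y₃ a (m + l - i) (I w (n + i) u)
          - ((Int.negOnePow l : ℤˣ) : ℤ) • I w (n + l - i) (Y₂ a (m + i) u)))
      = ∑ᶠ i : ℕ, (Ring.choose m i : ℤ) • I (Y₁ a (l + i) w) (n + m - i) u ↔
    outerSum (fun p n => Y₃ a p (I w n u)) l m n - innerSum (fun p n => I w n (Y₂ a p u)) l m n
      = iterSum (fun p n => I (Y₁ a p w) n u) l m n := by
  simp only [smul_sub]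
  rw [finsum_sub_of_eventually (hd.eventually (m + l) n _)
    (eventually_smul _ (hu.eventually m (n + l) _))]
  rfl

end Jacobi

/-! ### Modes of weak modules and of intertwining operators. -/

section WeakModules

variable {V : Type v} [AddCommGroup V] [Module ℂ V] [VertexOperatorAlgebra V]
  {W₁ W₂ W₃ : Type u} [AddCommGroup W₁] [Module ℂ W₁] [AddCommGroup W₂] [Module ℂ W₂]
  [AddCommGroup W₃] [Module ℂ W₃]

open VertexOperatorAlgebra (conf)

namespace WeakModule

theorem finDown_comp (S : WeakModule V W₂) (a : V) {f : ℂ → W₂}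
    (hf : ∀ α : ℂ, ∃ N : ℤ, ∀ j ≥ N, f (α + j) = 0) : FinDown fun p n => S.Y a p (f n) :=
  fun p n => by
    obtain ⟨N, hN⟩ := hf n
    refine ⟨N.toNat, fun i hi => ?_⟩
    have := hN i (by omega)
    rw [Int.cast_natCast] at this
    beta_reduce
    rw [this, map_zero]

theorem finDown_mode (S : WeakModule V W₁) (a b : V) (u : W₁) :
    FinDown fun p n => S.Y a p (S.Y b n u) := fun p n => by
  obtain ⟨N, hN⟩ := S.truncation b u
  exact ⟨(N - n).toNat, fun i hi => by
    beta_reduce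
    rw [hN _ (by omega), map_zero]⟩

theorem finUp_mode {ι E : Type*} [Ring ι] [AddCommGroup E] [Module ℂ E] (S : WeakModule V W₁)
    (a : V) (u : W₁) (f : ι → W₁ →ₗ[ℂ] E) : FinUp fun p n => f n (S.Y a p u) := by
  obtain ⟨N, hN⟩ := S.truncation a u
  exact FinUp.of_bound fun p hp n => by rw [hN p hp, map_zero]

/-- The Jacobi identity of a weak module in terms of the three sums. -/
theorem jacobi_sums (S : WeakModule V W₁) (a b : V) (u : W₁) (l m n : ℤ) :
    outerSum (fun p n => S.Y a p (S.Y b n u)) l m n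
        - innerSum (fun p n => S.Y b n (S.Y a p u)) l m n
      = iterSum (fun p n => S.Y (VertexOperatorAlgebra.Y a p b) n u) l m n :=
  (jacobi_sums_iff (S.finDown_mode a b u) (S.finUp_mode a u _) l m n).1 (S.jacobi a b u l m n)

/-- The commutator formula. -/
theorem commutator (S : WeakModule V W₁) (a b : V) (u : W₁) (m n : ℤ) :
    S.Y a m (S.Y b n u) - S.Y b n (S.Y a m u)
      = iterSum (fun p n => S.Y (VertexOperatorAlgebra.Y a p b) n u) 0 m n := by
  simpa using S.jacobi_sums a b u 0 m n

theorem mode_L_neg_one (S : WeakModule V W₁) (a : V) (n : ℤ) (u : W₁) :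
    S.Y a n (S.L (-1) u) = S.L (-1) (S.Y a n u) + (n : ℂ) • S.Y a (n - 1) u := by
  have h := S.commutator conf a u 0 n
  rw [iterSum_zero, S.derivative] at h
  simp only [L, Int.reduceNeg, neg_add_cancel]
  rw [LinearMap.smul_apply, neg_smul] at h
  rw [← sub_eq_iff_eq_add', ← neg_sub, h, neg_neg]

end WeakModule

variable {S₁ : WeakModule V W₁} {S₂ : WeakModule V W₂} {S₃ : WeakModule V W₃}

namespace IntertwiningOperator

theorem finDown_mode (I : IntertwiningOperator S₁ S₂ S₃) (a : V) (w : W₁) (u : W₂) :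
    FinDown fun p n => S₃.Y a p (I.mode w n u) := S₃.finDown_comp a (I.truncation w u)

/-- The Jacobi identity of an intertwining operator in terms of the three sums. -/
theorem jacobi_sums (I : IntertwiningOperator S₁ S₂ S₃) (a : V) (w : W₁) (u : W₂) (l m : ℤ)
    (n : ℂ) :
    outerSum (fun p n => S₃.Y a p (I.mode w n u)) l m n
        - innerSum (fun p n => I.mode w n (S₂.Y a p u)) l m n
      = iterSum (fun p n => I.mode (S₁.Y a p w) n u) l m n :=
  (jacobi_sums_iff (I.finDown_mode a w u) (S₂.finUp_mode a u _) l m n).1 (I.jacobi a w u l m n)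

theorem commutator (I : IntertwiningOperator S₁ S₂ S₃) (a : V) (w : W₁) (u : W₂) (m : ℤ)
    (n : ℂ) :
    S₃.Y a m (I.mode w n u) - I.mode w n (S₂.Y a m u)
      = iterSum (fun p n => I.mode (S₁.Y a p w) n u) 0 m n := by
  simpa using I.jacobi_sums a w u 0 m n

theorem finUp_left (I : IntertwiningOperator S₁ S₂ S₃) (a : V) (w : W₁) (u : W₂) :
    FinUp fun p n => I.mode (S₁.Y a p w) n u := by
  obtain ⟨N, hN⟩ := S₁.truncation a w
  exact FinUp.of_bound fun p hp n => by rw [hN p hp, map_zero]; rfl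

end IntertwiningOperator

/-! ### Generalized right intertwining operators -/

/-- The associativity relation with exponent `k` for `a`. -/
def AssocAt (S₁ : WeakModule V W₁) (S₂ : WeakModule V W₂) (Φ : ℂ → (W₁ →ₗ[ℂ] W₂)) (a : V)
    (k : ℤ) : Prop :=
  ∀ (u : W₁) (l : ℤ) (n : ℂ), outerSum (fun p n => S₂.Y a p (Φ n u)) l k n
    = iterSum (fun p n => Φ n (S₁.Y a p u)) l k n

/-- The regular part `Res_{z₀} (z₂ + z₀)^m Φ(z₂) Y(a,z₀) u` of the action on the right. -/
def resRight (S₁ : WeakModule V W₁) (a : V) (Φ : ℂ → (W₁ →ₗ[ℂ] W₂)) (u : W₁) (m : ℤ) (n : ℂ) :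
    W₂ :=
  iterSum (fun p n => Φ n (S₁.Y a p u)) 0 m n

theorem circRight_apply (a : V) (m : ℤ) (Φ : ℂ → (W₁ →ₗ[ℂ] W₂)) (n : ℂ) (u : W₁) :
    circRight S₁ S₂ a m Φ n u = S₂.Y a m (Φ n u) - resRight S₁ a Φ u m n := by
  simp only [circRight, resRight, iterSum, zero_add]
  rfl

/-- The part removed by `∘_r` involves only `a_0 u, …, a_{q-1} u`. It is a combination of
derivatives of order less than `q` of a delta function supported at `X = z₂`, so `(X - z₂)^q`
annihilates it. -/
theorem dif_pow_resRight {a : V} {Φ : ℂ → (W₁ →ₗ[ℂ] W₂)} {u : W₁} {q : ℕ}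
    (hq : ∀ j ≥ (q : ℤ), S₁.Y a j u = 0) :
    (dif ℂ W₂ ^ q) (fun m n => resRight S₁ a Φ u m n) = 0 :=
  dif_pow_iterSum_eq_zero (S₁.finUp_mode a u _) fun j hj n => by
    rw [hq j (by simpa using hj), map_zero]

section Circ

variable (S₁ S₂)

theorem resRight_add_op (a : V) (Φ Ψ : ℂ → (W₁ →ₗ[ℂ] W₂)) (u : W₁) (m : ℤ) (n : ℂ) :
    resRight S₁ a (Φ + Ψ) u m n = resRight S₁ a Φ u m n + resRight S₁ a Ψ u m n := by
  simp only [resRight, iterSum, Pi.add_apply, LinearMap.add_apply, smul_add]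
  exact finsum_add_of_eventually ((S₁.finUp_mode a u Φ).eventually 0 (n + m) _)
    ((S₁.finUp_mode a u Ψ).eventually 0 (n + m) _)

theorem circRight_add_op (a : V) (m : ℤ) (Φ Ψ : ℂ → (W₁ →ₗ[ℂ] W₂)) :
    circRight S₁ S₂ a m (Φ + Ψ) = circRight S₁ S₂ a m Φ + circRight S₁ S₂ a m Ψ := by
  ext n u
  simp only [circRight_apply, resRight_add_op, Pi.add_apply, LinearMap.add_apply, map_add]
  abel

theorem circRight_smul_op (a : V) (m : ℤ) (c : ℂ) (Φ : ℂ → (W₁ →ₗ[ℂ] W₂)) :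
    circRight S₁ S₂ a m (c • Φ) = c • circRight S₁ S₂ a m Φ := by
  ext n u
  simp only [circRight_apply, Pi.smul_apply, LinearMap.smul_apply, map_smul, smul_sub]
  congr 1
  simp only [resRight, iterSum, smul_finsum, Pi.smul_apply, LinearMap.smul_apply]
  exact finsum_congr fun i => smul_comm _ _ _

theorem circRight_zero_op (a : V) (m : ℤ) :
    circRight S₁ S₂ a m (0 : ℂ → (W₁ →ₗ[ℂ] W₂)) = 0 := by
  have := circRight_smul_op S₁ S₂ a m 0 0
  simpa using this

theorem circRight_add_vec (a b : V) (m : ℤ) (Φ : ℂ → (W₁ →ₗ[ℂ] W₂)) :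
    circRight S₁ S₂ (a + b) m Φ = circRight S₁ S₂ a m Φ + circRight S₁ S₂ b m Φ := by
  ext n u
  have h : resRight S₁ (a + b) Φ u m n = resRight S₁ a Φ u m n + resRight S₁ b Φ u m n := by
    simp only [resRight, iterSum, map_add, Pi.add_apply, LinearMap.add_apply, smul_add]
    exact finsum_add_of_eventually ((S₁.finUp_mode a u Φ).eventually 0 (n + m) _)
      ((S₁.finUp_mode b u Φ).eventually 0 (n + m) _)
  simp only [circRight_apply, h, map_add, Pi.add_apply, LinearMap.add_apply]
  abel

theorem circRight_smul_vec (c : ℂ) (a : V) (m : ℤ) (Φ : ℂ → (W₁ →ₗ[ℂ] W₂)) :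
    circRight S₁ S₂ (c • a) m Φ = c • circRight S₁ S₂ a m Φ := by
  ext n u
  simp only [circRight_apply, Pi.smul_apply, LinearMap.smul_apply, map_smul, smul_sub]
  congr 1
  simp only [resRight, iterSum, smul_finsum, Pi.smul_apply, LinearMap.smul_apply, map_smul]
  exact finsum_congr fun i => smul_comm _ _ _

theorem circRight_zero_vec (m : ℤ) (Φ : ℂ → (W₁ →ₗ[ℂ] W₂)) :
    circRight S₁ S₂ (0 : V) m Φ = 0 := by
  have := circRight_smul_vec S₁ S₂ (0 : ℂ) (0 : V) m Φ
  simpa using this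

end Circ

theorem AssocAt.of_le {Φ : ℂ → (W₁ →ₗ[ℂ] W₂)}
    (hΦ : ∀ (α : ℂ) (u : W₁), ∃ N : ℤ, ∀ j ≥ N, Φ (α + j) u = 0) {a : V} {k k' : ℤ}
    (hk : k ≤ k') (h : AssocAt S₁ S₂ Φ a k) : AssocAt S₁ S₂ Φ a k' := by
  induction k', hk using Int.leInduction with
  | base => exact h
  | succ k' _ ih =>
    intro u l n
    have h1 := outerSum_succ (S₂.finDown_comp a (f := fun n => Φ n u) fun α => hΦ α u) l k' n
    rw [iterSum_succ (S₁.finUp_mode a u _), ← ih, ← ih, h1]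
    abel

/-- Associativity in its `l = 0` coefficient says exactly that `a_m Φ` equals the removed part.
Truncation of `∘_r` thus holds for the whole series `Φ`, with a bound independent of the vector and
of the mode. -/
theorem AssocAt.circRight_eq_zero {Φ : ℂ → (W₁ →ₗ[ℂ] W₂)}
    (hΦ : ∀ (α : ℂ) (u : W₁), ∃ N : ℤ, ∀ j ≥ N, Φ (α + j) u = 0) {a : V} {k m : ℤ}
    (h : AssocAt S₁ S₂ Φ a k) (hm : k ≤ m) : circRight S₁ S₂ a m Φ = 0 := by
  ext n u
  have := h.of_le hΦ hm u 0 n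
  rw [outerSum_zero] at this
  rw [circRight_apply, this, resRight, sub_self]
  rfl

/-- Since the exponent may always be enlarged, requiring a positive natural number is no
restriction; integral exponents are more convenient below. -/
theorem isGenRightIntertwining_iff {Φ : ℂ → (W₁ →ₗ[ℂ] W₂)} :
    IsGenRightIntertwining S₁ S₂ Φ ↔
      (∀ (α : ℂ) (u : W₁), ∃ N : ℤ, ∀ j ≥ N, Φ (α + j) u = 0) ∧
      (∀ (n : ℂ) (u : W₁), Φ n (S₁.L (-1) u) = (-n) • Φ (n - 1) u) ∧
      ∀ a : V, ∃ k : ℤ, AssocAt S₁ S₂ Φ a k := by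
  constructor
  · refine fun h => ⟨h.truncation, h.derivative, fun a => ?_⟩
    obtain ⟨k, _, hk⟩ := h.associativity a
    refine ⟨k, fun u l n => ?_⟩
    rw [iterSum_natCast]
    exact hk u l n
  · rintro ⟨h1, h2, h3⟩
    refine ⟨h1, h2, fun a => ?_⟩
    obtain ⟨k, hk⟩ := h3 a
    refine ⟨k.toNat + 1, Nat.succ_pos _, fun u m n => ?_⟩
    have := hk.of_le h1 (k' := ((k.toNat + 1 : ℕ) : ℤ)) (by push_cast; omega) u m n
    rw [iterSum_natCast] at this
    exact this

variable (S₁ S₂) in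
/-- The space of all generalized right intertwining operators. -/
def genRight : Submodule ℂ (ℂ → (W₁ →ₗ[ℂ] W₂)) where
  carrier := {Φ | IsGenRightIntertwining S₁ S₂ Φ}
  zero_mem' := by
    refine isGenRightIntertwining_iff.2 ⟨fun _ _ => ⟨0, fun _ _ => rfl⟩, fun n u => by simp,
      fun a => ⟨0, fun u l n => ?_⟩⟩
    rw [outerSum_eq_zero (by simp), iterSum_eq_zero (by simp)]
  add_mem' := by
    intro Φ Ψ hΦ hΨ
    obtain ⟨h1, h2, h3⟩ := isGenRightIntertwining_iff.1 hΦ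
    obtain ⟨g1, g2, g3⟩ := isGenRightIntertwining_iff.1 hΨ
    refine isGenRightIntertwining_iff.2 ⟨fun α u => ?_, fun n u => ?_, fun a => ?_⟩
    · obtain ⟨N, hN⟩ := h1 α u
      obtain ⟨N', hN'⟩ := g1 α u
      exact ⟨max N N', fun j hj => by
        rw [Pi.add_apply, LinearMap.add_apply, hN j (le_trans (le_max_left _ _) hj),
          hN' j (le_trans (le_max_right _ _) hj), add_zero]⟩
    · simp only [Pi.add_apply, LinearMap.add_apply, h2, g2, smul_add]
    · obtain ⟨k, hk⟩ := h3 a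
      obtain ⟨k', hk'⟩ := g3 a
      refine ⟨max k k', fun u l n => ?_⟩
      have e1 := hk.of_le h1 (le_max_left k k') u l n
      have e2 := hk'.of_le g1 (le_max_right k k') u l n
      simp only [outerSum, iterSum] at e1 e2 ⊢
      simp only [Pi.add_apply, LinearMap.add_apply, map_add, smul_add]
      rw [finsum_add_of_eventually ((S₂.finDown_comp a (f := fun n => Φ n u) fun α => h1 α u).eventually _ _ _)
        ((S₂.finDown_comp a (f := fun n => Ψ n u) fun α => g1 α u).eventually _ _ _), e1, e2,
        finsum_add_of_eventually ((S₁.finUp_mode a u _).eventually _ _ _)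
        ((S₁.finUp_mode a u _).eventually _ _ _)]
  smul_mem' := by
    intro c Φ hΦ
    obtain ⟨h1, h2, h3⟩ := isGenRightIntertwining_iff.1 hΦ
    refine isGenRightIntertwining_iff.2 ⟨fun α u => ?_, fun n u => ?_, fun a => ?_⟩
    · obtain ⟨N, hN⟩ := h1 α u
      exact ⟨N, fun j hj => by rw [Pi.smul_apply, LinearMap.smul_apply, hN j hj, smul_zero]⟩
    · simp only [Pi.smul_apply, LinearMap.smul_apply, h2]
      rw [smul_comm]
    · obtain ⟨k, hk⟩ := h3 a
      refine ⟨k, fun u l n => ?_⟩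
      have e1 := congrArg (c • ·) (hk u l n)
      simp only [outerSum, iterSum, smul_finsum] at e1 ⊢
      simpa only [Pi.smul_apply, LinearMap.smul_apply, map_smul, smul_comm c] using e1

theorem genRightHomogeneous_le_genRight : genRightHomogeneous S₁ S₂ ≤ genRight S₁ S₂ :=
  Submodule.span_le.2 fun _ h => h.1

/-- The Jacobi identity relating the module actions and the action `∘_r` on a generalized right
intertwining operator. -/
theorem IsGenRightIntertwining.jacobi_sums {Φ : ℂ → (W₁ →ₗ[ℂ] W₂)}
    (h : IsGenRightIntertwining S₁ S₂ Φ) (a : V) (u : W₁) (l m : ℤ) (n : ℂ) :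
    outerSum (fun p n => S₂.Y a p (Φ n u)) l m n
        - innerSum (fun p n => circRight S₁ S₂ a p Φ n u) l m n
      = iterSum (fun p n => Φ n (S₁.Y a p u)) l m n := by
  obtain ⟨h1, -, h3⟩ := isGenRightIntertwining_iff.1 h
  obtain ⟨k, hk⟩ := h3 a
  have hd : FinDown fun p n => S₂.Y a p (Φ n u) := S₂.finDown_comp a (f := fun n => Φ n u) fun α => h1 α u
  have hu := S₁.finUp_mode a u Φ
  have hc : ∀ p ≥ k, ∀ n, circRight S₁ S₂ a p Φ n u = 0 := fun p hp n => by
    rw [hk.circRight_eq_zero h1 hp]; rfl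
  have hcu : FinUp fun p n => circRight S₁ S₂ a p Φ n u := FinUp.of_bound hc
  rw [← sub_eq_zero]
  -- At `l = 0` the identity is the definition of `∘_r`. For `m ≥ k` the middle sum vanishes and the
  -- remaining two agree by associativity.
  refine eq_zero_of_pascal (D := fun l m n => outerSum (fun p n => S₂.Y a p (Φ n u)) l m n
        - innerSum (fun p n => circRight S₁ S₂ a p Φ n u) l m n
      - iterSum (fun p n => Φ n (S₁.Y a p u)) l m n) (k := k) ?_ ?_ ?_ l m n
  · intro l m n
    rw [outerSum_succ hd, innerSum_succ hcu, iterSum_succ hu]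
    abel
  · intro m n
    simp only [outerSum_zero, innerSum_zero, circRight_apply, resRight]
    abel
  · intro l n m hm
    rw [innerSum_eq_zero fun i => hc _ (by omega) _, hk.of_le h1 hm, sub_zero, sub_self]

end WeakModules

/-! ### Stability of generalized right intertwining operators under `∘_r`. -/

noncomputable section

section WeakModules

variable {V : Type v} [AddCommGroup V] [Module ℂ V] [VertexOperatorAlgebra V]
  {W₁ W₂ : Type u} [AddCommGroup W₁] [Module ℂ W₁] [AddCommGroup W₂] [Module ℂ W₂]
  {S₁ : WeakModule V W₁} {S₂ : WeakModule V W₂}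

open VertexOperatorAlgebra (conf)

theorem outerSum_shift {ι E : Type*} [Ring ι] [AddCommGroup E] (f : ℤ → ι → E) (c l m : ℤ)
    (n : ι) : outerSum (fun p n => f (p + c) n) l m n = outerSum f l (m + c) n :=
  finsum_congr fun i => by beta_reduce; rw [show m + l - i + c = m + c + l - (i : ℤ) by ring]

theorem outerSum_finset_sum {ι E : Type*} [Ring ι] [AddCommGroup E] {f : ℕ → ℤ → ι → E}
    (hf : ∀ j, FinDown (f j)) (c : ℕ → ℤ) (s : Finset ℕ) (l m : ℤ) (n : ι) :
    outerSum (fun p n => ∑ j ∈ s, c j • f j p n) l m n = ∑ j ∈ s, c j • outerSum (f j) l m n := by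
  simp only [outerSum, Finset.smul_sum]
  rw [finsum_sum_comm]
  · refine Finset.sum_congr rfl fun j _ => ?_
    obtain ⟨K, hK⟩ := (hf j).eventually (m + l) n fun i => (-1) ^ i * Ring.choose l i
    rw [smul_finsum' _ (support_finite_of_eventually hK)]
    exact finsum_congr fun i => smul_comm _ _ _
  · intro j _
    obtain ⟨K, hK⟩ := hf j (m + l) n
    exact support_finite_of_eventually (K := K) fun i hi => by rw [hK i hi, smul_zero, smul_zero]

theorem FinDown.finset_sum {ι E : Type*} [Ring ι] [AddCommGroup E] {f : ℕ → ℤ → ι → E}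
    (hf : ∀ j, FinDown (f j)) (c : ℕ → ℤ) (s : Finset ℕ) :
    FinDown fun p n => ∑ j ∈ s, c j • f j p n := fun p n => by
  choose K hK using fun j => hf j p n
  refine ⟨s.sup K, fun i hi => Finset.sum_eq_zero fun j hj => ?_⟩
  rw [hK j i (le_trans (Finset.le_sup hj) hi), smul_zero]

theorem WeakModule.exists_nat_bound (S : WeakModule V W₁) (a : V) (u : W₁) :
    ∃ q : ℕ, ∀ j ≥ (q : ℤ), S.Y a j u = 0 := by
  obtain ⟨N, hN⟩ := S.truncation a u
  exact ⟨N.toNat, fun j hj => hN j (by omega)⟩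

theorem VertexOperatorAlgebra.exists_nat_bound (a b : V) :
    ∃ q : ℕ, ∀ j ≥ (q : ℤ), VertexOperatorAlgebra.Y a j b = 0 := by
  obtain ⟨N, hN⟩ := VertexOperatorAlgebra.truncation a b
  exact ⟨N.toNat, fun j hj => hN j (by omega)⟩

theorem WeakModule.exists_uniform_mode_bound (S : WeakModule V W₁) (a b : V) (u : W₁) (q : ℤ) :
    ∃ s : ℕ, ∀ (i : ℕ), ∀ j ≥ (s : ℤ), S.Y a j (S.Y b (q + i) u) = 0 := by
  obtain ⟨N, hN⟩ := S.truncation b u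
  obtain ⟨M, hM⟩ := exists_uniform_of_eventually
    (p := fun i j => S.Y a j (S.Y b (q + i) u) = 0) (I := (N - q).toNat)
    (fun i => S.truncation a _) (fun i hi x => by rw [hN _ (by omega), map_zero])
  exact ⟨M.toNat, fun i j hj => hM i j (by omega)⟩

theorem WeakModule.exists_uniform_vec_bound (S : WeakModule V W₁) (a b : V) (u : W₁) (l : ℤ) :
    ∃ s : ℕ, ∀ i ≥ l, ∀ j ≥ (s : ℤ), S.Y (VertexOperatorAlgebra.Y a i b) j u = 0 := by
  obtain ⟨N, hN⟩ := VertexOperatorAlgebra.truncation a b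
  obtain ⟨M, hM⟩ := exists_uniform_of_eventually
    (p := fun i j => S.Y (VertexOperatorAlgebra.Y a (l + i) b) j u = 0) (I := (N - l).toNat)
    (fun i => S.truncation _ _) (fun i hi x => by rw [hN _ (by omega), map_zero]; rfl)
  refine ⟨M.toNat, fun i hi j hj => ?_⟩
  have := hM (i - l).toNat j (by omega)
  rwa [show l + ((i - l).toNat : ℤ) = i by omega] at this

theorem resRight_truncation {Φ : ℂ → (W₁ →ₗ[ℂ] W₂)}
    (hΦ : ∀ (α : ℂ) (u : W₁), ∃ N : ℤ, ∀ j ≥ N, Φ (α + j) u = 0) (a : V) (u : W₁) (m : ℤ) (α : ℂ) :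
    ∃ N : ℤ, ∀ j ≥ N, resRight S₁ a Φ u m (α + j) = 0 := by
  obtain ⟨q, hq⟩ := S₁.exists_nat_bound a u
  obtain ⟨N, hN⟩ := exists_uniform_of_eventually
    (p := fun i j => Φ (α + m - i + j) (S₁.Y a i u) = 0) (I := q)
    (fun i => hΦ _ _) (fun i hi x => by rw [hq _ (by omega), map_zero])
  refine ⟨N, fun j hj => iterSum_eq_zero fun i => ?_⟩
  rw [zero_add, ← hN i j hj]
  congr 2
  ring

theorem circRight_truncation {Φ : ℂ → (W₁ →ₗ[ℂ] W₂)}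
    (hΦ : ∀ (α : ℂ) (u : W₁), ∃ N : ℤ, ∀ j ≥ N, Φ (α + j) u = 0) (a : V) (m : ℤ) (α : ℂ) (u : W₁) :
    ∃ N : ℤ, ∀ j ≥ N, circRight S₁ S₂ a m Φ (α + j) u = 0 := by
  obtain ⟨N, hN⟩ := resRight_truncation (S₁ := S₁) hΦ a u m α
  obtain ⟨N', hN'⟩ := hΦ α u
  exact ⟨max N N', fun j hj => by
    rw [circRight_apply, hN j (le_trans (le_max_left _ _) hj),
      hN' j (le_trans (le_max_right _ _) hj), map_zero, sub_zero]⟩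

/-- Moving `L(-1)` through `a_i` adds `i a_{i-1}`, and the derivative of `Φ` contributes the factor
`-(n+m-i)`. After reindexing, the first correction has factor `m - i`, and the total is `-n` for
every `i`. -/
theorem circRight_derivative {Φ : ℂ → (W₁ →ₗ[ℂ] W₂)}
    (hΦ : ∀ (n : ℂ) (u : W₁), Φ n (S₁.L (-1) u) = (-n) • Φ (n - 1) u) (a : V) (m : ℤ) (n : ℂ)
    (u : W₁) : circRight S₁ S₂ a m Φ n (S₁.L (-1) u) = (-n) • circRight S₁ S₂ a m Φ (n - 1) u := by
  rw [circRight_apply, circRight_apply, hΦ, map_smul, smul_sub]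
  congr 1
  obtain ⟨q, hq⟩ := S₁.exists_nat_bound a u
  have key := finsum_choose_derivative (G := fun i : ℕ => Φ (n - 1 + m - i) (S₁.Y a i u))
    ⟨q, fun i hi => by rw [hq _ (by exact_mod_cast hi), map_zero]⟩ m
  simp only [resRight, iterSum, zero_add]
  have ev : ∃ K, ∀ i : ℕ, K ≤ i → Φ (n - 1 + m - i) (S₁.Y a i u) = 0 :=
    ⟨q, fun i hi => by rw [hq _ (by exact_mod_cast hi), map_zero]⟩
  have ev' : ∃ K, ∀ i : ℕ, K ≤ i → Φ (n - 1 + m - (i - 1 : ℕ)) (S₁.Y a (i - 1 : ℕ) u) = 0 :=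
    ⟨q + 1, fun i hi => by rw [hq _ (by omega), map_zero]⟩
  -- For `i = 0` the natural subtraction `i - 1` gives `0`, but the factor `i` makes that term
  -- vanish.
  have hterm : ∀ i : ℕ, (Ring.choose m i : ℤ) • Φ (n + m - i) (S₁.Y a i (S₁.L (-1) u))
      = (Ring.choose m i : ℤ) • ((-(n + m - i)) • Φ (n - 1 + m - i) (S₁.Y a i u))
        + (Ring.choose m i * i : ℤ) • Φ (n - 1 + m - (i - 1 : ℕ)) (S₁.Y a (i - 1 : ℕ) u) := by
    intro i
    rw [S₁.mode_L_neg_one, map_add, hΦ, smul_add, show n + m - i - 1 = n - 1 + m - (i : ℂ) by ring]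
    congr 1
    rcases i with _ | i
    · simp
    · rw [map_smul, mul_smul, Nat.add_sub_cancel]
      push_cast
      rw [show n + m - ((i : ℂ) + 1) = n - 1 + m - i by ring, show (i : ℤ) + 1 - 1 = i by ring]
      congr 1
      rw [← Int.cast_smul_eq_zsmul ℂ]
      push_cast
      rfl
  rw [finsum_congr hterm, finsum_add_of_eventually, key, ← finsum_add_of_eventually, smul_finsum]
  · refine finsum_congr fun i => ?_
    simp only [← Int.cast_smul_eq_zsmul ℂ, smul_smul, ← add_smul]
    congr 1
    push_cast
    ring
  · exact eventually_smul _ (by obtain ⟨K, hK⟩ := ev; exact ⟨K, fun i hi => by rw [hK i hi, smul_zero]⟩)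
  · exact eventually_smul _ ev
  · exact eventually_smul _ (by obtain ⟨K, hK⟩ := ev; exact ⟨K, fun i hi => by rw [hK i hi, smul_zero]⟩)
  · exact eventually_smul _ ev'

/-- The two-step sums that measure the failure of `a_p` to commute past an associativity relation
are annihilated by powers of `dif`. -/
theorem dif_pow_iterated_eq_zero {E : Type*} [AddCommGroup E] {y : ℕ → ℤ → ℂ → E}
    (hy : ∀ i, FinUp (y i)) {i₀ J : ℕ} {q : ℤ} (hi : ∀ i ≥ i₀, y i = 0)
    (hj : ∀ i, ∀ j ≥ q + J, ∀ n, y i j n = 0) (k : ℤ) (s i' j' : ℕ) (hs : i₀ + J ≤ i' + j' + s) :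
    (dif ℂ E ^ s) (fun p n => ∑ᶠ i : ℕ, (Ring.choose p i : ℤ) •
      iterSum (y (i + i')) (q + j') (k + p - i) n) = 0 := by
  have hev : ∀ (i' j' : ℕ) (p' : ℤ → ℕ → ℤ) (p : ℤ) (n : ℂ),
      ∃ K, ∀ i : ℕ, K ≤ i → iterSum (y (i + i')) (q + j') (p' p i) n = 0 := by
    intro i' j' p' p n
    exact ⟨i₀, fun i h => iterSum_eq_zero fun i'' => by rw [hi _ (by omega)]; rfl⟩
  induction s generalizing i' j' with
  | zero =>
    ext p n
    refine finsum_eq_zero_of_forall fun i => ?_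
    rw [iterSum_eq_zero, smul_zero]
    intro i''
    by_cases h : i₀ ≤ i'
    · rw [hi _ (by omega)]; rfl
    · exact hj _ _ (by omega) _
  | succ s ih =>
    rw [dif_pow_succ]
    -- One factor splits the double sum in two by Pascal's rule: one part raises `j'`, the other
    -- raises `i'`. After enough steps `i' + j' ≥ i₀ + J`, so `i' ≥ i₀` or `j' ≥ J`, and every term
    -- is zero.
    have : dif ℂ E (fun p n => ∑ᶠ i : ℕ, (Ring.choose p i : ℤ) •
          iterSum (y (i + i')) (q + j') (k + p - i) n)
        = (fun p n => ∑ᶠ i : ℕ, (Ring.choose p i : ℤ) •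
          iterSum (y (i + i')) (q + (j' + 1 : ℕ)) (k + p - i) n)
        + (fun p n => ∑ᶠ i : ℕ, (Ring.choose p i : ℤ) •
          iterSum (y (i + (i' + 1))) (q + j') (k + p - i) n) := by
      ext p n
      rw [dif_apply, finsum_choose_succ (hev i' j' (fun p i => k + (p + 1) - i) p n)]
      simp only [Pi.add_apply]
      rw [add_sub_right_comm, ← finsum_sub_of_eventually]
      · congr 1
        · refine finsum_congr fun i => ?_
          rw [show k + (p + 1) - (i : ℤ) = k + p - i + 1 by ring, iterSum_succ (hy _), smul_add,
            add_sub_cancel_left]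
          push_cast
          rw [add_assoc]
        · refine finsum_congr fun i => ?_
          push_cast
          rw [show k + (p + 1) - ((i : ℤ) + 1) = k + p - i by ring,
            show i + 1 + i' = i + (i' + 1) by ring]
      · exact eventually_smul _ (hev i' j' (fun p i => k + (p + 1) - i) p n)
      · exact eventually_smul _ (hev i' j' (fun p i => k + p - i) p (n + 1))
    rw [this, map_add, ih _ _ (by omega), ih _ _ (by omega), add_zero]

/-- The associativity defect of `a_p ∘ Φ` with respect to `b` is regarded as an array in `p`. It
vanishes for large `p`, because `a_p ∘ Φ` does, and on `p ≥ p₁` a power of `dif` annihilates it: the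
removed parts are killed outright, and the part with the left mode `a_p` is reduced by the
commutator formula to associativity for `b` and for the finitely many nonzero `a_i b`. Cancellation
makes the defect zero, in particular at `p = p₁`. -/
theorem AssocAt.circRight {Φ : ℂ → (W₁ →ₗ[ℂ] W₂)} (hΦ : IsGenRightIntertwining S₁ S₂ Φ)
    (a b : V) (p₁ : ℤ) : ∃ k : ℤ, AssocAt S₁ S₂ (circRight S₁ S₂ a p₁ Φ) b k := by
  obtain ⟨h1, -, h3⟩ := isGenRightIntertwining_iff.1 hΦ
  have h1' : ∀ (a : V) (u : W₁), FinDown fun p n => S₂.Y a p (Φ n u) := fun a u =>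
    S₂.finDown_comp a (f := fun n => Φ n u) fun α => h1 α u
  obtain ⟨P, hP⟩ := h3 a
  obtain ⟨i₀, hi₀⟩ := VertexOperatorAlgebra.exists_nat_bound a b
  obtain ⟨kb, hkb⟩ := h3 b
  have hK : ∃ K₀ : ℤ, ∀ i : ℕ, ∀ k ≥ K₀, AssocAt S₁ S₂ Φ (VertexOperatorAlgebra.Y a i b) k := by
    refine exists_uniform_of_eventually (I := i₀) (fun i => ?_) fun i hi k u l n => ?_
    · obtain ⟨K, hK⟩ := h3 (VertexOperatorAlgebra.Y a i b)
      exact ⟨K, fun k hk => hK.of_le h1 hk⟩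
    · rw [hi₀ i (by exact_mod_cast hi), map_zero, map_zero, outerSum_eq_zero (by simp),
        iterSum_eq_zero (by simp)]
  obtain ⟨K₀, hK₀⟩ := hK
  -- For `p ≥ p₁` and `i < i₀` this makes `k + p - i ≥ K₀`, an exponent admissible for all `a_i b`
  -- at once.
  obtain ⟨k, hk⟩ : ∃ k : ℕ, kb ≤ k ∧ K₀ + i₀ - p₁ ≤ k :=
    ⟨(max kb (K₀ + i₀ - p₁)).toNat, by omega, by omega⟩
  refine ⟨k, fun u q n => ?_⟩
  -- the associativity defect of `a_p ∘ Φ`, as an array in `p` and `n`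
  set f₁ : ℤ → ℂ → W₂ := fun p n => outerSum (fun t n => S₂.Y b t (S₂.Y a p (Φ n u))) q k n
      - iterSum (fun t n => S₂.Y a p (Φ n (S₁.Y b t u))) q k n with hf₁
  set f₂ : ℤ → ℂ → W₂ := fun p n => outerSum (fun t n => S₂.Y b t (resRight S₁ a Φ u p n)) q k n
      with hf₂
  set f₃ : ℤ → ℂ → W₂ := fun p n => iterSum (fun t n => resRight S₁ a Φ (S₁.Y b t u) p n) q k n
      with hf₃
  set f : ℤ → ℂ → W₂ := fun p n =>
      outerSum (fun t n => S₂.Y b t (_root_.circRight S₁ S₂ a p Φ n u)) q k n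
      - iterSum (fun t n => _root_.circRight S₁ S₂ a p Φ n (S₁.Y b t u)) q k n with hf
  have hr0 : ∀ p n, resRight S₁ a Φ 0 p n = 0 := fun p n => iterSum_eq_zero fun i => by simp
  have hrU : ∀ p, FinUp fun t n => resRight S₁ a Φ (S₁.Y b t u) p n := by
    intro p
    obtain ⟨N, hN⟩ := S₁.truncation b u
    exact FinUp.of_bound fun t ht n => by rw [hN t ht, hr0]
  have hrD : ∀ p, FinDown fun t n => S₂.Y b t (resRight S₁ a Φ u p n) := fun p =>
    S₂.finDown_comp b fun α => resRight_truncation (S₁ := S₁) h1 a u p α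
  have hfD : ∀ p, FinDown fun t n => S₂.Y b t (S₂.Y a p (Φ n u)) := fun p =>
    S₂.finDown_comp b fun α => by
      obtain ⟨N, hN⟩ := h1 α u
      exact ⟨N, fun j hj => by rw [hN j hj, map_zero]⟩
  have hdecomp : f = f₁ - f₂ + f₃ := by
    ext p n
    simp only [hf, hf₁, hf₂, hf₃, circRight_apply, map_sub, Pi.add_apply, Pi.sub_apply]
    have hu : FinUp fun t n => S₂.Y a p (Φ n (S₁.Y b t u)) :=
      S₁.finUp_mode b u fun n => (S₂.Y a p).comp (Φ n)
    rw [outerSum_sub (hfD p) (hrD p), iterSum_sub hu (hrU p)]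
    abel
  have hf₂0 : ∃ s : ℕ, (dif ℂ W₂ ^ s) f₂ = 0 := by
    obtain ⟨s, hs⟩ := S₁.exists_nat_bound a u
    refine ⟨s, ?_⟩
    have key := dif_pow_finsum
      (F := fun i p n => S₂.Y b (k + q - i) (resRight S₁ a Φ u (p + 0) (n + i)))
      (fun p n => by simpa using hrD p (k + q) n) (fun i => (-1) ^ i * Ring.choose q i) s
    have h' : ∀ i : ℕ, (dif ℂ W₂ ^ s)
        (fun p n => S₂.Y b (k + q - i) (resRight S₁ a Φ u (p + 0) (n + i))) = 0 := by
      intro i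
      rw [dif_pow_translate (fun p n => S₂.Y b (k + q - i) (resRight S₁ a Φ u p n)) s 0 (i : ℂ)]
      -- A mode acting on the values passes inside the removed part, which becomes the removed part
      -- of the composed series.
      have : (fun p n => S₂.Y b (k + q - i) (resRight S₁ a Φ u p n))
          = fun p n => iterSum (fun t n => ((S₂.Y b (k + q - i)).comp (Φ n)) (S₁.Y a t u)) 0 p n := by
        ext p n
        exact map_iterSum (S₂.Y b (k + q - i)).toAddMonoidHom (S₁.finUp_mode a u Φ) _ _ _
      rw [this, dif_pow_iterSum_eq_zero (S₁.finUp_mode a u fun n => (S₂.Y b (k + q - i)).comp (Φ n))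
        (fun j hj n => by rw [hs j (by simpa using hj), map_zero])]
      rfl
    simp only [add_zero] at key h'
    ext p n
    simp only [hf₂, outerSum]
    rw [key]
    simp [h']
  have hf₃0 : ∃ s : ℕ, (dif ℂ W₂ ^ s) f₃ = 0 := by
    obtain ⟨s, hs⟩ := S₁.exists_uniform_mode_bound a b u q
    refine ⟨s, ?_⟩
    have key := dif_pow_finsum
      (F := fun i p n => resRight S₁ a Φ (S₁.Y b (q + i) u) (p + 0) (n + (k - i)))
      (fun p n => by simpa [add_sub_assoc] using hrU p q (n + k)) (fun i => Ring.choose (k : ℤ) i) s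
    have h' : ∀ i : ℕ, (dif ℂ W₂ ^ s)
        (fun p n => resRight S₁ a Φ (S₁.Y b (q + i) u) (p + 0) (n + (k - i))) = 0 := by
      intro i
      rw [dif_pow_translate (fun p n => resRight S₁ a Φ (S₁.Y b (q + i) u) p n) s 0 ((k : ℂ) - i),
        dif_pow_resRight (hs i)]
      rfl
    simp only [add_zero] at key h'
    ext p n
    simp only [hf₃, iterSum, Int.cast_natCast, add_sub_assoc]
    rw [key]
    simp [h']
  have hf₁0 : ∃ s : ℕ, ∀ p ≥ p₁, ∀ n, (dif ℂ W₂ ^ s) f₁ p n = 0 := by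
    obtain ⟨j₀, hj₀⟩ := S₁.exists_uniform_vec_bound a b u 0
    set y : ℕ → ℤ → ℂ → W₂ := fun i j n => Φ n (S₁.Y (VertexOperatorAlgebra.Y a i b) j u) with hy
    have hy0 : ∀ i ≥ i₀, y i = 0 := fun i hi => by
      ext j n
      simp only [hy, hi₀ i (by exact_mod_cast hi), map_zero]
      simp
    have hF := dif_pow_iterated_eq_zero (y := y) (fun i => S₁.finUp_mode _ u Φ) (i₀ := i₀)
      (J := ((j₀ : ℤ) - q).toNat) (q := q) hy0
      (fun i j hj n => by simp only [hy]; rw [hj₀ i (by omega) j (by omega), map_zero])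
      k (i₀ + ((j₀ : ℤ) - q).toNat) 0 0 (by omega)
    refine ⟨i₀ + ((j₀ : ℤ) - q).toNat, fun p hp n => ?_⟩
    -- Commuting `b_t` past `a_p` leaves `a_p` applied to an associativity relation for `b`, which
    -- cancels, and minus a sum over `i` of relations for `a_i b`.
    have heq : ∀ p ≥ p₁, ∀ n, f₁ p n = (-fun (p : ℤ) (n : ℂ) => ∑ᶠ i : ℕ, (Ring.choose p i : ℤ) •
        iterSum (y (i + 0)) (q + (0 : ℕ)) (k + p - i) n) p n := by
      intro p hp n
      have hcomm : ∀ t n, S₂.Y b t (S₂.Y a p (Φ n u)) = S₂.Y a p (S₂.Y b t (Φ n u))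
          - ∑ᶠ i : ℕ, (Ring.choose p i : ℤ) •
            S₂.Y (VertexOperatorAlgebra.Y a i b) (t + (p - i)) (Φ n u) := by
        intro t n
        have := S₂.commutator a b (Φ n u) p t
        rw [← sub_eq_iff_eq_add'.2 (sub_eq_iff_eq_add.1 this)]
        simp only [iterSum, zero_add, Int.cast_id, add_sub_assoc]
      have hsum : ∀ t n, (∑ᶠ i : ℕ, (Ring.choose p i : ℤ) •
            S₂.Y (VertexOperatorAlgebra.Y a i b) (t + (p - i)) (Φ n u))
          = ∑ i ∈ Finset.range i₀, (Ring.choose p i : ℤ) •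
            S₂.Y (VertexOperatorAlgebra.Y a i b) (t + (p - i)) (Φ n u) := fun t n =>
        finsum_eq_sum_range fun i hi => by
          rw [hi₀ i (by exact_mod_cast hi), map_zero]
          simp
      have hD : ∀ i : ℕ, FinDown fun t n =>
          S₂.Y (VertexOperatorAlgebra.Y a i b) (t + (p - i)) (Φ n u) := fun i t n => by
        obtain ⟨K, hK⟩ := h1' (VertexOperatorAlgebra.Y a i b) u (t + (p - i)) n
        exact ⟨K, fun j hj => by
          beta_reduce
          rw [sub_add_eq_add_sub]
          exact hK j hj⟩
      have e1 : outerSum (fun t n => S₂.Y b t (S₂.Y a p (Φ n u))) q k n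
          = outerSum (fun t n => S₂.Y a p (S₂.Y b t (Φ n u))) q k n
            - ∑ i ∈ Finset.range i₀, (Ring.choose p i : ℤ) • iterSum (y i) q (k + (p - i)) n := by
        simp only [hcomm, hsum]
        have hp' : FinDown fun t n => S₂.Y a p (S₂.Y b t (Φ n u)) :=
          (h1' b u).map (S₂.Y a p).toAddMonoidHom
        rw [outerSum_sub hp' (FinDown.finset_sum hD _ _), outerSum_finset_sum hD]
        congr 1
        refine Finset.sum_congr rfl fun i hi => ?_
        have hi' := Finset.mem_range.1 hi
        rw [outerSum_shift (fun t n => S₂.Y (VertexOperatorAlgebra.Y a i b) t (Φ n u)),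
          hK₀ i _ (by omega)]
      have e2 : outerSum (fun t n => S₂.Y a p (S₂.Y b t (Φ n u))) q k n
          = iterSum (fun t n => S₂.Y a p (Φ n (S₁.Y b t u))) q k n := by
        refine (map_outerSum (S₂.Y a p).toAddMonoidHom (h1' b u) q k n).symm.trans ?_
        rw [hkb.of_le h1 hk.1]
        exact map_iterSum (S₂.Y a p).toAddMonoidHom (S₁.finUp_mode b u Φ) q k n
      simp only [hf₁, e1, e2, Pi.neg_apply, sub_sub_cancel_left, add_zero, Nat.cast_zero]
      rw [finsum_eq_sum_range (K := i₀) (fun i hi => by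
        rw [iterSum_eq_zero fun j => by rw [hy0 i hi]; rfl, smul_zero])]
      simp only [add_sub_assoc]
    rw [dif_pow_congr_of_ge heq _ p hp n, map_neg, hF]
    simp
  have hfP : ∃ b : ℤ, ∀ p ≥ b, ∀ n, f p n = 0 := by
    refine ⟨P, fun p hp n => ?_⟩
    simp only [hf, hP.circRight_eq_zero h1 hp]
    rw [outerSum_eq_zero (by simp), iterSum_eq_zero (by simp), sub_zero]
  obtain ⟨s₁, hs₁⟩ := hf₁0
  obtain ⟨s₂, hs₂⟩ := hf₂0
  obtain ⟨s₃, hs₃⟩ := hf₃0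
  -- The three annihilating exponents are added, so that one power of `dif` kills all three pieces
  -- on `p ≥ p₁`.
  have hfin := eq_zero_of_dif_pow_eq_zero (g := f) (q := s₁ + s₂ + s₃) (a := p₁) (fun p hp n => by
    have e1 : (dif ℂ W₂ ^ (s₁ + s₂ + s₃)) f₁ p n = 0 := by
      rw [add_assoc, add_comm, pow_add, Module.End.mul_apply]
      exact dif_pow_congr_of_ge (g' := 0) hs₁ _ p hp n |>.trans (by simp)
    rw [hdecomp, map_add, map_sub, dif_pow_eq_zero_of_le (by omega) hs₂,
      dif_pow_eq_zero_of_le (by omega) hs₃]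
    simpa using e1) hfP p₁ le_rfl n
  exact sub_eq_zero.1 hfin

end WeakModules

/-! ### The weak module axioms for `∘_r`. -/

noncomputable section

section WeakModules

variable {V : Type v} [AddCommGroup V] [Module ℂ V] [VertexOperatorAlgebra V]
  {W₁ W₂ : Type u} [AddCommGroup W₁] [Module ℂ W₁] [AddCommGroup W₂] [Module ℂ W₂]
  {S₁ : WeakModule V W₁} {S₂ : WeakModule V W₂}

open VertexOperatorAlgebra (conf vac)

theorem IsGenRightIntertwining.circRight {Φ : ℂ → (W₁ →ₗ[ℂ] W₂)}
    (h : IsGenRightIntertwining S₁ S₂ Φ) (a : V) (m : ℤ) :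
    IsGenRightIntertwining S₁ S₂ (circRight S₁ S₂ a m Φ) :=
  isGenRightIntertwining_iff.2 ⟨circRight_truncation h.truncation a m,
    circRight_derivative h.derivative a m, fun b => AssocAt.circRight h a b m⟩

theorem IsGenRightIntertwining.circRight_eventually {Φ : ℂ → (W₁ →ₗ[ℂ] W₂)}
    (h : IsGenRightIntertwining S₁ S₂ Φ) (a : V) :
    ∃ N : ℤ, ∀ m ≥ N, _root_.circRight S₁ S₂ a m Φ = 0 := by
  obtain ⟨k, hk⟩ := (isGenRightIntertwining_iff.1 h).2.2 a
  exact ⟨k, fun m hm => hk.circRight_eq_zero h.truncation hm⟩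

theorem circRight_vac (m : ℤ) (Φ : ℂ → (W₁ →ₗ[ℂ] W₂)) :
    circRight S₁ S₂ vac m Φ = if m = -1 then Φ else 0 := by
  ext n u
  rw [circRight_apply, resRight, iterSum_eq_zero, S₂.vacuum]
  · split_ifs <;> simp
  · intro i
    rw [S₁.vacuum, if_neg (by omega)]
    simp

theorem mul_choose_sub_one (m : ℤ) (i : ℕ) :
    m * Ring.choose (m - 1) i = (m - i) * Ring.choose m i := by
  have h1 := succ_mul_choose_succ (m - 1) i
  have h2 := Ring.choose_succ_succ (m - 1) i
  rw [sub_add_cancel] at h2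
  rw [← succ_mul_choose_succ, h2]
  linarith

theorem circRight_derivative_vec (a : V) (m : ℤ) (Φ : ℂ → (W₁ →ₗ[ℂ] W₂)) :
    circRight S₁ S₂ (VertexOperatorAlgebra.Y conf 0 a) m Φ
      = -(m : ℂ) • circRight S₁ S₂ a (m - 1) Φ := by
  ext n u
  rw [Pi.smul_apply, LinearMap.smul_apply, circRight_apply, circRight_apply, S₂.derivative,
    LinearMap.smul_apply, smul_sub]
  congr 1
  obtain ⟨q, hq⟩ := S₁.exists_nat_bound a u
  have ev : ∃ K, ∀ i : ℕ, K ≤ i → Φ (n + (m - 1 : ℤ) - i) (S₁.Y a i u) = 0 :=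
    ⟨q, fun i hi => by rw [hq _ (by exact_mod_cast hi), map_zero]⟩
  have key := finsum_choose_derivative ev m
  simp only [resRight, iterSum, zero_add, S₁.derivative]
  have hterm : ∀ i : ℕ, (Ring.choose m i : ℤ) •
      Φ (n + m - i) (((-((i : ℤ) : ℂ)) • S₁.Y a ((i : ℤ) - 1)) u)
      = -((Ring.choose m i * i : ℤ) •
        Φ (n + (m - 1 : ℤ) - (i - 1 : ℕ)) (S₁.Y a (i - 1 : ℕ) u)) := by
    intro i
    rcases i with _ | i
    · simp
    · rw [LinearMap.smul_apply, map_smul, neg_smul, smul_neg, mul_smul, Nat.add_sub_cancel]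
      push_cast
      rw [show n + m - ((i : ℂ) + 1) = n + (m - 1) - i by ring, show (i : ℤ) + 1 - 1 = i by ring]
      congr 2
      rw [← Int.cast_smul_eq_zsmul ℂ]
      push_cast
      rfl
  rw [finsum_congr hterm, finsum_neg_distrib, key, smul_finsum, ← finsum_neg_distrib]
  refine finsum_congr fun i => ?_
  rw [mul_comm, ← mul_choose_sub_one, mul_smul, neg_smul, Int.cast_smul_eq_zsmul]

theorem difFst_pow_eventually {E : Type*} [AddCommGroup E] {D : ℤ → ℤ → ℂ → E}
    (h : ∀ m, ∃ N : ℤ, ∀ n ≥ N, ∀ μ, D m n μ = 0) (q : ℕ) (m : ℤ) :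
    ∃ N : ℤ, ∀ n ≥ N, ∀ μ, (difFst ℂ E ^ q) D m n μ = 0 := by
  induction q generalizing D with
  | zero => exact h m
  | succ q ih =>
    rw [pow_succ]
    refine ih (D := difFst ℂ E D) fun m => ?_
    obtain ⟨N, hN⟩ := h m
    obtain ⟨N', hN'⟩ := h (m + 1)
    exact ⟨max N N', fun n hn μ => by
      change D (m + 1) n μ - D m n (μ + 1) = 0
      rw [hN n (le_trans (le_max_left _ _) hn), hN' n (le_trans (le_max_right _ _) hn), sub_zero]⟩

/-- A triple array annihilated by `(X - z)^q (Y - z)^q'` that vanishes for large `Y`-index and for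
large `X`-index is zero. -/
theorem eq_zero_of_difFst_difSnd {E : Type*} [AddCommGroup E] {D : ℤ → ℤ → ℂ → E} {q q' : ℕ}
    (hD : (difSnd ℂ E ^ q') ((difFst ℂ E ^ q) D) = 0)
    (h1 : ∀ m, ∃ N : ℤ, ∀ n ≥ N, ∀ μ, D m n μ = 0)
    (h2 : ∀ n, ∃ N : ℤ, ∀ m ≥ N, ∀ μ, D m n μ = 0) : D = 0 := by
  -- The factor `(Y - z)^q'` is cancelled with the first index fixed; powers of `difFst` involve
  -- only finitely many first indices, so truncation in the second index persists.
  have h3 : (difFst ℂ E ^ q) D = 0 := by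
    ext m n μ
    obtain ⟨N, hN⟩ := difFst_pow_eventually h1 q m
    refine eq_zero_of_dif_pow_eq_zero (g := fun n μ => (difFst ℂ E ^ q) D m n μ) (q := q') (a := n)
      (fun p hp μ => ?_) ⟨N, hN⟩ n le_rfl μ
    rw [← difSnd_pow_apply, hD]
    rfl
  ext m n μ
  refine eq_zero_of_dif_pow_eq_zero (g := fun m μ => D m n μ) (q := q) (a := m)
    (fun p hp μ => ?_) (h2 n) m le_rfl μ
  rw [← difFst_pow_apply, h3]
  rfl

theorem difFst_resRight {a : V} {u : W₁} {q : ℕ} (hq : ∀ j ≥ (q : ℤ), S₁.Y a j u = 0)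
    (Ψ : ℤ → ℂ → (W₁ →ₗ[ℂ] W₂)) :
    (difFst ℂ W₂ ^ q) (fun p s μ => resRight S₁ a (Ψ s) u p μ) = 0 := by
  ext p s μ
  rw [difFst_pow_apply, dif_pow_resRight hq]
  rfl

theorem difSnd_resRight {b : V} {u : W₁} {q : ℕ} (hq : ∀ j ≥ (q : ℤ), S₁.Y b j u = 0)
    (Ψ : ℤ → ℂ → (W₁ →ₗ[ℂ] W₂)) :
    (difSnd ℂ W₂ ^ q) (fun p s μ => resRight S₁ b (Ψ p) u s μ) = 0 := by
  ext p s μ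
  rw [difSnd_pow_apply, dif_pow_resRight hq]
  rfl

theorem resRight_comp (T : Module.End ℂ W₂) (a : V) (Φ : ℂ → (W₁ →ₗ[ℂ] W₂)) (u : W₁) (m : ℤ)
    (n : ℂ) : resRight S₁ a (fun n => T.comp (Φ n)) u m n = T (resRight S₁ a Φ u m n) :=
  (map_iterSum T.toAddMonoidHom (S₁.finUp_mode a u Φ) 0 m n).symm

/-- The Jacobi identity for the action `∘_r`. -/
theorem IsGenRightIntertwining.circRight_jacobi {Φ : ℂ → (W₁ →ₗ[ℂ] W₂)}
    (h : IsGenRightIntertwining S₁ S₂ Φ) (a b : V) (l m n : ℤ) :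
    outerSum (fun p s => _root_.circRight S₁ S₂ a p (_root_.circRight S₁ S₂ b s Φ)) l m n
      - innerSum (fun p s => _root_.circRight S₁ S₂ b s (_root_.circRight S₁ S₂ a p Φ)) l m n
      = iterSum (fun p s => _root_.circRight S₁ S₂ (VertexOperatorAlgebra.Y a p b) s Φ) l m n := by
  obtain ⟨Nb, hNb⟩ := h.circRight_eventually b
  obtain ⟨Na, hNa⟩ := h.circRight_eventually a
  obtain ⟨I, hI⟩ := VertexOperatorAlgebra.exists_nat_bound a b
  have c0 : ∀ a p, _root_.circRight S₁ S₂ a p (0 : ℂ → (W₁ →ₗ[ℂ] W₂)) = 0 :=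
    circRight_zero_op S₁ S₂
  have dO : FinDown fun p s => _root_.circRight S₁ S₂ a p (_root_.circRight S₁ S₂ b s Φ) :=
    fun p s => ⟨(Nb - s).toNat, fun i hi => by beta_reduce; rw [hNb _ (by omega), c0]⟩
  have uO : FinUp fun p s => _root_.circRight S₁ S₂ b s (_root_.circRight S₁ S₂ a p Φ) :=
    FinUp.of_bound fun p hp s => by rw [hNa p hp, c0]
  have ue : FinUp fun p s => _root_.circRight S₁ S₂ (VertexOperatorAlgebra.Y a p b) s Φ :=
    FinUp.of_bound fun p hp s => by rw [hI p hp, circRight_zero_vec]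
  funext μ
  refine LinearMap.ext fun u => ?_
  let evh : ℂ → (ℂ → (W₁ →ₗ[ℂ] W₂)) →+ W₂ := fun μ =>
    { toFun := fun Ψ => Ψ μ u, map_zero' := rfl, map_add' := fun _ _ => rfl }
  -- the six arrays
  let O : ℤ → ℤ → ℂ → W₂ := fun p s μ =>
    _root_.circRight S₁ S₂ a p (_root_.circRight S₁ S₂ b s Φ) μ u
  let O' : ℤ → ℤ → ℂ → W₂ := fun p s μ =>
    _root_.circRight S₁ S₂ b s (_root_.circRight S₁ S₂ a p Φ) μ u
  let e : ℤ → ℤ → ℂ → W₂ := fun p s μ =>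
    _root_.circRight S₁ S₂ (VertexOperatorAlgebra.Y a p b) s Φ μ u
  let L : ℤ → ℤ → ℂ → W₂ := fun p s μ => S₂.Y a p (S₂.Y b s (Φ μ u))
  let L' : ℤ → ℤ → ℂ → W₂ := fun p s μ => S₂.Y b s (S₂.Y a p (Φ μ u))
  let eL : ℤ → ℤ → ℂ → W₂ := fun p s μ => S₂.Y (VertexOperatorAlgebra.Y a p b) s (Φ μ u)
  have hO : ∀ μ, FinDown fun p s => O p s μ := fun μ => dO.map (evh μ)
  have hO' : ∀ μ, FinUp fun p s => O' p s μ := fun μ => uO.map (evh μ)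
  have he : ∀ μ, FinUp fun p s => e p s μ := fun μ => ue.map (evh μ)
  have hL : ∀ μ, FinDown fun p s => L p s μ := fun μ => S₂.finDown_mode a b (Φ μ u)
  have hL' : ∀ μ, FinUp fun p s => L' p s μ := fun μ => S₂.finUp_mode a (Φ μ u) _
  have heL : ∀ μ, FinUp fun p s => eL p s μ := fun μ => by
    refine FinUp.of_bound (K := I) fun p hp s => ?_
    simp only [eL, hI p hp, map_zero]
    rfl
  let D : ℤ → ℤ → ℂ → W₂ := fun m n μ => outerSum (fun p s => O p s μ) l m n
      - innerSum (fun p s => O' p s μ) l m n - iterSum (fun p s => e p s μ) l m n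
  suffices hD : D = 0 by
    have := congrFun (congrFun (congrFun hD m) n) μ
    have e1 := map_outerSum (evh μ) dO l m n
    have e2 := map_innerSum (evh μ) uO l m n
    have e3 := map_iterSum (evh μ) ue l m n
    refine (map_sub (evh μ) _ _).trans ?_
    rw [e1, e2]
    exact (sub_eq_zero.1 this).trans e3.symm
  obtain ⟨qa, hqa⟩ := S₁.exists_nat_bound a u
  obtain ⟨qb, hqb⟩ := S₁.exists_nat_bound b u
  obtain ⟨qc, hqc⟩ := S₁.exists_uniform_vec_bound a b u l
  set q' := max qb qc with hq'
  have hqb' : ∀ j ≥ (q' : ℤ), S₁.Y b j u = 0 := fun j hj => hqb j (by omega)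
  have hqc' : ∀ i ≥ l, ∀ j ≥ (q' : ℤ), S₁.Y (VertexOperatorAlgebra.Y a i b) j u = 0 :=
    fun i hi j hj => hqc i hi j (by omega)
  -- Replacing left modes by `∘_r` changes each array by removed parts. `U` and `U'` are removed
  -- parts for `a`, killed by `(X - z)^qa`; `T`, `T'` and `R` are removed parts for `b` or for `a_p
  -- b`, killed by `(Y - z)^q'`.
  let U : ℤ → ℤ → ℂ → W₂ := fun p s μ => resRight S₁ a (_root_.circRight S₁ S₂ b s Φ) u p μ
  let T : ℤ → ℤ → ℂ → W₂ := fun p s μ =>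
    resRight S₁ b (fun n => (S₂.Y a p).comp (Φ n)) u s μ
  let U' : ℤ → ℤ → ℂ → W₂ := fun p s μ =>
    resRight S₁ a (fun n => (S₂.Y b s).comp (Φ n)) u p μ
  let T' : ℤ → ℤ → ℂ → W₂ := fun p s μ => resRight S₁ b (_root_.circRight S₁ S₂ a p Φ) u s μ
  let R : ℤ → ℤ → ℂ → W₂ := fun p s μ => resRight S₁ (VertexOperatorAlgebra.Y a p b) Φ u s μ
  have r0 : ∀ (a : V) s μ, resRight S₁ a (0 : ℂ → (W₁ →ₗ[ℂ] W₂)) u s μ = 0 := fun a s μ =>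
    iterSum_eq_zero fun i => rfl
  have hU : ∀ μ, FinDown fun p s => U p s μ := fun μ p s =>
    ⟨(Nb - s).toNat, fun i hi => by simp only [U]; rw [hNb _ (by omega), r0]⟩
  have hT' : ∀ μ, FinUp fun p s => T' p s μ := fun μ =>
    FinUp.of_bound fun p hp s => by simp only [T']; rw [hNa p hp, r0]
  have eO : ∀ p s μ, L p s μ - O p s μ = T p s μ + U p s μ := by
    intro p s μ
    simp only [O, L, U, T]
    rw [circRight_apply, circRight_apply, resRight_comp, map_sub]
    abel
  have eO' : ∀ p s μ, L' p s μ - O' p s μ = T' p s μ + U' p s μ := by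
    intro p s μ
    simp only [O', L', U', T']
    rw [circRight_apply, circRight_apply, resRight_comp, map_sub]
    abel
  have ee : ∀ p s μ, eL p s μ - e p s μ = R p s μ := by
    intro p s μ
    simp only [eL, e, R]
    rw [circRight_apply, sub_sub_cancel]
  have hT : ∀ μ, FinDown fun p s => T p s μ := fun μ => by
    have := ((hL μ).sub (hO μ)).sub (hU μ)
    simpa only [eO, add_sub_cancel_right] using this
  have hU' : ∀ μ, FinUp fun p s => U' p s μ := fun μ => by
    have := ((hL' μ).sub (hO' μ)).sub (hT' μ)
    simpa only [eO', add_sub_cancel_left] using this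
  have hR : ∀ μ, FinUp fun p s => R p s μ := fun μ => by
    have := (heL μ).sub (he μ)
    simpa only [ee] using this
  -- The Jacobi identity of the values cancels the arrays `L`, `L'` and `eL`, so only removed parts
  -- remain.
  have hDdec : D = -(fun m n μ => outerSum (fun p s => T p s μ) l m n)
      - (fun m n μ => outerSum (fun p s => U p s μ) l m n)
      + (fun m n μ => innerSum (fun p s => T' p s μ) l m n)
      + (fun m n μ => innerSum (fun p s => U' p s μ) l m n)
      + (fun m n μ => iterSum (fun p s => R p s μ) l m n) := by
    ext m n μ
    have jL : outerSum (fun p s => L p s μ) l m n - innerSum (fun p s => L' p s μ) l m n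
      = iterSum (fun p s => eL p s μ) l m n := S₂.jacobi_sums a b (Φ μ u) l m n
    have x1 := outerSum_sub (hL μ) (hO μ) l m n
    have x2 := outerSum_sub ((hL μ).sub (hO μ)) (hU μ) l m n
    have y1 := innerSum_sub (hL' μ) (hO' μ) l m n
    have y2 := innerSum_sub ((hL' μ).sub (hO' μ)) (hT' μ) l m n
    have z1 := iterSum_sub (heL μ) (he μ) l m n
    simp only [eO, eO', ee, add_sub_cancel_right, add_sub_cancel_left] at x1 x2 y1 y2 z1
    simp only [D, Pi.add_apply, Pi.sub_apply, Pi.neg_apply, z1, x2, y2, x1, y1, ← jL]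
    abel
  have comm : ∀ g : ℤ → ℤ → ℂ → W₂, (difSnd ℂ W₂ ^ q') ((difFst ℂ W₂ ^ qa) g)
      = (difFst ℂ W₂ ^ qa) ((difSnd ℂ W₂ ^ q') g) := fun g =>
    LinearMap.congr_fun ((difFst_difSnd_commute (κ := ℂ) (E := W₂)).pow_pow qa q').eq.symm g
  refine eq_zero_of_difFst_difSnd (q := qa) (q' := q') ?_ ?_ ?_
  · rw [hDdec]
    simp only [map_add, map_sub, map_neg]
    rw [difFst_pow_outerSum hU l (difFst_resRight hqa _),
      difFst_pow_innerSum hU' l (difFst_resRight hqa fun s n => (S₂.Y b s).comp (Φ n)),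
      comm, comm, comm,
      difSnd_pow_outerSum hT l (difSnd_resRight hqb' fun p n => (S₂.Y a p).comp (Φ n)),
      difSnd_pow_innerSum hT' l (difSnd_resRight hqb' _),
      difSnd_pow_iterSum hR l fun j hj => dif_pow_resRight (hqc' j hj)]
    simp
  -- For fixed `m` only finitely many modes `a_{m+i} ∘ Φ` and `a_{l+i} b` are nonzero, so the bounds
  -- on `n` can be taken uniform in `i`. The last case is the same with the two variables exchanged.
  · intro m
    obtain ⟨N, hN⟩ := exists_uniform_of_eventually (I := (Na - m).toNat)
      (p := fun i s => _root_.circRight S₁ S₂ b (s - i) (_root_.circRight S₁ S₂ a (m + i) Φ) = 0)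
      (fun i => by
        obtain ⟨M, hM⟩ := (h.circRight a (m + i)).circRight_eventually b
        exact ⟨M + i, fun x hx => hM _ (by omega)⟩)
      (fun i hi x => by rw [hNa _ (by omega), c0])
    obtain ⟨N', hN'⟩ := exists_uniform_of_eventually (I := (I - l).toNat)
      (p := fun i s => _root_.circRight S₁ S₂ (VertexOperatorAlgebra.Y a (l + i) b) (s - i) Φ = 0)
      (fun i => by
        obtain ⟨M, hM⟩ := h.circRight_eventually (VertexOperatorAlgebra.Y a (l + i) b)
        exact ⟨M + i, fun x hx => hM _ (by omega)⟩)
      (fun i hi x => by rw [hI _ (by omega), circRight_zero_vec])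
    refine ⟨max Nb (max (N - l) (N' - m)), fun n hn μ => ?_⟩
    simp only [D]
    rw [outerSum_eq_zero, innerSum_eq_zero, iterSum_eq_zero, sub_zero, sub_zero]
    · intro i
      simp only [e, Int.cast_id]
      rw [hN' i _ (by omega)]
      rfl
    · intro i
      simp only [O', Int.cast_id]
      rw [hN i _ (by omega)]
      rfl
    · intro i
      simp only [O]
      rw [hNb _ (by omega), c0]
      rfl
  · intro n
    obtain ⟨N, hN⟩ := exists_uniform_of_eventually (I := (Nb - n).toNat)
      (p := fun i s => _root_.circRight S₁ S₂ a (s - i) (_root_.circRight S₁ S₂ b (n + i) Φ) = 0)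
      (fun i => by
        obtain ⟨M, hM⟩ := (h.circRight b (n + i)).circRight_eventually a
        exact ⟨M + i, fun x hx => hM _ (by omega)⟩)
      (fun i hi x => by rw [hNb _ (by omega), c0])
    obtain ⟨N', hN'⟩ := exists_uniform_of_eventually (I := (I - l).toNat)
      (p := fun i s => _root_.circRight S₁ S₂ (VertexOperatorAlgebra.Y a (l + i) b) (s - i) Φ = 0)
      (fun i => by
        obtain ⟨M, hM⟩ := h.circRight_eventually (VertexOperatorAlgebra.Y a (l + i) b)
        exact ⟨M + i, fun x hx => hM _ (by omega)⟩)
      (fun i hi x => by rw [hI _ (by omega), circRight_zero_vec])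
    refine ⟨max Na (max (N - l) (N' - n)), fun m hm μ => ?_⟩
    simp only [D]
    rw [outerSum_eq_zero, innerSum_eq_zero, iterSum_eq_zero, sub_zero, sub_zero]
    · intro i
      simp only [e, Int.cast_id]
      rw [hN' i _ (by omega)]
      rfl
    · intro i
      simp only [O', Int.cast_id]
      rw [hNa _ (by omega), c0]
      rfl
    · intro i
      simp only [O]
      rw [hN i _ (by omega)]
      rfl

/-- The action `∘_r` on a space of generalized right intertwining operators stable under it. -/
def circModule (N : Submodule ℂ (ℂ → (W₁ →ₗ[ℂ] W₂))) (hN : N ≤ genRight S₁ S₂)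
    (hst : ∀ (a : V) (m : ℤ), ∀ Φ ∈ N, circRight S₁ S₂ a m Φ ∈ N) : WeakModule V N where
  Y :=
    { toFun := fun a m =>
        { toFun := fun Φ => ⟨circRight S₁ S₂ a m Φ, hst a m Φ Φ.2⟩
          map_add' := fun Φ Ψ => Subtype.ext (circRight_add_op S₁ S₂ a m Φ Ψ)
          map_smul' := fun c Φ => Subtype.ext (circRight_smul_op S₁ S₂ a m c Φ) }
      map_add' := fun a b => by
        ext m Φ : 2
        exact Subtype.ext (circRight_add_vec S₁ S₂ a b m Φ)
      map_smul' := fun c a => by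
        ext m Φ : 2
        exact Subtype.ext (circRight_smul_vec S₁ S₂ c a m Φ) }
  vacuum := fun m => by
    ext Φ : 1
    refine Subtype.ext ((circRight_vac m Φ.1).trans ?_)
    split_ifs <;> rfl
  truncation := fun a Φ => by
    obtain ⟨K, hK⟩ := IsGenRightIntertwining.circRight_eventually (hN Φ.2) a
    exact ⟨K, fun m hm => Subtype.ext (hK m hm)⟩
  derivative := fun a m => by
    ext Φ : 1
    exact Subtype.ext (circRight_derivative_vec a m Φ.1)
  jacobi := by
    intro a b Φ l m n
    have hΦ : IsGenRightIntertwining S₁ S₂ Φ.1 := hN Φ.2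
    obtain ⟨Nb, hNb⟩ := hΦ.circRight_eventually b
    obtain ⟨Na, hNa⟩ := hΦ.circRight_eventually a
    obtain ⟨I, hI⟩ := VertexOperatorAlgebra.exists_nat_bound a b
    have c0 := circRight_zero_op (V := V) S₁ S₂
    rw [jacobi_sums_iff]
    · have dO : FinDown fun p s => (⟨circRight S₁ S₂ a p (circRight S₁ S₂ b s Φ.1),
          hst _ _ _ (hst _ _ _ Φ.2)⟩ : N) := fun p s => ⟨(Nb - s).toNat, fun i hi =>
        Subtype.ext (by simp only [hNb _ (show s + (i : ℤ) ≥ Nb by omega), c0]; rfl)⟩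
      have uO : FinUp fun p s => (⟨circRight S₁ S₂ b s (circRight S₁ S₂ a p Φ.1),
          hst _ _ _ (hst _ _ _ Φ.2)⟩ : N) :=
        FinUp.of_bound (K := Na) fun p hp s => Subtype.ext (by simp only [hNa p hp, c0]; rfl)
      have ue : FinUp fun p s => (⟨circRight S₁ S₂ (VertexOperatorAlgebra.Y a p b) s Φ.1,
          hst _ _ _ Φ.2⟩ : N) :=
        FinUp.of_bound (K := I) fun p hp s => Subtype.ext (by simp only [hI p hp, circRight_zero_vec]; rfl)
      refine Subtype.ext ?_
      have := hΦ.circRight_jacobi a b l m n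
      have e1 := map_outerSum N.subtype.toAddMonoidHom dO l m n
      have e2 := map_innerSum N.subtype.toAddMonoidHom uO l m n
      have e3 := map_iterSum N.subtype.toAddMonoidHom ue l m n
      refine (map_sub N.subtype _ _).trans ?_
      exact (congrArg₂ (· - ·) e1 e2).trans (this.trans e3.symm)
    · exact fun p s => ⟨(Nb - s).toNat, fun i hi => Subtype.ext (by
        change circRight S₁ S₂ a _ (circRight S₁ S₂ b _ Φ.1) = 0
        rw [hNb _ (by omega), c0])⟩
    · exact FinUp.of_bound (K := Na) fun p hp s => Subtype.ext (by
        change circRight S₁ S₂ b _ (circRight S₁ S₂ a _ Φ.1) = 0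
        rw [hNa p hp, c0])

end WeakModules

noncomputable section

/-! ### Taylor coefficients -/

/-- The Taylor coefficient of order `j` at `0`. -/
def taylorCoeff (f : ℂ → ℂ) (j : ℕ) : ℂ := iteratedDeriv j f 0 / (j.factorial : ℂ)

theorem taylorCoeff_congr {f g : ℂ → ℂ} (h : f =ᶠ[nhds 0] g) (j : ℕ) :
    taylorCoeff f j = taylorCoeff g j := by
  rw [taylorCoeff, taylorCoeff, h.iteratedDeriv_eq]

theorem taylorCoeff_add {f g : ℂ → ℂ} (hf : AnalyticAt ℂ f 0) (hg : AnalyticAt ℂ g 0) (j : ℕ) :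
    taylorCoeff (fun x => f x + g x) j = taylorCoeff f j + taylorCoeff g j := by
  have := iteratedDeriv_fun_add (n := j) (x := (0 : ℂ)) hf.contDiffAt hg.contDiffAt
  rw [taylorCoeff, this, add_div]; rfl

theorem taylorCoeff_const_mul (c : ℂ) (f : ℂ → ℂ) (j : ℕ) :
    taylorCoeff (fun x => c * f x) j = c * taylorCoeff f j := by
  rw [taylorCoeff, iteratedDeriv_const_mul_field, taylorCoeff, mul_div_assoc]

theorem taylorCoeff_zero_fun (j : ℕ) : taylorCoeff (fun _ => 0) j = 0 := by
  have := taylorCoeff_const_mul 0 (fun _ => 0) j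
  simpa using this

theorem taylorCoeff_sum {ι : Type*} (s : Finset ι) {f : ι → ℂ → ℂ}
    (hf : ∀ i ∈ s, AnalyticAt ℂ (f i) 0) (j : ℕ) :
    taylorCoeff (fun x => ∑ i ∈ s, f i x) j = ∑ i ∈ s, taylorCoeff (f i) j := by
  rw [taylorCoeff, iteratedDeriv_fun_sum fun i hi => (hf i hi).contDiffAt, Finset.sum_div]
  rfl

theorem iteratedDeriv_id_mul_zero (n : ℕ) : ∀ f : ℂ → ℂ, AnalyticAt ℂ f 0 →
    iteratedDeriv n (fun x => x * f x) 0 = n * iteratedDeriv (n - 1) f 0 := by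
  induction n with
  | zero => intro f _; simp
  | succ n ih =>
    intro f hf
    rw [iteratedDeriv_succ']
    have h1 : deriv (fun x => x * f x) =ᶠ[nhds 0] fun x => f x + x * deriv f x := by
      filter_upwards [hf.eventually_analyticAt] with x hx
      have := (hasDerivAt_id x).mul hx.differentiableAt.hasDerivAt
      have h2 : (id * f) = fun x => x * f x := rfl
      rw [h2] at this
      simpa using this.deriv
    have h3 : AnalyticAt ℂ (fun x => x * deriv f x) 0 := analyticAt_id.mul hf.deriv
    rw [h1.iteratedDeriv_eq, iteratedDeriv_fun_add hf.contDiffAt h3.contDiffAt]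
    rw [ih _ hf.deriv]
    rcases n with _ | n
    · simp
    · rw [Nat.add_sub_cancel, ← iteratedDeriv_succ', Nat.add_sub_cancel]
      push_cast; ring

theorem taylorCoeff_id_mul_succ {f : ℂ → ℂ} (hf : AnalyticAt ℂ f 0) (j : ℕ) :
    taylorCoeff (fun x => x * f x) (j + 1) = taylorCoeff f j := by
  rw [taylorCoeff, iteratedDeriv_id_mul_zero _ f hf, taylorCoeff, Nat.factorial_succ,
    Nat.add_sub_cancel]
  have h1 : (j.factorial : ℂ) ≠ 0 := by exact_mod_cast j.factorial_ne_zero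
  have h2 : ((j : ℂ) + 1) ≠ 0 := by exact_mod_cast j.succ_ne_zero
  push_cast
  field_simp

theorem taylorCoeff_id_mul_zero (f : ℂ → ℂ) : taylorCoeff (fun x => x * f x) 0 = 0 := by
  simp [taylorCoeff]

theorem taylorCoeff_id_mul_deriv {f : ℂ → ℂ} (hf : AnalyticAt ℂ f 0) (j : ℕ) :
    taylorCoeff (fun x => x * deriv f x) j = j * taylorCoeff f j := by
  rcases j with _ | j
  · simp [taylorCoeff_id_mul_zero]
  · rw [taylorCoeff_id_mul_succ hf.deriv, taylorCoeff, taylorCoeff, iteratedDeriv_succ',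
      Nat.factorial_succ]
    have h1 : (j.factorial : ℂ) ≠ 0 := by exact_mod_cast j.factorial_ne_zero
    have h2 : ((j : ℂ) + 1) ≠ 0 := by exact_mod_cast j.succ_ne_zero
    push_cast
    field_simp

theorem taylorCoeff_pow_mul {f : ℂ → ℂ} (hf : AnalyticAt ℂ f 0) (e N : ℕ) :
    taylorCoeff (fun x => x ^ e * f x) N = if e ≤ N then taylorCoeff f (N - e) else 0 := by
  induction e generalizing N with
  | zero => simp
  | succ e ih =>
    have h : (fun x : ℂ => x ^ (e + 1) * f x) = fun x => x * (x ^ e * f x) := by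
      funext x; ring
    rw [h]
    rcases N with _ | N
    · rw [taylorCoeff_id_mul_zero]; simp
    · have h3 : AnalyticAt ℂ (fun x => x ^ e * f x) 0 := (analyticAt_id.pow e).mul hf
      rw [taylorCoeff_id_mul_succ h3, ih]
      simp

/-! ### Multivalued sums -/

/-- The contribution of one term `z₁^r z₂^s f(z₂/z₁)` to the coefficient of
`z₁^{-m-1} z₂^{-n-1}`. -/
def termCoeff (r s : ℂ) (f : ℂ → ℂ) (m n : ℂ) : ℂ :=
  open Classical in
  ∑ᶠ j : ℕ, if -m - 1 = r - j ∧ -n - 1 = s + j then taylorCoeff f j else 0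

theorem MultivaluedSum.coeff_eq (g : MultivaluedSum) (m n : ℂ) :
    g.coeff m n = ∑ i, termCoeff (g.r i) (g.s i) (g.f i) m n := rfl

theorem termCoeff_of_eq {r s : ℂ} {f : ℂ → ℂ} {m n : ℂ} (j : ℕ) (h1 : -m - 1 = r - j)
    (h2 : -n - 1 = s + j) : termCoeff r s f m n = taylorCoeff f j := by
  rw [termCoeff, finsum_eq_single _ j, if_pos ⟨h1, h2⟩]
  intro i hi
  rw [if_neg]
  rintro ⟨-, h3⟩
  rw [h2] at h3
  exact hi (by exact_mod_cast (add_left_cancel h3).symm)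

theorem termCoeff_of_ne {r s : ℂ} {f : ℂ → ℂ} {m n : ℂ}
    (h : ∀ j : ℕ, -m - 1 = r - j → -n - 1 = s + j → False) : termCoeff r s f m n = 0 := by
  rw [termCoeff]
  exact finsum_eq_zero_of_forall_eq_zero fun j => if_neg fun h' => h j h'.1 h'.2

/-- Compare two term coefficients through their Taylor coefficients. -/
theorem termCoeff_eq_mul {r s r' s' : ℂ} {f f' : ℂ → ℂ} {m n m' n' : ℂ} (c : ℂ)
    (h : ∀ j : ℕ, (-m - 1 = r - j ∧ -n - 1 = s + j) ↔ (-m' - 1 = r' - j ∧ -n' - 1 = s' + j))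
    (hc : ∀ j : ℕ, -m - 1 = r - j → -n - 1 = s + j → taylorCoeff f j = c * taylorCoeff f' j) :
    termCoeff r s f m n = c * termCoeff r' s' f' m' n' := by
  by_cases hj : ∃ j : ℕ, -m - 1 = r - j ∧ -n - 1 = s + j
  · obtain ⟨j, h1, h2⟩ := hj
    obtain ⟨h3, h4⟩ := (h j).1 ⟨h1, h2⟩
    rw [termCoeff_of_eq j h1 h2, termCoeff_of_eq j h3 h4, hc j h1 h2]
  · push Not at hj
    rw [termCoeff_of_ne fun j h1 h2 => hj j h1 h2, termCoeff_of_ne, mul_zero]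
    intro j h1 h2
    obtain ⟨h3, h4⟩ := (h j).2 ⟨h1, h2⟩
    exact hj j h3 h4

/-- Addition naturally indexes terms by a disjoint union; reindexing by `Fin` returns it to the
format of `MultivaluedSum`. -/
theorem MultivaluedSum.exists_of_fintype {ι : Type*} [Fintype ι] (r s : ι → ℂ) (f : ι → ℂ → ℂ)
    (hf : ∀ i, AnalyticOnNhd ℂ (f i) (Metric.ball 0 1)) :
    ∃ g : MultivaluedSum,
      (∀ z₁ z₂, g.eval z₁ z₂ = ∑ i, z₁ ^ r i * z₂ ^ s i * f i (z₂ / z₁)) ∧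
      (∀ m n, g.coeff m n = ∑ i, termCoeff (r i) (s i) (f i) m n) ∧
      (∀ P : ℂ → ℂ → Prop, (∀ i, P (r i) (s i)) → ∀ i, P (g.r i) (g.s i)) := by
  let e := (Fintype.equivFin ι).symm
  refine ⟨⟨Fintype.card ι, r ∘ e, s ∘ e, fun i => f (e i), fun i => hf _⟩, fun z₁ z₂ => ?_,
    fun m n => ?_, fun P hP i => hP _⟩
  · exact e.sum_comp fun i => z₁ ^ r i * z₂ ^ s i * f i (z₂ / z₁)
  · exact e.sum_comp fun i => termCoeff (r i) (s i) (f i) m n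

/-! ### The region of comparison and the expansion relation -/

/-- The region on which an iterate is compared with its extension. -/
def overlapRegion : Set (ℂ × ℂ) :=
  {z | 0 < (z.1 - z.2).re ∧ 0 < z.2.re ∧ ‖z.1 - z.2‖ < ‖z.2‖ ∧ ‖z.2‖ < ‖z.1‖}

theorem isOpen_overlapRegion : IsOpen overlapRegion := by
  have h1 : IsOpen {z : ℂ × ℂ | 0 < (z.1 - z.2).re} := isOpen_lt (by fun_prop) (by fun_prop)
  have h2 : IsOpen {z : ℂ × ℂ | 0 < z.2.re} := isOpen_lt (by fun_prop) (by fun_prop)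
  have h3 : IsOpen {z : ℂ × ℂ | ‖z.1 - z.2‖ < ‖z.2‖} := isOpen_lt (by fun_prop) (by fun_prop)
  have h4 : IsOpen {z : ℂ × ℂ | ‖z.2‖ < ‖z.1‖} := isOpen_lt (by fun_prop) (by fun_prop)
  exact h1.inter (h2.inter (h3.inter h4))

theorem overlapRegion_ne {z₁ z₂ : ℂ} (h : (z₁, z₂) ∈ overlapRegion) :
    z₁ - z₂ ≠ 0 ∧ z₂ ≠ 0 ∧ z₁ ≠ 0 ∧ 0 < z₁.re := by
  obtain ⟨h1, h2, -, h4⟩ := h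
  have h5 : 0 < z₁.re := by simp only [Complex.sub_re] at h1 h2; linarith
  refine ⟨?_, ?_, ?_, h5⟩
  · rintro h; simp [h] at h1
  · rintro h; simp only [h, Complex.zero_re, lt_irrefl] at h2
  · rintro h; simp [h] at h5

/-- On the region of comparison the series with coefficients `c` sums to a multivalued sum with
coefficients `d`. -/
def HasExpansion (c d : ℂ → ℂ → ℂ) : Prop :=
  ∃ g : MultivaluedSum, (∀ z₁ z₂, (z₁, z₂) ∈ overlapRegion →
    HasSum (iterateTerm c z₁ z₂) (g.eval z₁ z₂)) ∧ ∀ m n, d m n = g.coeff m n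

/-- Absolute convergence of an iterate on its whole domain. -/
def IterateSummable (c : ℂ → ℂ → ℂ) : Prop :=
  ∀ z₁ z₂ : ℂ, 0 < ‖z₁ - z₂‖ → ‖z₁ - z₂‖ < ‖z₂‖ → Summable (iterateTerm c z₁ z₂)

theorem extendsIterate_iff {c : ℂ → ℂ → ℂ} {g : MultivaluedSum} :
    ExtendsIterate c g ↔ IterateSummable c ∧ ∀ z₁ z₂, (z₁, z₂) ∈ overlapRegion →
      HasSum (iterateTerm c z₁ z₂) (g.eval z₁ z₂) := by
  constructor
  · rintro ⟨h1, h2⟩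
    refine ⟨h1, fun z₁ z₂ hz => ?_⟩
    rw [← h2 z₁ z₂ hz.1 hz.2.1 hz.2.2.1 hz.2.2.2]
    exact (h1 z₁ z₂ (norm_pos_iff.2 (overlapRegion_ne hz).1) hz.2.2.1).hasSum
  · rintro ⟨h1, h2⟩
    exact ⟨h1, fun z₁ z₂ a b c d => (h2 z₁ z₂ ⟨a, b, c, d⟩).tsum_eq⟩

theorem isIterateExpansion_iff {c d : ℂ → ℂ → ℂ} :
    IsIterateExpansion c d ↔ IterateSummable c ∧ HasExpansion c d := by
  constructor
  · rintro ⟨g, h, hd⟩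
    rw [extendsIterate_iff] at h
    exact ⟨h.1, g, h.2, hd⟩
  · rintro ⟨h, g, hg, hd⟩
    exact ⟨g, extendsIterate_iff.2 ⟨h, hg⟩, hd⟩

theorem iterateTerm_add (c c' : ℂ → ℂ → ℂ) (z₁ z₂ : ℂ) :
    iterateTerm (fun n m => c n m + c' n m) z₁ z₂
      = fun p => iterateTerm c z₁ z₂ p + iterateTerm c' z₁ z₂ p := by
  funext p; simp only [iterateTerm]; ring

theorem iterateTerm_smul (t : ℂ) (c : ℂ → ℂ → ℂ) (z₁ z₂ : ℂ) :
    iterateTerm (fun n m => t * c n m) z₁ z₂ = fun p => t * iterateTerm c z₁ z₂ p := by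
  funext p; simp only [iterateTerm]; ring

theorem HasSum.of_eq {ι : Type*} {f g : ι → ℂ} {a b : ℂ} (h : HasSum f a) (hf : g = f)
    (ha : b = a) : HasSum g b := by
  rw [hf, ha]; exact h

theorem HasExpansion.add {c c' d d' : ℂ → ℂ → ℂ} (h : HasExpansion c d) (h' : HasExpansion c' d') :
    HasExpansion (fun n m => c n m + c' n m) (fun m n => d m n + d' m n) := by
  obtain ⟨g, hg, hd⟩ := h
  obtain ⟨g', hg', hd'⟩ := h'
  obtain ⟨G, hG, hGc, -⟩ := MultivaluedSum.exists_of_fintype (Sum.elim g.r g'.r)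
    (Sum.elim g.s g'.s) (Sum.elim g.f g'.f)
    (by rintro (i | i); exacts [g.analytic i, g'.analytic i])
  refine ⟨G, fun z₁ z₂ hz => ?_, fun m n => ?_⟩
  · rw [iterateTerm_add, hG, Fintype.sum_sum_type]
    exact (hg z₁ z₂ hz).add (hg' z₁ z₂ hz)
  · beta_reduce
    rw [hd, hd', hGc, Fintype.sum_sum_type]
    rfl

theorem HasExpansion.smul {c d : ℂ → ℂ → ℂ} (t : ℂ) (h : HasExpansion c d) :
    HasExpansion (fun n m => t * c n m) (fun m n => t * d m n) := by
  obtain ⟨g, hg, hd⟩ := h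
  obtain ⟨G, hG, hGc, -⟩ := MultivaluedSum.exists_of_fintype g.r g.s (fun i x => t * g.f i x)
    (fun i => analyticOnNhd_const.mul (g.analytic i))
  refine ⟨G, fun z₁ z₂ hz => ?_, fun m n => ?_⟩
  · rw [iterateTerm_smul, hG]
    refine ((hg z₁ z₂ hz).mul_left t).of_eq rfl ?_
    rw [MultivaluedSum.eval, Finset.mul_sum]
    exact Finset.sum_congr rfl fun i _ => by ring
  · beta_reduce
    rw [hd, hGc, MultivaluedSum.coeff_eq, Finset.mul_sum]
    refine Finset.sum_congr rfl fun i _ => (termCoeff_eq_mul t (fun j => Iff.rfl) ?_).symm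
    exact fun j _ _ => taylorCoeff_const_mul _ _ _

theorem HasExpansion.zero : HasExpansion (fun _ _ => 0) (fun _ _ => 0) := by
  refine ⟨⟨0, Fin.elim0, Fin.elim0, fun i => i.elim0, fun i => i.elim0⟩, fun z₁ z₂ _ => ?_,
    fun m n => ?_⟩
  · simp only [MultivaluedSum.eval, Finset.univ_eq_empty, Finset.sum_empty]
    convert hasSum_zero using 1
    funext p; simp [iterateTerm]
  · simp [MultivaluedSum.coeff]

theorem HasExpansion.sub {c c' d d' : ℂ → ℂ → ℂ} (h : HasExpansion c d) (h' : HasExpansion c' d') :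
    HasExpansion (fun n m => c n m - c' n m) (fun m n => d m n - d' m n) := by
  convert h.add (h'.smul (-1)) using 3 <;> ring

theorem HasExpansion.sum {ι : Type*} (s : Finset ι) {c d : ι → ℂ → ℂ → ℂ}
    (h : ∀ i ∈ s, HasExpansion (c i) (d i)) :
    HasExpansion (fun n m => ∑ i ∈ s, c i n m) (fun m n => ∑ i ∈ s, d i m n) := by
  classical
  induction s using Finset.induction_on with
  | empty => simpa using HasExpansion.zero
  | insert a s ha ih =>
    simp only [Finset.sum_insert ha]
    exact (h a (Finset.mem_insert_self _ _)).add
      (ih fun i hi => h i (Finset.mem_insert_of_mem hi))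

theorem IterateSummable.add {c c' : ℂ → ℂ → ℂ} (h : IterateSummable c) (h' : IterateSummable c') :
    IterateSummable (fun n m => c n m + c' n m) := fun z₁ z₂ a b => by
  rw [iterateTerm_add]; exact (h z₁ z₂ a b).add (h' z₁ z₂ a b)

theorem IterateSummable.smul (t : ℂ) {c : ℂ → ℂ → ℂ} (h : IterateSummable c) :
    IterateSummable (fun n m => t * c n m) := fun z₁ z₂ a b => by
  rw [iterateTerm_smul]; exact (h z₁ z₂ a b).mul_left t

theorem IsIterateExpansion.add {c c' d d' : ℂ → ℂ → ℂ} (h : IsIterateExpansion c d)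
    (h' : IsIterateExpansion c' d') :
    IsIterateExpansion (fun n m => c n m + c' n m) (fun m n => d m n + d' m n) := by
  rw [isIterateExpansion_iff] at *
  exact ⟨h.1.add h'.1, h.2.add h'.2⟩

theorem IsIterateExpansion.smul {c d : ℂ → ℂ → ℂ} (t : ℂ) (h : IsIterateExpansion c d) :
    IsIterateExpansion (fun n m => t * c n m) (fun m n => t * d m n) := by
  rw [isIterateExpansion_iff] at *
  exact ⟨h.1.smul t, h.2.smul t⟩

theorem IsIterateExpansion.zero : IsIterateExpansion (fun _ _ => 0) (fun _ _ => 0) := by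
  rw [isIterateExpansion_iff]
  refine ⟨fun z₁ z₂ _ _ => ?_, HasExpansion.zero⟩
  convert summable_zero using 1
  funext p; simp [iterateTerm]

theorem IsIterateExpansion.sum {ι : Type*} (s : Finset ι) {c d : ι → ℂ → ℂ → ℂ}
    (h : ∀ i ∈ s, IsIterateExpansion (c i) (d i)) :
    IsIterateExpansion (fun n m => ∑ i ∈ s, c i n m) (fun m n => ∑ i ∈ s, d i m n) := by
  classical
  induction s using Finset.induction_on with
  | empty => simpa using IsIterateExpansion.zero
  | insert a s ha ih =>
    simp only [Finset.sum_insert ha]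
    exact (h a (Finset.mem_insert_self _ _)).add
      (ih fun i hi => h i (Finset.mem_insert_of_mem hi))

/-- Multiplication by an integral power of `z₂`. -/
theorem HasExpansion.shift_snd {c d : ℂ → ℂ → ℂ} (h : HasExpansion c d) (q : ℤ) :
    HasExpansion (fun n m => c n (m + q)) (fun m n => d m (n + q)) := by
  obtain ⟨g, hg, hd⟩ := h
  obtain ⟨G, hG, hGc, -⟩ := MultivaluedSum.exists_of_fintype g.r (fun i => g.s i + q) g.f g.analytic
  refine ⟨G, fun z₁ z₂ hz => ?_, fun m n => ?_⟩
  · obtain ⟨-, h2, -, -⟩ := overlapRegion_ne hz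
    have h3 := (hg z₁ z₂ hz).mul_left (z₂ ^ q)
    rw [← ((Equiv.refl ℂ).prodCongr (Equiv.addRight (q : ℂ))).hasSum_iff] at h3
    refine h3.of_eq ?_ ?_
    · funext p
      simp only [iterateTerm, Function.comp, Equiv.prodCongr_apply, Prod.map, Equiv.refl_apply,
        Equiv.coe_addRight]
      have : (-p.2 - 1 : ℂ) = (-(p.2 + q) - 1) + q := by ring
      rw [this, Complex.cpow_add _ _ h2, Complex.cpow_intCast]
      ring_nf
    · rw [hG, MultivaluedSum.eval, Finset.mul_sum]
      refine Finset.sum_congr rfl fun i _ => ?_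
      rw [Complex.cpow_add _ _ h2, Complex.cpow_intCast]; ring
  · beta_reduce
    rw [hd, hGc, MultivaluedSum.coeff_eq]
    refine Finset.sum_congr rfl fun i _ => ?_
    rw [termCoeff_eq_mul 1 _ (fun j _ _ => (one_mul _).symm), one_mul]
    intro j
    refine and_congr Iff.rfl ⟨fun h => ?_, fun h => ?_⟩ <;> linear_combination h

/-- Multiplication by `z₁ = z₀ + z₂`. -/
theorem HasExpansion.shift_fst {c d : ℂ → ℂ → ℂ} (h : HasExpansion c d) :
    HasExpansion (fun n m => c (n + 1) m + c n (m + 1)) (fun m n => d (m + 1) n) := by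
  obtain ⟨g, hg, hd⟩ := h
  obtain ⟨G, hG, hGc, -⟩ := MultivaluedSum.exists_of_fintype (fun i => g.r i + 1) g.s g.f g.analytic
  refine ⟨G, fun z₁ z₂ hz => ?_, fun m n => ?_⟩
  · obtain ⟨h1, h2, h3, -⟩ := overlapRegion_ne hz
    -- Multiplication by `z₁` is the sum of multiplications by `z₁ - z₂` and by `z₂`, each of which
    -- merely shifts one index of the iterate.
    have e0 := (hg z₁ z₂ hz).mul_left (z₁ - z₂)
    have e2 := (hg z₁ z₂ hz).mul_left z₂
    rw [← ((Equiv.refl ℂ).prodCongr (Equiv.addRight (1 : ℂ))).hasSum_iff] at e2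
    rw [← ((Equiv.addRight (1 : ℂ)).prodCongr (Equiv.refl ℂ)).hasSum_iff] at e0
    refine (e0.add e2).of_eq ?_ ?_
    · funext p
      simp only [iterateTerm, Function.comp, Equiv.prodCongr_apply, Prod.map, Equiv.refl_apply,
        Equiv.coe_addRight]
      have k2 : (-p.2 - 1 : ℂ) = (-(p.2 + 1) - 1) + 1 := by ring
      have k1 : (-p.1 - 1 : ℂ) = (-(p.1 + 1) - 1) + 1 := by ring
      rw [add_mul, add_mul]
      congr 1
      · rw [k1, Complex.cpow_add _ _ h1, Complex.cpow_one]; ring_nf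
      · rw [k2, Complex.cpow_add _ _ h2, Complex.cpow_one]; ring_nf
    · rw [hG, ← add_mul, sub_add_cancel, MultivaluedSum.eval, Finset.mul_sum]
      refine Finset.sum_congr rfl fun i _ => ?_
      rw [Complex.cpow_add _ _ h3, Complex.cpow_one]; ring
  · beta_reduce
    rw [hd, hGc, MultivaluedSum.coeff_eq]
    refine Finset.sum_congr rfl fun i _ => ?_
    rw [termCoeff_eq_mul 1 _ (fun j _ _ => (one_mul _).symm), one_mul]
    intro j
    refine and_congr ⟨fun h => ?_, fun h => ?_⟩ Iff.rfl <;> linear_combination h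

end

/-! ### Uniqueness of expansions. -/

noncomputable section

/-- The character `(τ, k) ↦ exp (τ ρ + 2πi k σ)` of `ℝ × ℤ`. -/
def logCharacter (ρ σ : ℂ) : Multiplicative (ℝ × ℤ) →* ℂ where
  toFun x := Complex.exp ((x.toAdd.1 : ℂ) * ρ + 2 * Real.pi * Complex.I * (x.toAdd.2 : ℂ) * σ)
  map_one' := by simp
  map_mul' x y := by
    rw [← Complex.exp_add]
    congr 1
    simp only [toAdd_mul, Prod.fst_add, Prod.snd_add]
    push_cast
    ring

theorem logCharacter_apply (ρ σ : ℂ) (τ : ℝ) (k : ℤ) :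
    logCharacter ρ σ (Multiplicative.ofAdd (τ, k))
      = Complex.exp ((τ : ℂ) * ρ + 2 * Real.pi * Complex.I * (k : ℂ) * σ) := rfl

theorem eq_of_exp_real_mul_eq {ρ ρ' : ℂ}
    (h : ∀ τ : ℝ, Complex.exp ((τ : ℂ) * ρ) = Complex.exp ((τ : ℂ) * ρ')) : ρ = ρ' := by
  have hd : ∀ r : ℂ, HasDerivAt (fun τ : ℝ => Complex.exp ((τ : ℂ) * r)) r 0 := by
    intro r
    have h0 : HasDerivAt (fun τ : ℝ => (τ : ℂ) * r) (1 * r) 0 :=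
      ((hasDerivAt_id (0 : ℝ)).ofReal_comp).mul_const r
    simpa using h0.cexp
  have h1 := hd ρ
  rw [show (fun τ : ℝ => Complex.exp ((τ : ℂ) * ρ)) = fun τ : ℝ => Complex.exp ((τ : ℂ) * ρ') from
    funext h] at h1
  exact h1.unique (hd ρ')

/-- The real parameter is a scaling and detects `ρ` completely. The integer is a winding number and
detects `σ` only through `exp (2πi σ)`, hence modulo `ℤ`. -/
theorem logCharacter_eq_iff {ρ σ ρ' σ' : ℂ} (h : logCharacter ρ σ = logCharacter ρ' σ') :
    ρ = ρ' ∧ ∃ k : ℤ, σ = σ' + k := by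
  constructor
  · refine eq_of_exp_real_mul_eq fun τ => ?_
    have := congrArg (fun f => f (Multiplicative.ofAdd (τ, (0 : ℤ)))) h
    simpa [logCharacter_apply] using this
  · have := congrArg (fun f => f (Multiplicative.ofAdd ((0 : ℝ), (1 : ℤ)))) h
    simp only [logCharacter_apply, Complex.ofReal_zero, zero_mul, zero_add, Int.cast_one,
      mul_one] at this
    obtain ⟨k, hk⟩ := Complex.exp_eq_exp_iff_exists_int.1 this
    refine ⟨k, ?_⟩
    have hpi : (2 * Real.pi * Complex.I : ℂ) ≠ 0 := Complex.two_pi_I_ne_zero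
    apply mul_left_cancel₀ hpi
    rw [hk]; ring

/-- In logarithmic coordinates a vanishing multivalued sum vanishes on all branches. -/
theorem MultivaluedSum.sum_log_eq_zero {ι : Type*} [Fintype ι] (r s : ι → ℂ) (f : ι → ℂ → ℂ)
    (hf : ∀ i, AnalyticOnNhd ℂ (f i) (Metric.ball 0 1))
    (h : ∀ z₁ z₂, (z₁, z₂) ∈ overlapRegion →
      ∑ i, z₁ ^ r i * z₂ ^ s i * f i (z₂ / z₁) = 0) (τ : ℝ) (η : ℂ) (hη : η.re < 0) :
    ∑ i, Complex.exp ((τ : ℂ) * (r i + s i)) * (Complex.exp (s i * η) * f i (Complex.exp η)) = 0 := by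
  -- With `z₁ = e^τ` and `z₂ = e^{τ+η}` the condition `|z₂| < |z₁|` is the half-plane `Re η < 0`.
  -- This is connected and contains all branches of the logarithm of `z₂ / z₁`, so the identity
  -- theorem reaches all of them.
  set U : Set ℂ := {η | η.re < 0} with hU
  set H : ℂ → ℂ := fun η => ∑ i, Complex.exp ((τ : ℂ) * (r i + s i)) *
    (Complex.exp (s i * η) * f i (Complex.exp η)) with hH
  have han : AnalyticOnNhd ℂ H U := by
    intro x hx
    have hx' : Complex.exp x ∈ Metric.ball (0 : ℂ) 1 := by
      rw [mem_ball_zero_iff, Complex.norm_exp]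
      exact (Real.exp_lt_exp.2 hx).trans_eq Real.exp_zero
    refine Finset.analyticAt_fun_sum _ fun i _ => ?_
    refine analyticAt_const.mul (AnalyticAt.mul ?_ ?_)
    · exact (analyticAt_const.mul analyticAt_id).cexp
    · exact (hf i _ hx').comp analyticAt_cexp
  have hpre : IsPreconnected U := (convex_halfSpace_re_lt 0).isPreconnected
  -- Any ratio `x = z₂ / z₁` within `1/8` of `3/4` satisfies `|1 - x| < |x| < 1`, and both `x` and
  -- `1 - x` have positive real part. Thus `(t, t x)` lies in the region for all `t > 0`.
  set x₀ : ℂ := ((3 / 4 : ℝ) : ℂ) with hx₀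
  have hx₀slit : x₀ ∈ Complex.slitPlane := Or.inl (by simp [hx₀])
  have hx₀ne : x₀ ≠ 0 := Complex.slitPlane_ne_zero hx₀slit
  have hlog : (Complex.log x₀).re < 0 := by
    rw [Complex.log_re, hx₀, Complex.norm_real]
    exact Real.log_neg (by norm_num) (by norm_num)
  have hcont : Filter.Tendsto Complex.exp (nhds (Complex.log x₀)) (nhds x₀) := by
    have := Complex.continuous_exp.tendsto (Complex.log x₀)
    rwa [Complex.exp_log hx₀ne] at this
  have hev : H =ᶠ[nhds (Complex.log x₀)] 0 := by
    have h1 : ∀ᶠ η in nhds (Complex.log x₀), Complex.exp η ∈ Metric.ball x₀ (1 / 8) :=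
      hcont (Metric.ball_mem_nhds _ (by norm_num))
    have h2 : ∀ᶠ η in nhds (Complex.log x₀), Complex.log (Complex.exp η) = η := by
      have hopen : IsOpen {η : ℂ | -Real.pi < η.im ∧ η.im < Real.pi} :=
        (isOpen_lt continuous_const Complex.continuous_im).inter
          (isOpen_lt Complex.continuous_im continuous_const)
      have hmem : Complex.log x₀ ∈ {η : ℂ | -Real.pi < η.im ∧ η.im < Real.pi} := by
        have : (Complex.log x₀).im = 0 := by
          rw [Complex.log_im, hx₀, Complex.arg_ofReal_of_nonneg (by norm_num)]
        simp only [Set.mem_ofPred_eq, this]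
        exact ⟨neg_lt_zero.2 Real.pi_pos, Real.pi_pos⟩
      filter_upwards [hopen.mem_nhds hmem] with η hη
      exact Complex.log_exp hη.1 hη.2.le
    filter_upwards [h1, h2] with η hη hη2
    set x := Complex.exp η with hx
    have hxne : x ≠ 0 := Complex.exp_ne_zero _
    have hre : |x.re - 3 / 4| < 1 / 8 := by
      have := (Complex.abs_re_le_norm (x - x₀)).trans_lt (by simpa [dist_eq_norm] using hη)
      simpa [hx₀] using this
    have him : |x.im| < 1 / 8 := by
      have := (Complex.abs_im_le_norm (x - x₀)).trans_lt (by simpa [dist_eq_norm] using hη)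
      simpa [hx₀] using this
    rw [abs_lt] at hre him
    set t : ℝ := Real.exp τ with ht
    have htpos : 0 < t := Real.exp_pos τ
    have hn : ∀ y : ℂ, ‖y‖ ^ 2 = y.re ^ 2 + y.im ^ 2 := fun y => by
      rw [Complex.sq_norm, Complex.normSq_apply]; ring
    have hlt1 : ‖1 - x‖ < ‖x‖ := by
      apply lt_of_pow_lt_pow_left₀ 2 (norm_nonneg _)
      rw [hn, hn]
      simp only [Complex.sub_re, Complex.one_re, Complex.sub_im, Complex.one_im]
      nlinarith
    have hlt2 : ‖x‖ < 1 := by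
      apply lt_of_pow_lt_pow_left₀ 2 zero_le_one
      rw [hn]
      nlinarith
    have hmem : ((t : ℂ), (t : ℂ) * x) ∈ overlapRegion := by
      have e : (t : ℂ) - t * x = t * (1 - x) := by ring
      refine ⟨?_, ?_, ?_, ?_⟩
      · simp only [e, Complex.re_ofReal_mul, Complex.sub_re, Complex.one_re]
        exact mul_pos htpos (by linarith)
      · simp only [Complex.re_ofReal_mul]
        exact mul_pos htpos (by linarith)
      · simp only [e, norm_mul, Complex.norm_real]
        exact mul_lt_mul_of_pos_left hlt1 (by simpa using htpos.ne')
      · simp only [norm_mul, Complex.norm_real]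
        have : 0 < ‖t‖ := by simpa using htpos.ne'
        nlinarith
    have h0 := h _ _ hmem
    rw [hH]
    show ∑ i, _ = (0 : ℂ)
    rw [← h0]
    refine Finset.sum_congr rfl fun i _ => ?_
    have htne : (t : ℂ) ≠ 0 := by exact_mod_cast htpos.ne'
    have hlt : Complex.log (t : ℂ) = τ := by
      rw [← Complex.ofReal_log htpos.le, ht, Real.log_exp]
    have hltx : Complex.log ((t : ℂ) * x) = τ + η := by
      rw [Complex.log_ofReal_mul htpos hxne, ht, Real.log_exp, hη2]
    rw [mul_div_cancel_left₀ _ htne, Complex.cpow_def_of_ne_zero htne,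
      Complex.cpow_def_of_ne_zero (mul_ne_zero htne hxne), hlt, hltx, ← mul_assoc,
      ← Complex.exp_add, ← Complex.exp_add]
    congr 2; ring
  exact han.eqOn_zero_of_preconnected_of_eventuallyEq_zero hpre (by simpa [hU] using hlog) hev hη

/-- Scaling both variables and winding `z₂` around zero multiply the `i`-th term by a character of
`ℝ × ℤ` depending on `r_i + s_i` and on `s_i` modulo `ℤ`. Linear independence of characters makes
the terms of each character sum to zero separately. Within one character the exponents differ by
integers, so a power of `x = z₂ / z₁` turns the sum into an analytic function vanishing on the
punctured disc; the desired coefficient is one of its Taylor coefficients. -/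
theorem MultivaluedSum.coeff_eq_zero_of_eval (g : MultivaluedSum)
    (h : ∀ z₁ z₂, (z₁, z₂) ∈ overlapRegion → g.eval z₁ z₂ = 0) (m n : ℂ) : g.coeff m n = 0 := by
  classical
  have key := MultivaluedSum.sum_log_eq_zero g.r g.s g.f g.analytic h
  set χ : Fin g.k → (Multiplicative (ℝ × ℤ) →* ℂ) := fun i =>
    logCharacter (g.r i + g.s i) (g.s i) with hχ
  set χ₀ := logCharacter (-m - n - 2) (-n - 1) with hχ₀
  set G : Fin g.k → ℂ → ℂ := fun i η => Complex.exp (g.s i * η) * g.f i (Complex.exp η) with hG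
  set I := Finset.univ.filter fun i => χ i = χ₀ with hI
  -- the part belonging to a single character vanishes
  have hpart : ∀ η : ℂ, η.re < 0 → ∑ i ∈ I, G i η = 0 := by
    intro η hη
    have hall : ∀ x : Multiplicative (ℝ × ℤ), ∑ i, G i η * χ i x = 0 := by
      intro x
      -- Shifting `η` by a multiple of `2πi` fixes `e^η` and changes only the power of `z₂`,
      -- producing the character.
      have := key x.toAdd.1 (η + 2 * Real.pi * Complex.I * (x.toAdd.2 : ℂ)) (by
        simpa [Complex.add_re, Complex.mul_re] using hη)
      rw [← this]
      refine Finset.sum_congr rfl fun i _ => ?_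
      have e1 : Complex.exp (η + 2 * Real.pi * Complex.I * (x.toAdd.2 : ℂ)) = Complex.exp η := by
        have := Complex.exp_periodic.int_mul x.toAdd.2 η
        rw [← this]; congr 1; ring
      rw [e1]
      show Complex.exp (g.s i * η) * g.f i (Complex.exp η) * Complex.exp _ = _
      rw [← mul_assoc, ← Complex.exp_add, mul_right_comm, ← Complex.exp_add]
      congr 2
      ring
    have hfib : ∑ ψ ∈ Finset.univ.image χ, (∑ i ∈ Finset.univ.filter fun i => χ i = ψ, G i η) •
        ((ψ : Multiplicative (ℝ × ℤ) → ℂ)) = 0 := by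
      funext x
      rw [Finset.sum_apply, Pi.zero_apply, ← hall x,
        ← Finset.sum_fiberwise_of_maps_to (g := χ) (t := Finset.univ.image χ)
          (fun i hi => Finset.mem_image_of_mem χ hi)]
      refine Finset.sum_congr rfl fun ψ _ => ?_
      rw [Pi.smul_apply, smul_eq_mul, Finset.sum_mul]
      refine Finset.sum_congr rfl fun i hi => ?_
      rw [(Finset.mem_filter.1 hi).2]
    by_cases hmem : χ₀ ∈ Finset.univ.image χ
    · exact linearIndependent_iff'.1
        (linearIndependent_monoidHom (Multiplicative (ℝ × ℤ)) ℂ) _ _ hfib χ₀ hmem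
    · rw [hI, Finset.filter_eq_empty_iff.2, Finset.sum_empty]
      intro i _ hi
      exact hmem (hi ▸ Finset.mem_image_of_mem χ (Finset.mem_univ i))
  -- exponents in the part are integral shifts
  have hexp : ∀ i ∈ I, ∃ k : ℤ, g.s i = -n - 1 - k ∧ g.r i = -m - 1 + k := by
    intro i hi
    obtain ⟨h1, k, h2⟩ := logCharacter_eq_iff (Finset.mem_filter.1 hi).2
    refine ⟨-k, ?_, ?_⟩
    · rw [h2]; push_cast; ring
    · have : g.r i = (g.r i + g.s i) - g.s i := by ring
      rw [this, h1, h2]; push_cast; ring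
  choose! κ hκs hκr using hexp
  have hout : ∀ i ∉ I, termCoeff (g.r i) (g.s i) (g.f i) m n = 0 := by
    intro i hi
    refine termCoeff_of_ne fun j h1 h2 => hi ?_
    rw [hI, Finset.mem_filter]
    refine ⟨Finset.mem_univ _, ?_⟩
    have e1 : g.r i + g.s i = -m - n - 2 := by linear_combination -h1 - h2
    have e2 : g.s i = -n - 1 + (-(j : ℤ) : ℤ) := by push_cast; linear_combination -h2
    rw [hχ, hχ₀]
    ext x
    show Complex.exp _ = Complex.exp _
    rw [e1, e2]
    rw [Complex.exp_eq_exp_iff_exists_int]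
    refine ⟨-(x.2 * j), ?_⟩
    simp only [toAdd_ofAdd]
    push_cast
    ring
  -- The integer `N` clears all negative exponents. In `x^{N-κ_i} f_i(x)` the wanted Taylor
  -- coefficient, of order `κ_i` in `f_i`, stands at `x^N` for every `i`; if `κ_i < 0` both
  -- contributions are zero.
  obtain ⟨N, hN⟩ : ∃ N : ℕ, ∀ i ∈ I, (κ i).natAbs ≤ N :=
    ⟨I.sup fun i => (κ i).natAbs, fun i hi => Finset.le_sup (f := fun i => (κ i).natAbs) hi⟩
  set P : ℂ → ℂ := fun x => ∑ i ∈ I, x ^ ((N : ℤ) - κ i).toNat * g.f i x with hP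
  have hterm : ∀ i, AnalyticAt ℂ (fun x => x ^ ((N : ℤ) - κ i).toNat * g.f i x) 0 := fun i =>
    (analyticAt_id.pow _).mul (g.analytic i 0 (Metric.mem_ball_self one_pos))
  have hPan : AnalyticAt ℂ P 0 := Finset.analyticAt_fun_sum _ fun i _ => hterm i
  have hPzero : ∀ x : ℂ, x ≠ 0 → ‖x‖ < 1 → P x = 0 := by
    intro x hx hx1
    have h1 := hpart (Complex.log x) (by
      rw [Complex.log_re]; exact Real.log_neg (norm_pos_iff.2 hx) hx1)
    have h2 : P x = Complex.exp ((N + n + 1) * Complex.log x) * ∑ i ∈ I, G i (Complex.log x) := by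
      rw [Finset.mul_sum]
      refine Finset.sum_congr rfl fun i hi => ?_
      rw [hG]
      simp only [Complex.exp_log hx]
      rw [← mul_assoc, ← Complex.exp_add]
      congr 1
      have e : (N + n + 1) * Complex.log x + g.s i * Complex.log x
          = (((N : ℤ) - κ i).toNat : ℕ) * Complex.log x := by
        have : ((((N : ℤ) - κ i).toNat : ℕ) : ℂ) = ((((N : ℤ) - κ i).toNat : ℤ) : ℂ) := by
          push_cast; rfl
        rw [this, Int.toNat_of_nonneg (by have := hN i hi; omega), hκs i hi]
        push_cast; ring
      rw [e, Complex.exp_nat_mul, Complex.exp_log hx]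
    rw [h2, h1, mul_zero]
  have hPev : P =ᶠ[nhds 0] fun _ => 0 := by
    refine (AnalyticAt.frequently_zero_iff_eventually_zero hPan).1 (Filter.Eventually.frequently ?_)
    have : ∀ᶠ x : ℂ in nhdsWithin 0 {0}ᶜ, ‖x‖ < 1 :=
      nhdsWithin_le_nhds (by
        filter_upwards [Metric.ball_mem_nhds (0 : ℂ) one_pos] with x hx
        simpa using hx)
    filter_upwards [this, self_mem_nhdsWithin] with x hx hx0
    exact hPzero x hx0 hx
  have htay := taylorCoeff_congr hPev N
  rw [taylorCoeff_zero_fun, taylorCoeff_sum _ (fun i _ => hterm i)] at htay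
  rw [MultivaluedSum.coeff_eq, ← Finset.sum_subset (Finset.subset_univ I)
    (fun i _ hi => hout i hi), ← htay]
  refine Finset.sum_congr rfl fun i hi => ?_
  rw [taylorCoeff_pow_mul (g.analytic i 0 (Metric.mem_ball_self one_pos))]
  by_cases hk : 0 ≤ κ i
  · have hb := hN i hi
    rw [if_pos (by omega), termCoeff_of_eq (κ i).toNat]
    · congr 1; omega
    · have : (((κ i).toNat : ℕ) : ℂ) = (((κ i).toNat : ℤ) : ℂ) := by push_cast; rfl
      rw [this, Int.toNat_of_nonneg hk, hκr i hi]; ring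
    · have : (((κ i).toNat : ℕ) : ℂ) = (((κ i).toNat : ℤ) : ℂ) := by push_cast; rfl
      rw [this, Int.toNat_of_nonneg hk, hκs i hi]; ring
  · have hb := hN i hi
    rw [if_neg (by omega), termCoeff_of_ne]
    intro j _ h2
    rw [hκs i hi] at h2
    have : (κ i : ℂ) = ((j : ℤ) : ℂ) := by push_cast; linear_combination h2
    have : κ i = j := by exact_mod_cast this
    omega

theorem HasExpansion.eq_zero {c d : ℂ → ℂ → ℂ} (h : HasExpansion c d) (hc : ∀ n m, c n m = 0) :
    ∀ m n, d m n = 0 := by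
  obtain ⟨g, hg, hd⟩ := h
  intro m n
  rw [hd]
  refine g.coeff_eq_zero_of_eval (fun z₁ z₂ hz => ?_) m n
  have h0 : iterateTerm c z₁ z₂ = fun _ => 0 := by funext p; simp [iterateTerm, hc]
  have := hg z₁ z₂ hz
  rw [h0] at this
  exact this.unique hasSum_zero

/-- This makes `E^{12}` well defined and lets every later identity of iterates be read off as an
identity of expansions. -/
theorem HasExpansion.unique {c d d' : ℂ → ℂ → ℂ} (h : HasExpansion c d) (h' : HasExpansion c d') :
    d = d' := by
  funext m n
  have := (h.sub h').eq_zero (fun n m => sub_self _) m n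
  exact sub_eq_zero.1 this

end

/-! ### Differentiation and homogeneity of expansions. -/

noncomputable section

theorem Real.exp_mul_le_add_exp {a x x₁ x₂ : ℝ} (h₁ : x₁ ≤ x) (h₂ : x ≤ x₂) :
    Real.exp (a * x) ≤ Real.exp (a * x₁) + Real.exp (a * x₂) := by
  rcases le_total 0 a with ha | ha
  · have := Real.exp_le_exp.2 (mul_le_mul_of_nonneg_left h₂ ha)
    linarith [Real.exp_pos (a * x₁)]
  · have := Real.exp_le_exp.2 (mul_le_mul_of_nonpos_left h₁ ha)
    linarith [Real.exp_pos (a * x₂)]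

/-- An exponential on a rectangle is dominated by its values at the four corners. -/
theorem Complex.norm_exp_mul_le_corners (a ζ : ℂ) {x₁ x₂ y₁ y₂ : ℝ} (hx₁ : x₁ ≤ ζ.re)
    (hx₂ : ζ.re ≤ x₂) (hy₁ : y₁ ≤ ζ.im) (hy₂ : ζ.im ≤ y₂) :
    ‖Complex.exp (a * ζ)‖ ≤ ‖Complex.exp (a * ⟨x₁, y₁⟩)‖ + ‖Complex.exp (a * ⟨x₁, y₂⟩)‖ +
      (‖Complex.exp (a * ⟨x₂, y₁⟩)‖ + ‖Complex.exp (a * ⟨x₂, y₂⟩)‖) := by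
  simp only [Complex.norm_exp, Complex.mul_re]
  have e : ∀ x y : ℝ, Real.exp (a.re * x - a.im * y) = Real.exp (a.re * x) * Real.exp (-a.im * y) :=
    fun x y => by rw [← Real.exp_add]; congr 1; ring
  simp only [e]
  have h1 := Real.exp_mul_le_add_exp (a := a.re) hx₁ hx₂
  have h2 := Real.exp_mul_le_add_exp (a := -a.im) hy₁ hy₂
  calc _ ≤ (Real.exp (a.re * x₁) + Real.exp (a.re * x₂)) *
        (Real.exp (-a.im * y₁) + Real.exp (-a.im * y₂)) := by gcongr
    _ = _ := by ring

theorem MultivaluedSum.hasDerivAt_term (r s : ℂ) {f : ℂ → ℂ}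
    (hf : AnalyticOnNhd ℂ f (Metric.ball 0 1)) {z₁ z₂ : ℂ} (hz : (z₁, z₂) ∈ overlapRegion) :
    HasDerivAt (fun z => z ^ r * z₂ ^ s * f (z₂ / z))
      (z₁ ^ (r - 1) * z₂ ^ s * (r * f (z₂ / z₁) - z₂ / z₁ * deriv f (z₂ / z₁))) z₁ := by
  obtain ⟨-, -, h3, h4⟩ := overlapRegion_ne hz
  have hmem : z₂ / z₁ ∈ Metric.ball (0 : ℂ) 1 := by
    rw [mem_ball_zero_iff, norm_div, div_lt_one (norm_pos_iff.2 h3)]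
    exact hz.2.2.2
  have hslit : z₁ ∈ Complex.slitPlane := Or.inl h4
  have d1 : HasDerivAt (fun z : ℂ => z ^ r) (r * z₁ ^ (r - 1)) z₁ := by
    simpa using (hasDerivAt_id z₁).cpow_const (c := r) hslit
  have d2 : HasDerivAt (fun z : ℂ => z₂ / z) (-z₂ / z₁ ^ 2) z₁ := by
    have := (hasDerivAt_inv h3).const_mul z₂
    simp only [div_eq_mul_inv]
    exact this.congr_deriv (by field_simp)
  have d3 : HasDerivAt (fun z : ℂ => f (z₂ / z)) (deriv f (z₂ / z₁) * (-z₂ / z₁ ^ 2)) z₁ :=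
    HasDerivAt.comp z₁ (hf _ hmem).differentiableAt.hasDerivAt d2
  have := (d1.mul_const (z₂ ^ s)).mul d3
  refine this.congr_deriv ?_
  have e : z₁ ^ r = z₁ ^ (r - 1) * z₁ := by
    conv_lhs => rw [show r = (r - 1) + 1 by ring]
    rw [Complex.cpow_add _ _ h3, Complex.cpow_one]
  rw [e]
  field_simp
  ring

theorem hasDerivAt_iterateTerm (c : ℂ → ℂ → ℂ) {z₁ z₂ : ℂ} (h : 0 < (z₁ - z₂).re) (p : ℂ × ℂ) :
    HasDerivAt (fun z => iterateTerm c z z₂ p)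
      (iterateTerm (fun n m => -n * c (n - 1) m) z₁ z₂ (p.1 + 1, p.2)) z₁ := by
  have hslit : z₁ - z₂ ∈ Complex.slitPlane := Or.inl h
  have d1 : HasDerivAt (fun z : ℂ => (z - z₂) ^ (-p.1 - 1))
      ((-p.1 - 1) * (z₁ - z₂) ^ (-p.1 - 1 - 1)) z₁ := by
    simpa using ((hasDerivAt_id z₁).sub_const z₂).cpow_const (c := -p.1 - 1) hslit
  have := (d1.const_mul (c p.1 p.2)).mul_const (z₂ ^ (-p.2 - 1))
  refine this.congr_deriv ?_
  simp only [iterateTerm]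
  rw [add_sub_cancel_right, show -(p.1 + 1) - 1 = -p.1 - 1 - 1 by ring]
  ring

/-- Differentiation with respect to `z₁`. -/
theorem HasExpansion.derivative {c d : ℂ → ℂ → ℂ} (h : HasExpansion c d) :
    HasExpansion (fun n m => -n * c (n - 1) m) (fun m n => -m * d (m - 1) n) := by
  obtain ⟨g, hg, hd⟩ := h
  obtain ⟨G, hG, hGc, -⟩ := MultivaluedSum.exists_of_fintype (fun i => g.r i - 1) g.s
    (fun i x => g.r i * g.f i x - x * deriv (g.f i) x)
    (fun i => (analyticOnNhd_const.mul (g.analytic i)).sub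
      (analyticOnNhd_id.mul (g.analytic i).deriv))
  refine ⟨G, fun z₁ z₂ hz => ?_, fun m n => ?_⟩
  · obtain ⟨h1, h2, h3, -⟩ := overlapRegion_ne hz
    -- a rectangle around the logarithm of `z₁ - z₂` that stays in the region
    have hreg : ∀ᶠ w in nhds z₁, (w, z₂) ∈ overlapRegion := by
      have hc : Continuous fun w : ℂ => (w, z₂) := by fun_prop
      exact hc.continuousAt.eventually_mem (isOpen_overlapRegion.mem_nhds hz)
    set ζ₀ := Complex.log (z₁ - z₂) with hζ₀
    have hexp : Filter.Tendsto (fun ζ => Complex.exp ζ + z₂) (nhds ζ₀) (nhds z₁) := by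
      have hc : Continuous fun ζ : ℂ => Complex.exp ζ + z₂ := by fun_prop
      have := hc.tendsto ζ₀
      rwa [Complex.exp_log h1, sub_add_cancel] at this
    obtain ⟨δ', hδ', hδm'⟩ := Metric.eventually_nhds_iff.1 (hexp.eventually hreg)
    obtain ⟨δ, hδ, hδ1, hδm⟩ : ∃ δ : ℝ, 0 < δ ∧ δ ≤ 1 ∧ ∀ ⦃y : ℂ⦄, dist y ζ₀ < δ →
        (Complex.exp y + z₂, z₂) ∈ overlapRegion :=
      ⟨min δ' 1, lt_min hδ' one_pos, min_le_right _ _,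
        fun y hy => hδm' (hy.trans_le (min_le_left _ _))⟩
    have him : |ζ₀.im| < Real.pi / 2 := by
      rw [hζ₀, Complex.log_im, Complex.abs_arg_lt_pi_div_two_iff]
      exact Or.inl hz.1
    have hcorner : ∀ a b : ℝ, |a - ζ₀.re| ≤ δ / 4 → |b - ζ₀.im| ≤ δ / 4 →
        (Complex.exp ⟨a, b⟩ + z₂, z₂) ∈ overlapRegion := by
      intro a b ha hb
      refine hδm ?_
      rw [dist_eq_norm]
      refine (Complex.norm_le_abs_re_add_abs_im _).trans_lt ?_
      simp only [Complex.sub_re, Complex.sub_im]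
      linarith
    set F : ℂ × ℂ → ℂ → ℂ := fun p z => iterateTerm c z z₂ p with hF
    set x₁ := ζ₀.re - δ / 4
    set x₂ := ζ₀.re + δ / 4
    set y₁ := ζ₀.im - δ / 4
    set y₂ := ζ₀.im + δ / 4
    have hx₁ : |x₁ - ζ₀.re| ≤ δ / 4 := by
      simp only [x₁]; rw [sub_sub_cancel_left, abs_neg, abs_of_pos (by linarith)]
    have hx₂ : |x₂ - ζ₀.re| ≤ δ / 4 := by
      simp only [x₂]; rw [add_sub_cancel_left, abs_of_pos (by linarith)]
    have hy₁ : |y₁ - ζ₀.im| ≤ δ / 4 := by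
      simp only [y₁]; rw [sub_sub_cancel_left, abs_neg, abs_of_pos (by linarith)]
    have hy₂ : |y₂ - ζ₀.im| ≤ δ / 4 := by
      simp only [y₂]; rw [add_sub_cancel_left, abs_of_pos (by linarith)]
    have hpi : ∀ w, (w, z₂) ∈ overlapRegion → ∀ p, F p w =
        c p.1 p.2 * z₂ ^ (-p.2 - 1) * Complex.exp ((-p.1 - 1) * Complex.log (w - z₂)) := by
      intro w hw p
      simp only [hF, iterateTerm]
      rw [Complex.cpow_def_of_ne_zero (overlapRegion_ne hw).1, mul_comm (Complex.log _)]
      ring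
    have hnorm : ∀ a b : ℝ, |a - ζ₀.re| ≤ δ / 4 → |b - ζ₀.im| ≤ δ / 4 → Summable fun p : ℂ × ℂ =>
        ‖c p.1 p.2 * z₂ ^ (-p.2 - 1)‖ * ‖Complex.exp ((-p.1 - 1) * ⟨a, b⟩)‖ := by
      intro a b ha hb
      have hs := (hg _ _ (hcorner a b ha hb)).summable
      refine hs.norm.congr fun p => ?_
      have hp := hpi _ (hcorner a b ha hb) p
      have hb' := abs_le.1 hb
      have him' := abs_lt.1 him
      have hpi3 := Real.pi_gt_three
      -- At a corner the imaginary part is at most `π/2 + 1/4` in absolute value, below `π`, so the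
      -- principal logarithm inverts the exponential.
      rw [add_sub_cancel_right, Complex.log_exp (by simp only; linarith)
        (by simp only; linarith)] at hp
      rw [← norm_mul, ← hp]
    -- The exponents are arbitrary complex numbers, so a power series bound is not at hand. Each
    -- term is instead bounded on the rectangle by the sum of its norms at the four corners, where
    -- the series converges absolutely. This summable majorant justifies termwise differentiation.
    set u : ℂ × ℂ → ℝ := fun p => ‖c p.1 p.2 * z₂ ^ (-p.2 - 1)‖ *
      (‖Complex.exp ((-p.1 - 1) * ⟨x₁, y₁⟩)‖ + ‖Complex.exp ((-p.1 - 1) * ⟨x₁, y₂⟩)‖ +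
      (‖Complex.exp ((-p.1 - 1) * ⟨x₂, y₁⟩)‖ + ‖Complex.exp ((-p.1 - 1) * ⟨x₂, y₂⟩)‖)) with hu
    have hus : Summable u := by
      refine (((hnorm _ _ hx₁ hy₁).add (hnorm _ _ hx₁ hy₂)).add
        ((hnorm _ _ hx₂ hy₁).add (hnorm _ _ hx₂ hy₂))).congr fun p => ?_
      simp only [hu]; ring
    have hlogc : ∀ᶠ w in nhds z₁, Complex.log (w - z₂) ∈ Metric.ball ζ₀ (δ / 4) := by
      have hslit : z₁ - z₂ ∈ Complex.slitPlane := Or.inl hz.1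
      have : ContinuousAt (fun w => Complex.log (w - z₂)) z₁ :=
        ContinuousAt.clog (by fun_prop) hslit
      exact this.eventually_mem (Metric.ball_mem_nhds _ (by linarith))
    obtain ⟨ε, hε, hεm⟩ := Metric.eventually_nhds_iff_ball.1 (hreg.and hlogc)
    have hle : ∀ (p : ℂ × ℂ) (w : ℂ), w ∈ Metric.ball z₁ ε → ‖F p w‖ ≤ u p := by
      intro p w hw
      obtain ⟨hw1, hw2⟩ := hεm w hw
      rw [hpi w hw1 p, norm_mul]
      refine mul_le_mul_of_nonneg_left ?_ (norm_nonneg _)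
      rw [mem_ball_iff_norm] at hw2
      have hre := abs_le.1 ((Complex.abs_re_le_norm _).trans hw2.le)
      have him := abs_le.1 ((Complex.abs_im_le_norm _).trans hw2.le)
      simp only [Complex.sub_re, Complex.sub_im] at hre him
      refine Complex.norm_exp_mul_le_corners _ _ ?_ ?_ ?_ ?_ <;>
        simp only [x₁, x₂, y₁, y₂] <;> linarith
    have hdiff : ∀ p, DifferentiableOn ℂ (F p) (Metric.ball z₁ ε) := fun p w hw =>
      (hasDerivAt_iterateTerm c (hεm w hw).1.1 p).differentiableAt.differentiableWithinAt
    have hsum := Complex.hasSum_deriv_of_summable_norm hus hdiff Metric.isOpen_ball hle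
      (Metric.mem_ball_self hε)
    have hderiv : deriv (fun w => ∑' p, F p w) z₁ = G.eval z₁ z₂ := by
      have e1 : (fun w => ∑' p, F p w) =ᶠ[nhds z₁] fun w => g.eval w z₂ := by
        filter_upwards [hreg] with w hw
        exact (hg w z₂ hw).tsum_eq
      rw [e1.deriv_eq, hG]
      exact (HasDerivAt.fun_sum fun i _ =>
        MultivaluedSum.hasDerivAt_term (g.r i) (g.s i) (g.analytic i) hz).deriv
    rw [hderiv] at hsum
    rw [← ((Equiv.addRight (1 : ℂ)).prodCongr (Equiv.refl ℂ)).hasSum_iff]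
    refine hsum.of_eq ?_ rfl
    funext p
    exact (hasDerivAt_iterateTerm c hz.1 p).deriv.symm
  · beta_reduce
    rw [hd, hGc, MultivaluedSum.coeff_eq, Finset.mul_sum]
    refine Finset.sum_congr rfl fun i _ => ?_
    have hf := g.analytic i 0 (Metric.mem_ball_self one_pos)
    symm
    refine termCoeff_eq_mul (-m) (fun j => ?_) (fun j h1 h2 => ?_)
    · refine and_congr ⟨fun h => ?_, fun h => ?_⟩ Iff.rfl <;> linear_combination h
    · have e : (fun x => g.r i * g.f i x - x * deriv (g.f i) x)
          = fun x => g.r i * g.f i x + (-1) * (x * deriv (g.f i) x) := by funext x; ring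
      have a1 : AnalyticAt ℂ (fun x => g.r i * g.f i x) 0 := analyticAt_const.mul hf
      have a2 : AnalyticAt ℂ (fun x => x * deriv (g.f i) x) 0 := analyticAt_id.mul hf.deriv
      have a3 : AnalyticAt ℂ (fun x => (-1) * (x * deriv (g.f i) x)) 0 := analyticAt_const.mul a2
      rw [e, taylorCoeff_add a1 a3, taylorCoeff_const_mul, taylorCoeff_const_mul,
        taylorCoeff_id_mul_deriv hf]
      linear_combination -taylorCoeff (g.f i) j * h1

/-- Homogeneous iterates have homogeneous expansions. -/
theorem HasExpansion.homogeneous {c d : ℂ → ℂ → ℂ} (h : HasExpansion c d) {σ : ℂ}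
    (hc : ∀ n m, n + m ≠ σ → c n m = 0) {m n : ℂ} (hmn : m + n ≠ σ) : d m n = 0 := by
  obtain ⟨g, hg, hd⟩ := h
  by_contra hne
  apply hmn
  -- Scaling both variables by `t = e^τ` multiplies the iterate by `t^{-σ-2}` and the coefficient `d
  -- m n` by `t^{-m-n-2}`. By uniqueness a nonzero coefficient forces these to agree for all `τ`.
  have key : ∀ τ : ℝ, Complex.exp ((τ : ℂ) * (m + n)) = Complex.exp ((τ : ℂ) * σ) := by
    intro τ
    set t : ℝ := Real.exp τ with ht
    have htpos : 0 < t := Real.exp_pos τ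
    have htne : (t : ℂ) ≠ 0 := by exact_mod_cast htpos.ne'
    have hlog : Complex.log (t : ℂ) = τ := by
      rw [← Complex.ofReal_log htpos.le, ht, Real.log_exp]
    have hmul : ∀ (z r : ℂ), z ≠ 0 → ((t : ℂ) * z) ^ r = (t : ℂ) ^ r * z ^ r := by
      intro z r hz
      rw [Complex.cpow_def_of_ne_zero (mul_ne_zero htne hz), Complex.cpow_def_of_ne_zero htne,
        Complex.cpow_def_of_ne_zero hz, ← Complex.exp_add, Complex.log_ofReal_mul htpos hz, hlog,
        ht, Real.log_exp]
      congr 1; ring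
    obtain ⟨G, hG, hGc, -⟩ := MultivaluedSum.exists_of_fintype g.r g.s
      (fun i x => (t : ℂ) ^ (g.r i + g.s i) * g.f i x)
      (fun i => analyticOnNhd_const.mul (g.analytic i))
    have h1 : HasExpansion (fun n m => (t : ℂ) ^ (-σ - 2) * c n m) G.coeff := by
      refine ⟨G, fun z₁ z₂ hz => ?_, fun _ _ => rfl⟩
      obtain ⟨e1, e2, e3, -⟩ := overlapRegion_ne hz
      have hz' : ((t : ℂ) * z₁, (t : ℂ) * z₂) ∈ overlapRegion := by
        obtain ⟨a1, a2, a3, a4⟩ := hz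
        have ht' : 0 < ‖t‖ := by simpa using htpos.ne'
        refine ⟨?_, ?_, ?_, ?_⟩
        · simp only [← mul_sub, Complex.re_ofReal_mul]; exact mul_pos htpos a1
        · simp only [Complex.re_ofReal_mul]; exact mul_pos htpos a2
        · simp only [← mul_sub, norm_mul, Complex.norm_real]
          exact mul_lt_mul_of_pos_left a3 ht'
        · simp only [norm_mul, Complex.norm_real]
          exact mul_lt_mul_of_pos_left a4 ht'
      refine (hg _ _ hz').of_eq ?_ ?_
      · funext p
        by_cases hp : p.1 + p.2 = σ
        · simp only [iterateTerm]
          rw [← mul_sub, hmul _ _ e1, hmul _ _ e2, ← hp,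
            show -(p.1 + p.2) - 2 = (-p.1 - 1) + (-p.2 - 1) by ring, Complex.cpow_add _ _ htne]
          ring
        · simp only [iterateTerm, hc _ _ hp]; ring
      · rw [hG, MultivaluedSum.eval]
        refine Finset.sum_congr rfl fun i _ => ?_
        rw [hmul _ _ e3, hmul _ _ e2, mul_div_mul_left _ _ htne, Complex.cpow_add _ _ htne]
        ring
    have h2 := h1.unique (HasExpansion.smul ((t : ℂ) ^ (-σ - 2)) ⟨g, hg, hd⟩)
    have h3 : G.coeff m n = (t : ℂ) ^ (-m - n - 2) * d m n := by
      rw [hGc, hd, MultivaluedSum.coeff_eq, Finset.mul_sum]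
      refine Finset.sum_congr rfl fun i _ => ?_
      refine termCoeff_eq_mul _ (fun j => Iff.rfl) fun j h1 h2 => ?_
      rw [taylorCoeff_const_mul]
      congr 2
      linear_combination -h1 - h2
    have h4 := mul_right_cancel₀ hne (h3.symm.trans (congrFun (congrFun h2 m) n))
    rw [Complex.cpow_def_of_ne_zero htne, Complex.cpow_def_of_ne_zero htne, hlog] at h4
    have h5 := congrArg (fun x => x⁻¹ * Complex.exp (-2 * (τ : ℂ))) h4
    simp only [← Complex.exp_neg, ← Complex.exp_add] at h5
    convert h5 using 2 <;> ring
  exact eq_of_exp_real_mul_eq key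

end

noncomputable section

/-! ### Gradings by generalized weights -/

/-- A Leibniz rule propagates nilpotency. -/
theorem pow_apply_eq_zero_of_leibniz {A B C : Type*} [AddCommGroup A] [Module ℂ A]
    [AddCommGroup B] [Module ℂ B] [AddCommGroup C] [Module ℂ C] (α : Module.End ℂ A)
    (β : Module.End ℂ B) (T : Module.End ℂ C) (F : A →ₗ[ℂ] B →ₗ[ℂ] C)
    (h : ∀ a b, T (F a b) = F (α a) b + F a (β b)) (N : ℕ) :
    ∀ (p q : ℕ) (a : A) (b : B), p + q ≤ N → (α ^ p) a = 0 → (β ^ q) b = 0 →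
      (T ^ N) (F a b) = 0 := by
  induction N with
  | zero =>
    intro p q a b hpq ha hb
    obtain rfl : p = 0 := by omega
    have : a = 0 := by simpa using ha
    simp [this]
  | succ N ih =>
    intro p q a b hpq ha hb
    rw [pow_succ, Module.End.mul_apply, h, map_add]
    have h1 : (T ^ N) (F (α a) b) = 0 := by
      rcases p with _ | p
      · have : a = 0 := by simpa using ha
        simp [this]
      · rw [pow_succ, Module.End.mul_apply] at ha
        exact ih p q _ _ (by omega) ha hb
    have h2 : (T ^ N) (F a (β b)) = 0 := by
      rcases q with _ | q
      · have : b = 0 := by simpa using hb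
        simp [this]
      · rw [pow_succ, Module.End.mul_apply] at hb
        exact ih p q _ _ (by omega) ha hb
    rw [h1, h2, add_zero]

theorem Module.End.maxGenEigenspace_eq_bot {W : Type*} [AddCommGroup W] [Module ℂ W]
    (T : Module.End ℂ W) (h : ℂ) (h0 : T.eigenspace h = ⊥) : T.maxGenEigenspace h = ⊥ := by
  rw [eq_bot_iff]
  intro x hx
  obtain ⟨k, hk⟩ := (Module.End.mem_maxGenEigenspace _ _ _).1 hx
  rw [Submodule.mem_bot]
  induction k generalizing x with
  | zero => simpa using hk
  | succ k ih =>
    rw [pow_succ, Module.End.mul_apply] at hk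
    have h1 : (T - h • 1) x = 0 :=
      ih ((Module.End.mem_maxGenEigenspace _ _ _).2 ⟨k, hk⟩) hk
    have h2 : x ∈ T.eigenspace h := by
      rw [Module.End.mem_eigenspace_iff]
      simpa [sub_eq_zero] using h1
    simpa [h0] using h2

section

variable {V : Type v} [AddCommGroup V] [Module ℂ V] [VertexOperatorAlgebra V]

/-- The consequences of membership in either category that are used: the space is the sum of its
generalized weight spaces, and the weights are bounded below in each class modulo `ℤ`. -/
structure WeakModule.IsWeightGraded {W : Type u} [AddCommGroup W] [Module ℂ W]
    (S : WeakModule V W) : Prop where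
  iSup_eq_top : ⨆ h, S.genWeightSpace h = ⊤
  bounded : ∀ h : ℂ, ∃ N : ℤ, ∀ n : ℤ, n ≤ N → S.genWeightSpace (h + n) = ⊥

/-- In the locally finite case each vector lies in a finite dimensional `L(0)`-stable subspace,
which over `ℂ` is the sum of its generalized eigenspaces. -/
theorem ModuleCategory.Mem.isWeightGraded {D : ModuleCategory} {W : Type u} [AddCommGroup W]
    [Module ℂ W] {S : WeakModule V W} (h : D.Mem S) : S.IsWeightGraded := by
  cases D with
  | ordinary =>
    obtain ⟨h1, -, h3⟩ := h
    refine ⟨?_, fun h => ?_⟩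
    · rw [eq_top_iff, ← h1]
      exact iSup_mono fun h => (S.L 0).genEigenspace_le_maximal h 1
    · obtain ⟨N, hN⟩ := h3 h
      exact ⟨N, fun n hn => Module.End.maxGenEigenspace_eq_bot _ _ (hN n hn)⟩
  | locallyFinite =>
    obtain ⟨h1, s, hs⟩ := h
    refine ⟨?_, fun h => ?_⟩
    · rw [eq_top_iff]
      intro w _
      obtain ⟨U, hfin, hwU, hU⟩ := h1 w
      have htop := Module.End.iSup_maxGenEigenspace_eq_top ((S.L 0).restrict hU)
      have hw : (⟨w, hwU⟩ : U) ∈ ⨆ μ, Module.End.maxGenEigenspace ((S.L 0).restrict hU) μ := by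
        rw [htop]; trivial
      have h2 : ∀ x : U, x ∈ ⨆ μ, Module.End.maxGenEigenspace ((S.L 0).restrict hU) μ →
          (x : W) ∈ ⨆ h, S.genWeightSpace h := by
        intro x hx
        refine Submodule.iSup_induction (motive := fun x : U => (x : W) ∈ ⨆ h, S.genWeightSpace h)
          _ hx (fun i x hx => ?_) (Submodule.zero_mem _) fun x y hx hy => Submodule.add_mem _ hx hy
        refine Submodule.mem_iSup_of_mem i ?_
        rw [Module.End.maxGenEigenspace, Module.End.genEigenspace_restrict] at hx
        exact hx
      exact h2 _ hw
    -- Each set `c + ℕ` meets the class `h + ℤ` in nothing or in a half-line bounded below, and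
    -- there are finitely many `c`.
    · have hc : ∀ c ∈ s, ∃ N : ℤ, ∀ n : ℤ, n ≤ N → ∀ k : ℕ, h + n ≠ c + k := by
        intro c _
        by_cases hex : ∃ (n : ℤ) (k : ℕ), h + n = c + k
        · obtain ⟨n₀, k₀, h0⟩ := hex
          refine ⟨n₀ - k₀ - 1, fun n hn k hk => ?_⟩
          have : ((n - n₀ : ℤ) : ℂ) = ((k - k₀ : ℤ) : ℂ) := by
            push_cast; linear_combination hk - h0
          have : n - n₀ = k - k₀ := by exact_mod_cast this
          omega
        · push Not at hex
          exact ⟨0, fun n _ k => hex n k⟩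
      choose! N hN using hc
      obtain ⟨M, hM⟩ : ∃ M : ℤ, ∀ c ∈ s, M ≤ N c := by
        obtain ⟨M, hM⟩ := (s.finite_toSet.image N).bddBelow
        exact ⟨M, fun c hc => hM ⟨c, hc, rfl⟩⟩
      refine ⟨M, fun n hn => ?_⟩
      by_contra hne
      obtain ⟨c, hcs, k, hk⟩ := hs _ hne
      exact hN c hcs n (hn.trans (hM c hcs)) k hk

namespace WeakModule

variable {W : Type u} [AddCommGroup W] [Module ℂ W] {S : WeakModule V W}

theorem IsWeightGraded.induction (hS : S.IsWeightGraded) {P : W → Prop} (w : W)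
    (hom : ∀ h, ∀ w ∈ S.genWeightSpace h, P w) (zero : P 0)
    (add : ∀ x y, P x → P y → P (x + y)) : P w := by
  have : w ∈ ⨆ h, S.genWeightSpace h := by rw [hS.iSup_eq_top]; trivial
  exact Submodule.iSup_induction (motive := P) _ this hom zero add

theorem IsWeightGraded.linearMap_ext (hS : S.IsWeightGraded) {E : Type*} [AddCommGroup E]
    [Module ℂ E] {f g : W →ₗ[ℂ] E} (h : ∀ h, ∀ w ∈ S.genWeightSpace h, f w = g w) : f = g := by
  ext w
  refine hS.induction w h ?_ fun x y hx hy => ?_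
  · simp
  · rw [map_add, map_add, hx, hy]

/-- Projections to the generalized weight spaces. -/
theorem IsWeightGraded.exists_proj (hS : S.IsWeightGraded) :
    ∃ π : ℂ → Module.End ℂ W, (∀ h w, π h w ∈ S.genWeightSpace h) ∧
      (∀ h, ∀ w ∈ S.genWeightSpace h, π h w = w) ∧
      (∀ h h', h ≠ h' → ∀ w ∈ S.genWeightSpace h, π h' w = 0) ∧
      ∀ w, ∃ s : Finset ℂ, (∑ h ∈ s, π h w = w) ∧ ∀ h ∉ s, π h w = 0 := by
  classical
  have hint : DirectSum.IsInternal S.genWeightSpace :=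
    DirectSum.isInternal_submodule_of_iSupIndep_of_iSup_eq_top
      (Module.End.independent_maxGenEigenspace (S.L 0)) hS.iSup_eq_top
  let _ := hint.chooseDecomposition
  refine ⟨fun h => (S.genWeightSpace h).subtype ∘ₗ
    (DirectSum.component ℂ ℂ (fun h => S.genWeightSpace h) h) ∘ₗ
    (DirectSum.decomposeLinearEquiv S.genWeightSpace).toLinearMap, ?_, ?_, ?_, ?_⟩
  · intro h w; exact Subtype.property _
  · intro h w hw
    exact DirectSum.decompose_of_mem_same _ hw
  · intro h h' hne w hw
    exact DirectSum.decompose_of_mem_ne _ hw hne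
  · intro w
    refine ⟨_, DirectSum.sum_support_decompose S.genWeightSpace w, fun h hh => ?_⟩
    have : DirectSum.decompose S.genWeightSpace w h = 0 := by simpa using hh
    show ((DirectSum.decompose S.genWeightSpace w h : S.genWeightSpace h) : W) = 0
    rw [this]; rfl

theorem IsHomogeneousFunctional.inGradedDual {f : Module.Dual ℂ W}
    (h : S.IsHomogeneousFunctional f) : S.InGradedDual f := by
  obtain ⟨k, hk⟩ := h
  refine (Set.finite_singleton k).subset ?_
  rintro h ⟨w, hw, hne⟩
  by_contra hh
  exact hne (hk h hh w hw)

theorem InGradedDual.zero : S.InGradedDual (0 : Module.Dual ℂ W) := by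
  refine Set.finite_empty.subset ?_
  rintro h ⟨w, -, hw⟩
  exact hw rfl

theorem InGradedDual.add {f g : Module.Dual ℂ W} (hf : S.InGradedDual f) (hg : S.InGradedDual g) :
    S.InGradedDual (f + g) := by
  refine (hf.union hg).subset ?_
  rintro h ⟨w, hw, hne⟩
  by_cases h0 : f w = 0
  · exact Or.inr ⟨w, hw, fun h1 => hne (by simp [h0, h1])⟩
  · exact Or.inl ⟨w, hw, h0⟩

theorem IsWeightGraded.exists_sum_homogeneous (hS : S.IsWeightGraded) {f : Module.Dual ℂ W}
    (hf : S.InGradedDual f) : ∃ (s : Finset ℂ) (F : ℂ → Module.Dual ℂ W), f = ∑ h ∈ s, F h ∧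
      ∀ h, ∀ h' ≠ h, ∀ w ∈ S.genWeightSpace h', F h w = 0 := by
  obtain ⟨π, h1, h2, h3, h4⟩ := hS.exists_proj
  have hf : {h : ℂ | ∃ w ∈ S.genWeightSpace h, f w ≠ 0}.Finite := hf
  refine ⟨hf.toFinset, fun h => f ∘ₗ π h, ?_, fun h h' hne w hw => ?_⟩
  · refine hS.linearMap_ext fun h w hw => ?_
    rw [LinearMap.sum_apply]
    by_cases hh : h ∈ hf.toFinset
    · rw [Finset.sum_eq_single_of_mem h hh]
      · rw [LinearMap.comp_apply, h2 h w hw]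
      · intro k _ hk
        rw [LinearMap.comp_apply, h3 h k hk.symm w hw, map_zero]
    · rw [Finset.sum_eq_zero]
      · by_contra hne
        exact hh (by rw [Set.Finite.mem_toFinset]; exact ⟨w, hw, hne⟩)
      · intro k hk
        rw [LinearMap.comp_apply, h3 h k (fun e => hh (e ▸ hk)) w hw, map_zero]
  · rw [LinearMap.comp_apply, h3 h' h hne w hw, map_zero]

theorem IsWeightGraded.inGradedDual_induction (hS : S.IsWeightGraded) {P : Module.Dual ℂ W → Prop}
    {f : Module.Dual ℂ W} (hf : S.InGradedDual f)
    (hom : ∀ (h : ℂ) (f : Module.Dual ℂ W),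
      (∀ h' ≠ h, ∀ w ∈ S.genWeightSpace h', f w = 0) → P f)
    (zero : P 0) (add : ∀ f g, P f → P g → P (f + g)) : P f := by
  obtain ⟨s, F, rfl, hF⟩ := hS.exists_sum_homogeneous hf
  exact Finset.sum_induction _ _ add zero fun h _ => hom h _ (hF h)

/-- A nonzero component of `w` is detected by a functional composed with the projection to that
weight, which is homogeneous. Hence vector identities may be tested on the graded dual. -/
theorem IsWeightGraded.eq_zero_of_forall (hS : S.IsWeightGraded) {w : W}
    (h : ∀ f : Module.Dual ℂ W, S.IsHomogeneousFunctional f → f w = 0) : w = 0 := by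
  obtain ⟨π, h1, h2, h3, h4⟩ := hS.exists_proj
  obtain ⟨s, hs, -⟩ := h4 w
  rw [← hs]
  refine Finset.sum_eq_zero fun k _ => ?_
  by_contra hne
  obtain ⟨f, hf⟩ := Module.Projective.exists_dual_ne_zero ℂ hne
  refine hf (h (f ∘ₗ π k) ⟨k, fun h' hne' u hu => ?_⟩)
  rw [LinearMap.comp_apply, h3 h' k hne' u hu, map_zero]

theorem IsWeightGraded.ext (hS : S.IsWeightGraded) {x y : W}
    (h : ∀ f : Module.Dual ℂ W, S.InGradedDual f → f x = f y) : x = y := by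
  rw [← sub_eq_zero]
  refine hS.eq_zero_of_forall fun f hf => ?_
  rw [map_sub, h f (IsHomogeneousFunctional.inGradedDual hf), sub_self]

theorem mem_genWeightSpace {h : ℂ} {w : W} :
    w ∈ S.genWeightSpace h ↔ ∃ k : ℕ, ((S.L 0 - h • 1) ^ k) w = 0 :=
  Module.End.mem_maxGenEigenspace _ _ _

end WeakModule

end

end

/-! ### Weights of modes. -/

noncomputable section

variable {V : Type v} [AddCommGroup V] [Module ℂ V] [VertexOperatorAlgebra V]

theorem VertexOperatorAlgebra.induction {P : V → Prop} (a : V)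
    (hom : ∀ k, ∀ a ∈ VertexOperatorAlgebra.grade (V := V) k, P a) (zero : P 0)
    (add : ∀ x y, P x → P y → P (x + y)) : P a := by
  have : a ∈ ⨆ k, VertexOperatorAlgebra.grade (V := V) k := by
    rw [VertexOperatorAlgebra.grade_internal.submodule_iSup_eq_top]; trivial
  exact Submodule.iSup_induction (motive := P) _ this hom zero add

section

variable {W₁ W₂ W₃ : Type u} [AddCommGroup W₁] [Module ℂ W₁]
  [AddCommGroup W₂] [Module ℂ W₂] [AddCommGroup W₃] [Module ℂ W₃]
  {S₁ : WeakModule V W₁} {S₂ : WeakModule V W₂} {S₃ : WeakModule V W₃}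

theorem WeakModule.L_zero (S : WeakModule V W₁) :
    S.L 0 = S.Y VertexOperatorAlgebra.conf 1 := by simp [WeakModule.L]

theorem WeakModule.L_neg_one (S : WeakModule V W₁) :
    S.L (-1) = S.Y VertexOperatorAlgebra.conf 0 := by simp [WeakModule.L]

theorem IntertwiningOperator.L_zero_mode (I : IntertwiningOperator S₁ S₂ S₃) (w : W₁) (n : ℂ)
    (u : W₂) : S₃.L 0 (I.mode w n u)
      = I.mode (S₁.L 0 w) n u + I.mode w n (S₂.L 0 u) - (n + 1) • I.mode w n u := by
  have h := I.commutator VertexOperatorAlgebra.conf w u 1 n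
  have h1 := iterSum_natCast
    (fun p n => I.mode (S₁.Y VertexOperatorAlgebra.conf p w) n u) 0 1 n
  simp only [Nat.cast_one] at h1
  rw [h1] at h
  simp only [Finset.sum_range_succ, Finset.sum_range_zero, zero_add, Nat.choose_zero_right,
    Nat.choose_self, Nat.cast_one, one_smul, Nat.cast_zero, sub_zero,
    add_sub_cancel_right] at h
  rw [← S₁.L_neg_one, I.derivative, ← S₁.L_zero, ← S₂.L_zero, ← S₃.L_zero,
    add_sub_cancel_right] at h
  rw [sub_eq_iff_eq_add] at h
  rw [h, LinearMap.smul_apply]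
  module

/-- After subtracting the expected weights, `L(0)` obeys a Leibniz rule on `(w, u) ↦ w_n u`;
nilpotency of orders `p` and `q` gives nilpotency of order `p + q`. -/
theorem IntertwiningOperator.mode_mem (I : IntertwiningOperator S₁ S₂ S₃) {h₁ h₂ : ℂ} {w : W₁}
    {u : W₂} (hw : w ∈ S₁.genWeightSpace h₁) (hu : u ∈ S₂.genWeightSpace h₂) (n : ℂ) :
    I.mode w n u ∈ S₃.genWeightSpace (h₁ + h₂ - n - 1) := by
  rw [WeakModule.mem_genWeightSpace] at *
  obtain ⟨p, hp⟩ := hw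
  obtain ⟨q, hq⟩ := hu
  refine ⟨p + q, pow_apply_eq_zero_of_leibniz _ _ _
    ((LinearMap.proj n : (ℂ → (W₂ →ₗ[ℂ] W₃)) →ₗ[ℂ] _) ∘ₗ I.mode) (fun a b => ?_) _ p q w u le_rfl
    hp hq⟩
  simp only [LinearMap.comp_apply, LinearMap.proj_apply, LinearMap.sub_apply,
    LinearMap.smul_apply, Module.End.one_apply, map_sub, map_smul,
    I.L_zero_mode]
  module

theorem WeakModule.L_zero_mode (S : WeakModule V W₁) {k : ℤ} {a : V}
    (ha : a ∈ VertexOperatorAlgebra.grade k) (n : ℤ) (u : W₁) :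
    S.L 0 (S.Y a n u) = S.Y a n (S.L 0 u) + ((k : ℂ) - n - 1) • S.Y a n u := by
  have h := S.commutator VertexOperatorAlgebra.conf a u 1 n
  have h1 := iterSum_natCast
    (fun p n => S.Y (VertexOperatorAlgebra.Y VertexOperatorAlgebra.conf p a) n u) 0 1 n
  simp only [Nat.cast_one] at h1
  rw [h1] at h
  simp only [Finset.sum_range_succ, Finset.sum_range_zero, zero_add, Nat.choose_zero_right,
    Nat.choose_self, Nat.cast_one, one_smul, Nat.cast_zero, sub_zero,
    add_sub_cancel_right] at h
  rw [S.derivative, VertexOperatorAlgebra.weight k a ha, ← S.L_zero, add_sub_cancel_right] at h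
  rw [sub_eq_iff_eq_add] at h
  rw [h, map_smul]
  simp only [Pi.smul_apply, LinearMap.smul_apply]
  push_cast
  module

/-- Since `a` is a true `L(0)`-eigenvector, `a_n` intertwines the two shifted operators, and the
same nilpotency order works. -/
theorem WeakModule.mode_mem (S : WeakModule V W₁) {k : ℤ} {a : V}
    (ha : a ∈ VertexOperatorAlgebra.grade k) (n : ℤ) {h : ℂ} {u : W₁}
    (hu : u ∈ S.genWeightSpace h) : S.Y a n u ∈ S.genWeightSpace (h + k - n - 1) := by
  rw [WeakModule.mem_genWeightSpace] at *
  obtain ⟨q, hq⟩ := hu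
  refine ⟨q, ?_⟩
  have key : ∀ q : ℕ, ∀ u, ((S.L 0 - (h + k - n - 1) • 1) ^ q) (S.Y a n u)
      = S.Y a n (((S.L 0 - h • 1) ^ q) u) := by
    intro q
    induction q with
    | zero => intro u; simp
    | succ q ih =>
      intro u
      rw [pow_succ, pow_succ, Module.End.mul_apply, Module.End.mul_apply, ← ih]
      congr 1
      simp only [LinearMap.sub_apply, LinearMap.smul_apply, Module.End.one_apply, map_sub, map_smul,
        S.L_zero_mode ha]
      module
  rw [key, hq, map_zero]

/-- Functionals of the graded dual kill the images of modes of very negative index. -/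
theorem WeakModule.IsWeightGraded.exists_mode_bound (hS : S₁.IsWeightGraded)
    {f : Module.Dual ℂ W₁} (hf : S₁.InGradedDual f) (a : V) :
    ∃ p₀ : ℤ, ∀ p < p₀, ∀ u, f (S₁.Y a p u) = 0 := by
  refine hS.inGradedDual_induction (P := fun f => ∃ p₀ : ℤ, ∀ p < p₀, ∀ u, f (S₁.Y a p u) = 0)
    hf (fun h f hf => ?_) ⟨0, fun _ _ _ => rfl⟩ ?_
  · refine VertexOperatorAlgebra.induction (P := fun a => ∃ p₀ : ℤ, ∀ p < p₀, ∀ u,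
      f (S₁.Y a p u) = 0) a (fun k a ha => ?_) ⟨0, fun _ _ _ => by simp⟩ ?_
    · obtain ⟨N, hN⟩ := hS.bounded h
      refine ⟨N + k - 1, fun p hp u => ?_⟩
      refine hS.induction (P := fun u => f (S₁.Y a p u) = 0) u (fun h' u hu => ?_) (by simp)
        fun x y hx hy => by rw [map_add, map_add, hx, hy, add_zero]
      by_cases he : h' + k - p - 1 = h
      · have h1 := hN (p + 1 - k) (by omega)
        have : h' = h + (p + 1 - k : ℤ) := by push_cast; linear_combination he
        rw [← this] at h1
        rw [h1, Submodule.mem_bot] at hu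
        simp [hu]
      · exact hf _ he _ (S₁.mode_mem ha p hu)
    · rintro x y ⟨p, hp⟩ ⟨q, hq⟩
      refine ⟨min p q, fun r hr u => ?_⟩
      rw [map_add, Pi.add_apply, LinearMap.add_apply, map_add,
        hp r (hr.trans_le (min_le_left _ _)), hq r (hr.trans_le (min_le_right _ _)), add_zero]
  · rintro x y ⟨p, hp⟩ ⟨q, hq⟩
    refine ⟨min p q, fun r hr u => ?_⟩
    rw [LinearMap.add_apply, hp r (hr.trans_le (min_le_left _ _)),
      hq r (hr.trans_le (min_le_right _ _)), add_zero]

theorem WeakModule.IsWeightGraded.inGradedDual_comp_mode (hS : S₁.IsWeightGraded)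
    {f : Module.Dual ℂ W₁} (hf : S₁.InGradedDual f) (a : V) (n : ℤ) :
    S₁.InGradedDual (f ∘ₗ S₁.Y a n) := by
  refine hS.inGradedDual_induction (P := fun f => S₁.InGradedDual (f ∘ₗ S₁.Y a n)) hf
    (fun h f hf => ?_) ?_ fun f g hf hg => ?_
  · refine VertexOperatorAlgebra.induction (P := fun a => S₁.InGradedDual (f ∘ₗ S₁.Y a n)) a
      (fun k a ha => ?_) ?_ fun x y hx hy => ?_
    · refine WeakModule.IsHomogeneousFunctional.inGradedDual ⟨h - k + n + 1, fun h' hne u hu => ?_⟩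
      refine hf _ (fun he => hne ?_) _ (S₁.mode_mem ha n hu)
      linear_combination he
    · simpa using WeakModule.InGradedDual.zero
    · rw [map_add, Pi.add_apply, LinearMap.comp_add]
      exact hx.add hy
  · rw [LinearMap.zero_comp]; exact WeakModule.InGradedDual.zero
  · rw [LinearMap.add_comp]; exact hf.add hg

theorem IsHomogeneousOfWeight.circRight {h : ℂ} {Φ : ℂ → (W₁ →ₗ[ℂ] W₂)}
    (hΦ : IsHomogeneousOfWeight S₁ S₂ h Φ) {k : ℤ} {a : V}
    (ha : a ∈ VertexOperatorAlgebra.grade k) (m : ℤ) :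
    IsHomogeneousOfWeight S₁ S₂ (h + k - m - 1) (_root_.circRight S₁ S₂ a m Φ) := by
  intro n h₁ w hw
  rw [circRight_apply]
  refine Submodule.sub_mem _ ?_ ?_
  · convert S₂.mode_mem ha m (hΦ n h₁ w hw) using 2
    ring
  · rw [resRight, iterSum]
    refine finsum_induction (· ∈ S₂.genWeightSpace _) (Submodule.zero_mem _)
      (fun _ _ => Submodule.add_mem _) fun i => ?_
    refine zsmul_mem ?_ _
    convert hΦ (n + m - i) _ _ (S₁.mode_mem ha (0 + i) hw) using 2
    push_cast
    ring

theorem genRightHomogeneous_circRight_mem {a : V} {m : ℤ} {Φ : ℂ → (W₁ →ₗ[ℂ] W₂)}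
    (hΦ : Φ ∈ genRightHomogeneous S₁ S₂) :
    circRight S₁ S₂ a m Φ ∈ genRightHomogeneous S₁ S₂ := by
  induction hΦ using Submodule.span_induction with
  | mem Φ hΦ =>
    obtain ⟨hg, h, hh⟩ := hΦ
    refine VertexOperatorAlgebra.induction
      (P := fun a => circRight S₁ S₂ a m Φ ∈ genRightHomogeneous S₁ S₂) a (fun k a ha => ?_) ?_
      fun x y hx hy => ?_
    · exact Submodule.subset_span ⟨hg.circRight a m, _, hh.circRight ha m⟩
    · rw [circRight_zero_vec]; exact Submodule.zero_mem _
    · rw [circRight_add_vec]; exact Submodule.add_mem _ hx hy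
  | zero => rw [circRight_zero_op]; exact Submodule.zero_mem _
  | add x y _ _ hx hy => rw [circRight_add_op]; exact Submodule.add_mem _ hx hy
  | smul c x _ hx => rw [circRight_smul_op]; exact Submodule.smul_mem _ _ hx

end

end

/-! ### Existence, uniqueness and truncation of `φ`. -/

noncomputable section

variable {V : Type v} [AddCommGroup V] [Module ℂ V] [VertexOperatorAlgebra V]
  {W₁ W₂ W₃ W₄ W₅ : Type u} [AddCommGroup W₁] [Module ℂ W₁] [AddCommGroup W₂] [Module ℂ W₂]
  [AddCommGroup W₃] [Module ℂ W₃] [AddCommGroup W₄] [Module ℂ W₄] [AddCommGroup W₅] [Module ℂ W₅]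
  {S₁ : WeakModule V W₁} {S₂ : WeakModule V W₂} {S₃ : WeakModule V W₃} {S₄ : WeakModule V W₄}
  {S₅ : WeakModule V W₅} (F : IntertwiningOperator S₁ S₂ S₅) (G : IntertwiningOperator S₅ S₃ S₄)

/-- The coefficients `y m n ∈ W₄` expand the iterate at the given vectors. -/
def IteratesTo (w₁ : W₁) (w₂ : W₂) (w₃ : W₃) (y : ℂ → ℂ → W₄) : Prop :=
  ∀ f : Module.Dual ℂ W₄, S₄.InGradedDual f →
    IsIterateExpansion (iterateCoeff F G w₁ w₂ w₃ f) (fun m n => f (y m n))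

theorem IsIterateExpansion.unique {c d d' : ℂ → ℂ → ℂ} (h : IsIterateExpansion c d)
    (h' : IsIterateExpansion c d') : d = d' :=
  (isIterateExpansion_iff.1 h).2.unique (isIterateExpansion_iff.1 h').2

variable {F G}

theorem IteratesTo.unique (h₄ : S₄.IsWeightGraded) {w₁ : W₁} {w₂ : W₂} {w₃ : W₃}
    {y y' : ℂ → ℂ → W₄} (h : IteratesTo F G w₁ w₂ w₃ y) (h' : IteratesTo F G w₁ w₂ w₃ y') :
    y = y' := by
  funext m n
  exact h₄.ext fun f hf => congrFun (congrFun ((h f hf).unique (h' f hf)) m) n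

theorem IteratesTo.zero_fst {w₂ : W₂} {w₃ : W₃} :
    IteratesTo F G 0 w₂ w₃ fun _ _ => 0 := fun f _ => by
  convert IsIterateExpansion.zero using 3 <;> simp [iterateCoeff]

theorem IteratesTo.zero_snd {w₁ : W₁} {w₃ : W₃} :
    IteratesTo F G w₁ 0 w₃ fun _ _ => 0 := fun f _ => by
  convert IsIterateExpansion.zero using 3 <;> simp [iterateCoeff]

theorem IteratesTo.zero_thd {w₁ : W₁} {w₂ : W₂} :
    IteratesTo F G w₁ w₂ 0 fun _ _ => 0 := fun f _ => by
  convert IsIterateExpansion.zero using 3 <;> simp [iterateCoeff]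

theorem IteratesTo.add_fst {w₁ w₁' : W₁} {w₂ : W₂} {w₃ : W₃} {y y' : ℂ → ℂ → W₄}
    (h : IteratesTo F G w₁ w₂ w₃ y) (h' : IteratesTo F G w₁' w₂ w₃ y') :
    IteratesTo F G (w₁ + w₁') w₂ w₃ fun m n => y m n + y' m n := fun f hf => by
  convert (h f hf).add (h' f hf) using 3 <;> simp [iterateCoeff]

theorem IteratesTo.add_snd {w₁ : W₁} {w₂ w₂' : W₂} {w₃ : W₃} {y y' : ℂ → ℂ → W₄}
    (h : IteratesTo F G w₁ w₂ w₃ y) (h' : IteratesTo F G w₁ w₂' w₃ y') :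
    IteratesTo F G w₁ (w₂ + w₂') w₃ fun m n => y m n + y' m n := fun f hf => by
  convert (h f hf).add (h' f hf) using 3 <;> simp [iterateCoeff]

theorem IteratesTo.add_thd {w₁ : W₁} {w₂ : W₂} {w₃ w₃' : W₃} {y y' : ℂ → ℂ → W₄}
    (h : IteratesTo F G w₁ w₂ w₃ y) (h' : IteratesTo F G w₁ w₂ w₃' y') :
    IteratesTo F G w₁ w₂ (w₃ + w₃') fun m n => y m n + y' m n := fun f hf => by
  convert (h f hf).add (h' f hf) using 3 <;> simp [iterateCoeff]

theorem IteratesTo.smul_fst {w₁ : W₁} {w₂ : W₂} {w₃ : W₃} {y : ℂ → ℂ → W₄} (t : ℂ)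
    (h : IteratesTo F G w₁ w₂ w₃ y) :
    IteratesTo F G (t • w₁) w₂ w₃ fun m n => t • y m n := fun f hf => by
  convert (h f hf).smul t using 3 <;> simp [iterateCoeff]

theorem IteratesTo.smul_snd {w₁ : W₁} {w₂ : W₂} {w₃ : W₃} {y : ℂ → ℂ → W₄} (t : ℂ)
    (h : IteratesTo F G w₁ w₂ w₃ y) :
    IteratesTo F G w₁ (t • w₂) w₃ fun m n => t • y m n := fun f hf => by
  convert (h f hf).smul t using 3 <;> simp [iterateCoeff]

theorem IteratesTo.smul_thd {w₁ : W₁} {w₂ : W₂} {w₃ : W₃} {y : ℂ → ℂ → W₄} (t : ℂ)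
    (h : IteratesTo F G w₁ w₂ w₃ y) :
    IteratesTo F G w₁ w₂ (t • w₃) fun m n => t • y m n := fun f hf => by
  convert (h f hf).smul t using 3 <;> simp [iterateCoeff]

/-- It suffices to test homogeneous functionals. -/
theorem IteratesTo.of_homogeneous (h₄ : S₄.IsWeightGraded) {w₁ : W₁} {w₂ : W₂} {w₃ : W₃}
    {y : ℂ → ℂ → W₄}
    (h : ∀ (k : ℂ) (f : Module.Dual ℂ W₄), (∀ h' ≠ k, ∀ w ∈ S₄.genWeightSpace h', f w = 0) →
      IsIterateExpansion (iterateCoeff F G w₁ w₂ w₃ f) (fun m n => f (y m n))) :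
    IteratesTo F G w₁ w₂ w₃ y := by
  intro f hf
  refine h₄.inGradedDual_induction
    (P := fun f => IsIterateExpansion (iterateCoeff F G w₁ w₂ w₃ f) (fun m n => f (y m n))) hf
    h IsIterateExpansion.zero fun f g hf hg => ?_
  exact hf.add hg

theorem iterate_mem {h₁ h₂ h₃ : ℂ} {w₁ : W₁} {w₂ : W₂} {w₃ : W₃} (hw₁ : w₁ ∈ S₁.genWeightSpace h₁)
    (hw₂ : w₂ ∈ S₂.genWeightSpace h₂) (hw₃ : w₃ ∈ S₃.genWeightSpace h₃) (n m : ℂ) :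
    G.mode (F.mode w₁ n w₂) m w₃ ∈ S₄.genWeightSpace (h₁ + h₂ + h₃ - 2 - (n + m)) := by
  convert G.mode_mem (F.mode_mem hw₁ hw₂ n) hw₃ m using 2
  ring

/-- Convergence against all homogeneous functionals makes the homogeneous parts of the iterate finite
dimensional. -/
theorem finiteDimensional_span_iterate (h₄ : S₄.IsWeightGraded) {h₁ h₂ h₃ : ℂ} {w₁ : W₁} {w₂ : W₂}
    {w₃ : W₃} (hw₁ : w₁ ∈ S₁.genWeightSpace h₁) (hw₂ : w₂ ∈ S₂.genWeightSpace h₂)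
    (hw₃ : w₃ ∈ S₃.genWeightSpace h₃)
    (hsum : ∀ f, S₄.IsHomogeneousFunctional f → IterateSummable (iterateCoeff F G w₁ w₂ w₃ f))
    (σ : ℂ) : FiniteDimensional ℂ (Submodule.span ℂ
      {x | ∃ n m, n + m = σ ∧ x = G.mode (F.mode w₁ n w₂) m w₃}) := by
  set X := {x | ∃ n m, n + m = σ ∧ x = G.mode (F.mode w₁ n w₂) m w₃} with hX
  obtain ⟨b, hbX, hspan, hli⟩ := exists_linearIndependent ℂ X
  have hli : LinearIndepOn ℂ id b := hli
  rw [← hspan]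
  suffices hfin : b.Finite from FiniteDimensional.span_of_finite ℂ hfin
  by_contra hinf
  have hbX' : ∀ x ∈ b, ∃ n m, n + m = σ ∧ x = G.mode (F.mode w₁ n w₂) m w₃ := fun x hx => hbX hx
  choose! N M hNM hxNM using hbX'
  obtain ⟨π, hπ1, hπ2, hπ3, -⟩ := h₄.exists_proj
  set B := Module.Basis.extend hli
  set lam := h₁ + h₂ + h₃ - 2 - σ
  -- Linear independence permits prescribing the values freely. They are chosen to cancel the factor
  -- `z₂^{-M-1}` at `z₂ = 2`, while `z₁ - z₂ = 1` contributes nothing.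
  obtain ⟨f₀, hf₀⟩ : ∃ f₀ : Module.Dual ℂ W₄, ∀ x ∈ b, f₀ x = ((2 : ℂ) ^ (-M x - 1))⁻¹ := by
    refine ⟨B.constr ℂ fun x => ((2 : ℂ) ^ (-M x - 1))⁻¹, fun x hx => ?_⟩
    have hx' : x ∈ LinearIndepOn.extend hli (Set.subset_univ b) :=
      LinearIndepOn.subset_extend hli _ hx
    have := B.constr_basis ℂ (fun x => ((2 : ℂ) ^ (-M x - 1))⁻¹) ⟨x, hx'⟩
    rwa [Module.Basis.extend_apply_self] at this
  have hmem : ∀ x ∈ b, x ∈ S₄.genWeightSpace lam := by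
    intro x hx
    have := iterate_mem (F := F) (G := G) hw₁ hw₂ hw₃ (N x) (M x)
    rw [hNM x hx, ← hxNM x hx] at this
    exact this
  have hhom : S₄.IsHomogeneousFunctional (f₀ ∘ₗ π lam) :=
    ⟨lam, fun h' hne w hw => by rw [LinearMap.comp_apply, hπ3 h' lam hne w hw, map_zero]⟩
  -- An infinite independent family would give infinitely many terms equal to `1` at this point,
  -- contradicting summability.
  have hs := hsum _ hhom 3 2 (by norm_num) (by norm_num)
  have hone : ∀ x ∈ b, iterateTerm (iterateCoeff F G w₁ w₂ w₃ (f₀ ∘ₗ π lam)) 3 2 (N x, M x) = 1 := by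
    intro x hx
    simp only [iterateTerm, iterateCoeff, LinearMap.comp_apply]
    rw [← hxNM x hx, hπ2 lam x (hmem x hx), hf₀ x hx, show (3 - 2 : ℂ) = 1 by norm_num,
      Complex.one_cpow, mul_one, inv_mul_cancel₀]
    rw [Ne, Complex.cpow_eq_zero_iff]
    simp
  have hev := hs.tendsto_cofinite_zero.eventually_ne (show (0 : ℂ) ≠ 1 by norm_num)
  rw [Filter.eventually_cofinite] at hev
  have hinj : Set.InjOn (fun x => (N x, M x)) b := by
    intro x hx y hy hxy
    simp only [Prod.mk.injEq] at hxy
    rw [hxNM x hx, hxNM y hy, hxy.1, hxy.2]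
  refine hinf (Set.Finite.of_finite_image (hev.subset ?_) hinj)
  rintro _ ⟨x, hx, rfl⟩
  simpa using hone x hx

/-- Scalar expansions for the separate functionals need not come from a vector a priori. The part of
the iterate with `n + m = σ` spans a finite dimensional space `X σ`, so the expansions against a
dual basis of `X σ` assemble into vectors. -/
theorem IterateConvergenceExtension.exists_homogeneous (hconv : IterateConvergenceExtension F G)
    (h₄ : S₄.IsWeightGraded) {h₁ h₂ h₃ : ℂ} {w₁ : W₁} {w₂ : W₂} {w₃ : W₃}
    (hw₁ : w₁ ∈ S₁.genWeightSpace h₁) (hw₂ : w₂ ∈ S₂.genWeightSpace h₂)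
    (hw₃ : w₃ ∈ S₃.genWeightSpace h₃) : ∃ y, IteratesTo F G w₁ w₂ w₃ y := by
  obtain ⟨N, hN⟩ := hconv
  have hexp : ∀ f, S₄.IsHomogeneousFunctional f →
      ∃ d, IsIterateExpansion (iterateCoeff F G w₁ w₂ w₃ f) d := by
    intro f hf
    obtain ⟨g, -, hg⟩ := hN h₁ h₂ h₃ w₁ hw₁ w₂ hw₂ w₃ hw₃ f hf
    exact ⟨g.coeff, g, hg, fun _ _ => rfl⟩
  choose! d hd using hexp
  obtain ⟨π, hπ1, hπ2, hπ3, -⟩ := h₄.exists_proj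
  have hfd := finiteDimensional_span_iterate h₄ hw₁ hw₂ hw₃
    fun f hf => (isIterateExpansion_iff.1 (hd f hf)).1
  set X : ℂ → Submodule ℂ W₄ := fun σ => Submodule.span ℂ
      {x | ∃ n m, n + m = σ ∧ x = G.mode (F.mode w₁ n w₂) m w₃} with hX
  set lam : ℂ → ℂ := fun σ => h₁ + h₂ + h₃ - 2 - σ with hlam
  have hXle : ∀ σ, X σ ≤ S₄.genWeightSpace (lam σ) := by
    intro σ
    refine Submodule.span_le.2 ?_
    rintro _ ⟨n, m, rfl, rfl⟩
    exact iterate_mem hw₁ hw₂ hw₃ n m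
  set e : ∀ σ, Module.Basis (Fin (Module.finrank ℂ (X σ))) ℂ (X σ) := fun σ =>
    Module.finBasis ℂ (X σ)
  have hext : ∀ σ i, ∃ f : Module.Dual ℂ W₄, f ∘ₗ (X σ).subtype = (e σ).coord i := fun σ i =>
    LinearMap.exists_extend _
  choose ε₀ hε₀ using hext
  set ε : ∀ σ, Fin (Module.finrank ℂ (X σ)) → Module.Dual ℂ W₄ := fun σ i => ε₀ σ i ∘ₗ π (lam σ)
  have hεhom : ∀ σ i, S₄.IsHomogeneousFunctional (ε σ i) := fun σ i =>
    ⟨lam σ, fun h' hne w hw => by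
      show ε₀ σ i (π (lam σ) w) = 0
      rw [hπ3 h' _ hne w hw, map_zero]⟩
  have hεX : ∀ σ i, ∀ x : X σ, ε σ i x = (e σ).coord i x := by
    intro σ i x
    show ε₀ σ i (π (lam σ) x) = _
    rw [hπ2 _ _ (hXle σ x.2), ← hε₀ σ i]
    rfl
  -- Homogeneity of the iterate is inherited by its expansion, so the coefficient at `(m, n)`
  -- belongs to `X (m + n)`.
  set y : ℂ → ℂ → W₄ := fun m n => ∑ i, d (ε (m + n) i) m n • (e (m + n) i : W₄) with hy
  have hymem : ∀ m n, y m n ∈ S₄.genWeightSpace (lam (m + n)) := fun m n =>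
    Submodule.sum_mem _ fun i _ => Submodule.smul_mem _ _ (hXle _ (e (m + n) i).2)
  refine ⟨y, IteratesTo.of_homogeneous h₄ fun k f hf => ?_⟩
  obtain ⟨σ, hσ⟩ : ∃ σ, σ = h₁ + h₂ + h₃ - 2 - k := ⟨_, rfl⟩
  have hk : lam σ = k := by simp only [hlam, hσ]; ring
  -- On `X σ` the functional `f` is the combination of the dual basis with coefficients `f (e_i)`;
  -- off the degree `σ` both sides vanish for weight reasons.
  have hc : iterateCoeff F G w₁ w₂ w₃ f
      = fun n m => ∑ i, f (e σ i) * iterateCoeff F G w₁ w₂ w₃ (ε σ i) n m := by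
    funext n m
    simp only [iterateCoeff]
    by_cases hnm : n + m = σ
    · have hx : G.mode (F.mode w₁ n w₂) m w₃ ∈ X σ := Submodule.subset_span ⟨n, m, hnm, rfl⟩
      have h1 := (e σ).sum_repr ⟨_, hx⟩
      have h2 := congrArg (fun z : X σ => f z) h1
      simp only [AddSubmonoidClass.coe_finsetSum, Submodule.coe_smul, map_sum, map_smul,
        smul_eq_mul] at h2
      rw [← h2]
      refine Finset.sum_congr rfl fun i _ => ?_
      rw [hεX σ i ⟨_, hx⟩, mul_comm]
      rfl
    · have hm := iterate_mem (F := F) (G := G) hw₁ hw₂ hw₃ n m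
      have hne : h₁ + h₂ + h₃ - 2 - (n + m) ≠ k := fun h0 => hnm (by rw [hσ, ← h0]; ring)
      rw [hf _ hne _ hm]
      symm
      refine Finset.sum_eq_zero fun i _ => ?_
      show _ * ε₀ σ i (π (lam σ) _) = 0
      rw [hk, hπ3 _ _ hne _ hm, map_zero, mul_zero]
  have hE := IsIterateExpansion.sum Finset.univ fun i _ => (hd (ε σ i) (hεhom σ i)).smul (f (e σ i))
  rw [← hc] at hE
  convert hE using 1
  funext m n
  by_cases hmn : m + n = σ
  · subst hmn
    rw [hy]
    simp only [map_sum, map_smul, smul_eq_mul]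
    exact Finset.sum_congr rfl fun i _ => mul_comm _ _
  · rw [(isIterateExpansion_iff.1 hE).2.homogeneous (σ := σ) (fun n m hnm => ?_) hmn]
    · refine hf _ (fun h0 => hmn ?_) _ (hymem m n)
      rw [hσ, ← h0]; simp only [hlam]; ring
    · refine hf _ (fun h0 => hnm ?_) _ (iterate_mem hw₁ hw₂ hw₃ n m)
      rw [hσ, ← h0]; ring

theorem IterateConvergenceExtension.exists_iteratesTo (hconv : IterateConvergenceExtension F G)
    (h₁ : S₁.IsWeightGraded) (h₂ : S₂.IsWeightGraded) (h₃ : S₃.IsWeightGraded)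
    (h₄ : S₄.IsWeightGraded) (w₁ : W₁) (w₂ : W₂) (w₃ : W₃) : ∃ y, IteratesTo F G w₁ w₂ w₃ y := by
  refine h₁.induction (P := fun w₁ => ∃ y, IteratesTo F G w₁ w₂ w₃ y) w₁ (fun k₁ w₁ hw₁ => ?_)
    ⟨_, IteratesTo.zero_fst⟩ fun _ _ hx hy => ⟨_, hx.choose_spec.add_fst hy.choose_spec⟩
  refine h₂.induction (P := fun w₂ => ∃ y, IteratesTo F G w₁ w₂ w₃ y) w₂ (fun k₂ w₂ hw₂ => ?_)
    ⟨_, IteratesTo.zero_snd⟩ fun _ _ hx hy => ⟨_, hx.choose_spec.add_snd hy.choose_spec⟩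
  refine h₃.induction (P := fun w₃ => ∃ y, IteratesTo F G w₁ w₂ w₃ y) w₃ (fun k₃ w₃ hw₃ => ?_)
    ⟨_, IteratesTo.zero_thd⟩ fun _ _ hx hy => ⟨_, hx.choose_spec.add_thd hy.choose_spec⟩
  exact hconv.exists_homogeneous h₄ hw₁ hw₂ hw₃

/-- Linearity in `w₁` is not built into the pointwise choice; it follows from uniqueness of
expansions. -/
theorem IterateConvergenceExtension.existsUnique (hconv : IterateConvergenceExtension F G)
    (h₁ : S₁.IsWeightGraded) (h₂ : S₂.IsWeightGraded) (h₃ : S₃.IsWeightGraded)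
    (h₄ : S₄.IsWeightGraded) :
    ∃! φ : W₂ → W₃ → ℂ → ℂ → (W₁ →ₗ[ℂ] W₄), IsIterateExtension F G φ := by
  choose y hy using hconv.exists_iteratesTo h₁ h₂ h₃ h₄
  refine ⟨fun w₂ w₃ n m => ⟨⟨fun w₁ => y w₁ w₂ w₃ m n, fun w w' => ?_⟩, fun t w => ?_⟩,
    fun w₁ w₂ w₃ f hf => hy w₁ w₂ w₃ f hf, fun φ hφ => ?_⟩
  · exact congrFun (congrFun ((hy _ w₂ w₃).unique h₄ ((hy w w₂ w₃).add_fst (hy w' w₂ w₃))) m) n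
  · exact congrFun (congrFun ((hy _ w₂ w₃).unique h₄ ((hy w w₂ w₃).smul_fst t)) m) n
  · funext w₂ w₃ n m
    ext w₁
    have h : IteratesTo F G w₁ w₂ w₃ fun m n => φ w₂ w₃ n m w₁ := fun f hf => hφ w₁ w₂ w₃ f hf
    exact congrFun (congrFun (h.unique h₄ (hy w₁ w₂ w₃)) m) n

section extension

variable {φ : W₂ → W₃ → ℂ → ℂ → (W₁ →ₗ[ℂ] W₄)}

theorem IsIterateExtension.iteratesTo (hφ : IsIterateExtension F G φ) (w₁ : W₁) (w₂ : W₂)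
    (w₃ : W₃) : IteratesTo F G w₁ w₂ w₃ fun m n => φ w₂ w₃ n m w₁ :=
  fun f hf => hφ w₁ w₂ w₃ f hf

theorem IsIterateExtension.hasExpansion (hφ : IsIterateExtension F G φ) (w₁ : W₁) (w₂ : W₂)
    (w₃ : W₃) {f : Module.Dual ℂ W₄} (hf : S₄.InGradedDual f) :
    HasExpansion (fun n m => f (G.mode (F.mode w₁ n w₂) m w₃)) fun m n => f (φ w₂ w₃ n m w₁) :=
  (isIterateExpansion_iff.1 (hφ w₁ w₂ w₃ f hf)).2

theorem IsIterateExtension.eq_of_iteratesTo (hφ : IsIterateExtension F G φ)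
    (h₄ : S₄.IsWeightGraded) {w₁ : W₁} {w₂ : W₂} {w₃ : W₃} {y : ℂ → ℂ → W₄}
    (h : IteratesTo F G w₁ w₂ w₃ y) (n m : ℂ) : φ w₂ w₃ n m w₁ = y m n :=
  congrFun (congrFun ((hφ.iteratesTo w₁ w₂ w₃).unique h₄ h) m) n

theorem IsIterateExtension.add_snd (hφ : IsIterateExtension F G φ) (h₄ : S₄.IsWeightGraded)
    (w₂ w₂' : W₂) (w₃ : W₃) : φ (w₂ + w₂') w₃ = φ w₂ w₃ + φ w₂' w₃ := by
  funext n m; ext w₁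
  exact hφ.eq_of_iteratesTo h₄ ((hφ.iteratesTo w₁ w₂ w₃).add_snd (hφ.iteratesTo w₁ w₂' w₃)) n m

theorem IsIterateExtension.smul_snd (hφ : IsIterateExtension F G φ) (h₄ : S₄.IsWeightGraded)
    (t : ℂ) (w₂ : W₂) (w₃ : W₃) : φ (t • w₂) w₃ = t • φ w₂ w₃ := by
  funext n m; ext w₁
  exact hφ.eq_of_iteratesTo h₄ ((hφ.iteratesTo w₁ w₂ w₃).smul_snd t) n m

theorem IsIterateExtension.zero_snd (hφ : IsIterateExtension F G φ) (h₄ : S₄.IsWeightGraded)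
    (w₃ : W₃) : φ 0 w₃ = 0 := by
  funext n m; ext w₁
  exact hφ.eq_of_iteratesTo h₄ IteratesTo.zero_snd n m

theorem IsIterateExtension.add_thd (hφ : IsIterateExtension F G φ) (h₄ : S₄.IsWeightGraded)
    (w₂ : W₂) (w₃ w₃' : W₃) : φ w₂ (w₃ + w₃') = φ w₂ w₃ + φ w₂ w₃' := by
  funext n m; ext w₁
  exact hφ.eq_of_iteratesTo h₄ ((hφ.iteratesTo w₁ w₂ w₃).add_thd (hφ.iteratesTo w₁ w₂ w₃')) n m

theorem IsIterateExtension.smul_thd (hφ : IsIterateExtension F G φ) (h₄ : S₄.IsWeightGraded)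
    (t : ℂ) (w₂ : W₂) (w₃ : W₃) : φ w₂ (t • w₃) = t • φ w₂ w₃ := by
  funext n m; ext w₁
  exact hφ.eq_of_iteratesTo h₄ ((hφ.iteratesTo w₁ w₂ w₃).smul_thd t) n m

theorem IsIterateExtension.zero_thd (hφ : IsIterateExtension F G φ) (h₄ : S₄.IsWeightGraded)
    (w₂ : W₂) : φ w₂ 0 = 0 := by
  funext n m; ext w₁
  exact hφ.eq_of_iteratesTo h₄ IteratesTo.zero_thd n m

/-- `φ_n(w₂,w₃,z₁) = 0` when `Re n` is large. -/
theorem IsIterateExtension.exists_bound (hφ : IsIterateExtension F G φ)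
    (hconv : IterateConvergenceExtension F G) (h₁ : S₁.IsWeightGraded)
    (h₂ : S₂.IsWeightGraded) (h₃ : S₃.IsWeightGraded) (h₄ : S₄.IsWeightGraded) (w₂ : W₂)
    (w₃ : W₃) : ∃ h : ℝ, ∀ n : ℂ, h < n.re → φ w₂ w₃ n = 0 := by
  obtain ⟨N, hN⟩ := hconv
  refine h₂.induction (P := fun w₂ => ∃ h : ℝ, ∀ n : ℂ, h < n.re → φ w₂ w₃ n = 0) w₂
    (fun k₂ w₂ hw₂ => ?_) ⟨0, fun n _ => by rw [hφ.zero_snd h₄]; rfl⟩ ?_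
  · refine h₃.induction (P := fun w₃ => ∃ h : ℝ, ∀ n : ℂ, h < n.re → φ w₂ w₃ n = 0) w₃
      (fun k₃ w₃ hw₃ => ?_) ⟨0, fun n _ => by rw [hφ.zero_thd h₄]; rfl⟩ ?_
    -- A nonzero coefficient has `-n - 1 = s_i + j` with `j ≥ 0` and `Re s_i > N - Re (k₂ + k₃)`.
    -- This bounds `Re n` by a constant free of `w₁` and of the functional.
    · refine ⟨(k₂ + k₃).re - N, fun n hn => ?_⟩
      funext m
      refine h₁.linearMap_ext fun k₁ w₁ hw₁ => ?_
      rw [Pi.zero_apply, LinearMap.zero_apply]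
      refine h₄.eq_zero_of_forall fun f hf => ?_
      obtain ⟨g, hs, hg⟩ := hN k₁ k₂ k₃ w₁ hw₁ w₂ hw₂ w₃ hw₃ f hf
      have hu := (hφ w₁ w₂ w₃ f (WeakModule.IsHomogeneousFunctional.inGradedDual hf)).unique
        ⟨g, hg, fun _ _ => rfl⟩
      rw [congrFun (congrFun hu m) n, MultivaluedSum.coeff_eq]
      refine Finset.sum_eq_zero fun i _ => termCoeff_of_ne fun j _ hj => ?_
      have h1 := hs i
      have h2 := congrArg Complex.re hj
      simp only [Complex.add_re, Complex.sub_re, Complex.neg_re, Complex.one_re,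
        Complex.natCast_re] at h1 h2 hn
      have : (0 : ℝ) ≤ j := j.cast_nonneg
      linarith
    · rintro x y ⟨a, ha⟩ ⟨b, hb⟩
      refine ⟨max a b, fun n hn => ?_⟩
      rw [hφ.add_thd h₄, Pi.add_apply, ha n ((le_max_left _ _).trans_lt hn),
        hb n ((le_max_right _ _).trans_lt hn), add_zero]
  · rintro x y ⟨a, ha⟩ ⟨b, hb⟩
    refine ⟨max a b, fun n hn => ?_⟩
    rw [hφ.add_snd h₄, Pi.add_apply, ha n ((le_max_left _ _).trans_lt hn),
      hb n ((le_max_right _ _).trans_lt hn), add_zero]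

theorem WeakModule.IsWeightGraded.mem_of_forall (h₄ : S₄.IsWeightGraded) {k : ℂ} {x : W₄}
    (h : ∀ k' ≠ k, ∀ f : Module.Dual ℂ W₄, (∀ h' ≠ k', ∀ w ∈ S₄.genWeightSpace h', f w = 0) →
      f x = 0) : x ∈ S₄.genWeightSpace k := by
  obtain ⟨π, hπ1, hπ2, hπ3, -⟩ := h₄.exists_proj
  have : x = π k x := by
    rw [← sub_eq_zero]
    refine h₄.eq_zero_of_forall fun f hf => ?_
    obtain ⟨k', hf⟩ := hf
    rw [map_sub]
    by_cases hk : k' = k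
    · subst hk
      have e : f = f ∘ₗ π k' := h₄.linearMap_ext fun h w hw => by
        rw [LinearMap.comp_apply]
        by_cases hh : h = k'
        · rw [hπ2 k' w (hh ▸ hw)]
        · rw [hπ3 h k' hh w hw, hf h hh w hw, map_zero]
      conv_lhs => rw [e]
      simp only [LinearMap.comp_apply]
      rw [hπ2 k' _ (hπ1 k' x), sub_self]
    · rw [h k' hk f hf, hf k (Ne.symm hk) _ (hπ1 k x), sub_zero]
  rw [this]
  exact hπ1 k x

theorem IsIterateExtension.mem (hφ : IsIterateExtension F G φ) (h₄ : S₄.IsWeightGraded)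
    {k₁ k₂ k₃ : ℂ} {w₁ : W₁} {w₂ : W₂} {w₃ : W₃} (hw₁ : w₁ ∈ S₁.genWeightSpace k₁)
    (hw₂ : w₂ ∈ S₂.genWeightSpace k₂) (hw₃ : w₃ ∈ S₃.genWeightSpace k₃) (n m : ℂ) :
    φ w₂ w₃ n m w₁ ∈ S₄.genWeightSpace (k₁ + k₂ + k₃ - 2 - (m + n)) := by
  refine h₄.mem_of_forall fun k hk f hf => ?_
  have := hφ.hasExpansion w₁ w₂ w₃ (WeakModule.IsHomogeneousFunctional.inGradedDual ⟨k, hf⟩)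
  refine this.homogeneous (σ := k₁ + k₂ + k₃ - 2 - k) (fun n m hnm => ?_) fun h0 => hk ?_
  · refine hf _ (fun h0 => hnm ?_) _ (iterate_mem hw₁ hw₂ hw₃ n m)
    rw [← h0]; ring
  · rw [h0]; ring

theorem IsIterateExtension.truncation (hφ : IsIterateExtension F G φ) (h₁ : S₁.IsWeightGraded)
    (h₂ : S₂.IsWeightGraded) (h₃ : S₃.IsWeightGraded) (h₄ : S₄.IsWeightGraded) (w₂ : W₂)
    (w₃ : W₃) (n α : ℂ) (w₁ : W₁) : ∃ N : ℤ, ∀ j : ℤ, j ≥ N → φ w₂ w₃ n (α + j) w₁ = 0 := by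
  refine h₁.induction (P := fun w₁ => ∃ N : ℤ, ∀ j : ℤ, j ≥ N → φ w₂ w₃ n (α + j) w₁ = 0) w₁
    (fun k₁ w₁ hw₁ => ?_) ⟨0, by simp⟩ ?_
  · refine h₂.induction (P := fun w₂ => ∃ N : ℤ, ∀ j : ℤ, j ≥ N → φ w₂ w₃ n (α + j) w₁ = 0) w₂
      (fun k₂ w₂ hw₂ => ?_) ⟨0, fun j _ => by rw [hφ.zero_snd h₄]; rfl⟩ ?_
    · refine h₃.induction (P := fun w₃ => ∃ N : ℤ, ∀ j : ℤ, j ≥ N → φ w₂ w₃ n (α + j) w₁ = 0) w₃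
        (fun k₃ w₃ hw₃ => ?_) ⟨0, fun j _ => by rw [hφ.zero_thd h₄]; rfl⟩ ?_
      · obtain ⟨N, hN⟩ := h₄.bounded (k₁ + k₂ + k₃ - 2 - (α + n))
        refine ⟨-N, fun j hj => ?_⟩
        have h := hφ.mem h₄ hw₁ hw₂ hw₃ n (α + j)
        have e : k₁ + k₂ + k₃ - 2 - (α + j + n) = k₁ + k₂ + k₃ - 2 - (α + n) + (-j : ℤ) := by
          push_cast; ring
        rwa [e, hN (-j) (by omega), Submodule.mem_bot] at h
      · rintro x y ⟨a, ha⟩ ⟨b, hb⟩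
        refine ⟨max a b, fun j hj => ?_⟩
        rw [hφ.add_thd h₄, Pi.add_apply, Pi.add_apply, LinearMap.add_apply,
          ha j (le_trans (le_max_left _ _) hj), hb j (le_trans (le_max_right _ _) hj), add_zero]
    · rintro x y ⟨a, ha⟩ ⟨b, hb⟩
      refine ⟨max a b, fun j hj => ?_⟩
      rw [hφ.add_snd h₄, Pi.add_apply, Pi.add_apply, LinearMap.add_apply,
        ha j (le_trans (le_max_left _ _) hj), hb j (le_trans (le_max_right _ _) hj), add_zero]
  · rintro x y ⟨a, ha⟩ ⟨b, hb⟩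
    refine ⟨max a b, fun j hj => ?_⟩
    rw [map_add, ha j (le_trans (le_max_left _ _) hj), hb j (le_trans (le_max_right _ _) hj),
      add_zero]

end extension

end

/-! ### Algebraic operations on both sides of an expansion. -/

noncomputable section

theorem HasExpansion.finsum {c d : ℕ → ℂ → ℂ → ℂ} (k : ℕ → ℤ) (h : ∀ i, HasExpansion (c i) (d i))
    (hK : ∃ K, ∀ i, K ≤ i → ∀ n m, c i n m = 0) :
    HasExpansion (fun n m => ∑ᶠ i, k i • c i n m) (fun m n => ∑ᶠ i, k i • d i m n) := by
  obtain ⟨K, hK⟩ := hK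
  have e1 : (fun n m => ∑ᶠ i, k i • c i n m)
      = fun n m => ∑ i ∈ Finset.range K, (k i : ℂ) * c i n m := by
    funext n m
    rw [finsum_eq_sum_range (K := K) fun i hi => by rw [hK i hi, smul_zero]]
    simp
  have e2 : (fun m n => ∑ᶠ i, k i • d i m n)
      = fun m n => ∑ i ∈ Finset.range K, (k i : ℂ) * d i m n := by
    funext m n
    rw [finsum_eq_sum_range (K := K) fun i hi => by rw [(h i).eq_zero (hK i hi), smul_zero]]
    simp
  rw [e1, e2]
  exact HasExpansion.sum _ fun i _ => (h i).smul _

theorem HasExpansion.congr {c c' d d' : ℂ → ℂ → ℂ} (h : HasExpansion c d)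
    (hc : ∀ n m, c' n m = c n m) (hd : ∀ m n, d' m n = d m n) : HasExpansion c' d' := by
  have e1 : c' = c := by funext n m; exact hc n m
  have e2 : d' = d := by funext n m; exact hd n m
  rw [e1, e2]; exact h

theorem HasExpansion.zero_of {c d : ℂ → ℂ → ℂ} (hc : ∀ n m, c n m = 0) (hd : ∀ m n, d m n = 0) :
    HasExpansion c d := HasExpansion.zero.congr hc hd

theorem outerSum_add_one {ι E : Type*} [Ring ι] [AddCommGroup E] (f : ℤ → ι → E) (l m : ℤ) (n : ι) :
    outerSum (fun p n => f (p + 1) n) l m n = outerSum f l (m + 1) n := outerSum_shift f 1 l m n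

theorem iterSum_add_one {ι E : Type*} [Ring ι] [AddCommGroup E] (f : ℤ → ι → E) (l m : ℤ) (n : ι) :
    iterSum (fun p n => f (p + 1) n) l m n = iterSum f (l + 1) m n := by
  simp only [iterSum, add_right_comm l _ (1 : ℤ)]

/-! ### Iterated sums -/

/-- The coefficients of `(z₃ - z₁)^q (z₃ - z₂)^l z₃^r ℓ`, expanded with `z₁ = z₀ + z₂`. -/
def outerOuterSum (ℓ : ℤ → ℂ → ℂ → ℂ) (q l r : ℤ) (n m : ℂ) : ℂ :=
  outerSum (fun l' n => outerSum (fun p m => ℓ p n m) l' r m) q l n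

/-- The corresponding coefficients on the side of the iterate. -/
def iterIterSum (A : ℤ → ℂ → ℂ → ℂ) (q l r : ℤ) (n m : ℂ) : ℂ :=
  iterSum (fun j m => iterSum (fun k n => A k n m) q j n) l r m

section

variable {ℓ : ℤ → ℂ → ℂ → ℂ} {p₀ : ℤ}

theorem finDown_outerSum (hℓ : ∀ p < p₀, ∀ n m, ℓ p n m = 0) (r : ℤ) (m : ℂ) :
    FinDown fun l' n => outerSum (fun p m => ℓ p n m) l' r m :=
  FinDown.of_bound (K := p₀ - r) fun p hp n => outerSum_eq_zero fun i => hℓ _ (by omega) _ _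

/-- The identity used is `z₃ - z₁ = (z₃ - z₂) - z₀`. -/
theorem outerOuterSum_succ_fst (hℓ : ∀ p < p₀, ∀ n m, ℓ p n m = 0) (q l r : ℤ) (n m : ℂ) :
    outerOuterSum ℓ (q + 1) l r n m
      = outerOuterSum ℓ q (l + 1) r n m - outerOuterSum ℓ q l r (n + 1) m :=
  outerSum_succ (finDown_outerSum hℓ r m) q l n

theorem outerOuterSum_succ_snd (hℓ : ∀ p < p₀, ∀ n m, ℓ p n m = 0) (q l r : ℤ) (n m : ℂ) :
    outerOuterSum ℓ q (l + 1) r n m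
      = outerOuterSum ℓ q l (r + 1) n m - outerOuterSum ℓ q l r n (m + 1) := by
  have hd : ∀ n, FinDown fun p m => ℓ p n m := fun n =>
    FinDown.of_bound (K := p₀) fun p hp m => hℓ p hp n m
  simp only [outerOuterSum]
  rw [← outerSum_add_one, ← outerSum_sub (finDown_outerSum hℓ _ _) (finDown_outerSum hℓ _ _)]
  simp only [outerSum_succ (hd _)]

theorem outerOuterSum_eq_zero (hℓ : ∀ p < p₀, ∀ n m, ℓ p n m = 0) {q l r : ℤ}
    (h : q + l + r < p₀) (n m : ℂ) : outerOuterSum ℓ q l r n m = 0 :=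
  outerSum_eq_zero fun i => outerSum_eq_zero fun j => hℓ _ (by omega) _ _

/-- Multiplication by `z₃ - z₁` is `z₃` minus `z₁`, and multiplication by `z₁` is compatible with
expansions. This settles `q ≥ 0`. -/
theorem HasExpansion.outerOuterSum {δ : ℤ → ℂ → ℂ → ℂ} (h : ∀ p, HasExpansion (ℓ p) (δ p))
    (hℓ : ∀ p < p₀, ∀ n m, ℓ p n m = 0) (q : ℤ) : ∀ r : ℤ,
    HasExpansion (outerOuterSum ℓ q 0 r) (fun μ n => outerSum (fun p μ => δ p μ n) q r μ) := by
  have hδ : ∀ p < p₀, ∀ μ n, δ p μ n = 0 := fun p hp => (h p).eq_zero (hℓ p hp)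
  have hd : ∀ n, FinDown fun p μ => δ p μ n := fun n =>
    FinDown.of_bound (K := p₀) fun p hp m => hδ p hp m n
  have hrec : ∀ q r n m, _root_.outerOuterSum ℓ (q + 1) 0 r n m
      = _root_.outerOuterSum ℓ q 0 (r + 1) n m
        - (_root_.outerOuterSum ℓ q 0 r (n + 1) m + _root_.outerOuterSum ℓ q 0 r n (m + 1)) := by
    intro q r n m
    rw [outerOuterSum_succ_fst hℓ, outerOuterSum_succ_snd hℓ]; ring
  induction q using Int.induction_on with
  | zero =>
    intro r
    refine (h r).congr (fun n m => ?_) fun μ n => ?_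
    · simp [_root_.outerOuterSum]
    · simp
  | succ q ih =>
    intro r
    refine ((ih (r + 1)).sub (ih r).shift_fst).congr (fun n m => hrec _ _ _ _) fun μ n => ?_
    rw [outerSum_succ (hd n)]
  | pred q ih =>
    -- For negative `q` the recurrence is solved upwards in `r`, starting where the lower truncation
    -- makes everything zero. This avoids expanding infinitely many powers of `z₁`.
    have key : ∀ t : ℕ, ∀ r : ℤ, r < p₀ + q + 1 + t →
        HasExpansion (_root_.outerOuterSum ℓ (-q - 1) 0 r)
          (fun μ n => outerSum (fun p μ => δ p μ n) (-q - 1) r μ) := by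
      intro t
      induction t with
      | zero =>
        intro r hr
        refine HasExpansion.zero_of (outerOuterSum_eq_zero hℓ (by push_cast at hr; omega)) fun μ n =>
          outerSum_eq_zero fun i => hδ _ (by push_cast at hr; omega) _ _
      | succ t iht =>
        intro r hr
        have h1 := (ih (r - 1)).add (iht (r - 1) (by push_cast at hr ⊢; omega)).shift_fst
        refine h1.congr (fun n m => ?_) fun μ n => ?_
        · have := hrec (-q - 1) (r - 1) n m
          rw [sub_add_cancel, sub_add_cancel] at this
          linear_combination -this
        · have := outerSum_succ (hd n) (-q - 1) (r - 1) μ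
          rw [sub_add_cancel, sub_add_cancel] at this
          linear_combination -this
    intro r
    exact key (r - p₀).toNat r (by omega)

variable {A : ℤ → ℂ → ℂ → ℂ} {K : ℤ}

theorem finUp_iterSum (hA : ∀ k ≥ K, ∀ n m, A k n m = 0)
    (hA' : ∀ (q : ℤ) n, ∃ N : ℤ, ∀ j ≥ N, ∀ k ≥ q, ∀ m, A k (n + j) m = 0) (q : ℤ) (n : ℂ) :
    FinUp fun j m => iterSum (fun k n => A k n m) q j n := by
  obtain ⟨N, hN⟩ := hA' q n
  refine FinUp.of_bound (K := N + (K - q).toNat) fun j hj m => iterSum_eq_zero fun i => ?_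
  by_cases hi : K ≤ q + i
  · exact hA _ hi _ _
  · have : n + (j : ℂ) - (i : ℂ) = n + ((j - i : ℤ) : ℂ) := by push_cast; ring
    rw [this]
    exact hN _ (by omega) _ (by omega) _

theorem finUp_of_bound (hA : ∀ k ≥ K, ∀ n m, A k n m = 0) (m : ℂ) : FinUp fun k n => A k n m :=
  FinUp.of_bound fun k hk n => hA k hk n m

theorem iterIterSum_succ_snd (hA : ∀ k ≥ K, ∀ n m, A k n m = 0)
    (hA' : ∀ (q : ℤ) n, ∃ N : ℤ, ∀ j ≥ N, ∀ k ≥ q, ∀ m, A k (n + j) m = 0) (q l r : ℤ) (n m : ℂ) :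
    iterIterSum A q (l + 1) r n m = iterIterSum A q l (r + 1) n m - iterIterSum A q l r n (m + 1) := by
  have := iterSum_succ (finUp_iterSum hA hA' q n) l r m
  simp only [iterIterSum]
  rw [this]; ring

/-- The two recurrences express the same factor as `z₃ - z₂` and as `z₀ + (z₃ - z₁)`. Together they
give `z₃ = z₁ + (z₃ - z₁)`, which drives the induction on `r` below. -/
theorem iterIterSum_succ_snd' (hA : ∀ k ≥ K, ∀ n m, A k n m = 0)
    (hA' : ∀ (q : ℤ) n, ∃ N : ℤ, ∀ j ≥ N, ∀ k ≥ q, ∀ m, A k (n + j) m = 0) (q l r : ℤ) (n m : ℂ) :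
    iterIterSum A q (l + 1) r n m = iterIterSum A q l r (n + 1) m + iterIterSum A (q + 1) l r n m := by
  have h1 : FinUp fun j m => iterSum (fun k n => A k n m) q (j + 1) n := by
    intro p m
    obtain ⟨K, hK⟩ := finUp_iterSum hA hA' q n (p + 1) m
    exact ⟨K, fun i hi => by
      beta_reduce
      rw [add_right_comm]
      exact hK i hi⟩
  have h2 := iterSum_sub h1 (finUp_iterSum hA hA' q (n + 1)) l r m
  simp only [iterSum_succ (finUp_of_bound hA _), add_sub_cancel_left] at h2
  simp only [iterIterSum]
  rw [← iterSum_add_one]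
  simp only [iterSum_succ (finUp_of_bound hA _)]
  rw [h2]; ring

theorem HasExpansion.iterIterSum {α : ℤ → ℂ → ℂ → ℂ} (h : ∀ k, HasExpansion (A k) (α k))
    (hA : ∀ k ≥ K, ∀ n m, A k n m = 0) (hA' : ∀ (q : ℤ) n, ∃ N : ℤ, ∀ j ≥ N, ∀ k ≥ q, ∀ m, A k (n + j) m = 0)
    (r : ℕ) : ∀ q : ℤ,
    HasExpansion (iterIterSum A q 0 r) (fun μ n => iterSum (fun k μ => α k μ n) q r μ) := by
  have hα : ∀ n, FinUp fun k μ => α k μ n := fun n =>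
    FinUp.of_bound (K := K) fun k hk μ => (h k).eq_zero (hA k hk) μ n
  induction r with
  | zero =>
    intro q
    refine (h q).congr (fun n m => ?_) fun μ n => ?_
    · simp [_root_.iterIterSum]
    · simp
  | succ r ih =>
    intro q
    refine ((ih q).shift_fst.add (ih (q + 1))).congr (fun n m => ?_) fun μ n => ?_
    · have h1 := iterIterSum_succ_snd hA hA' q 0 r n m
      have h2 := iterIterSum_succ_snd' hA hA' q 0 r n m
      push_cast
      linear_combination h2 - h1
    · push_cast
      rw [iterSum_succ (hα n)]

end

/-- Multiplication by powers of `z₃ - z₂` on both sides of an expansion. -/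
theorem HasExpansion.dif_snd {C : ℕ → ℤ → ℂ → ℂ → ℂ} {D : ℤ → ℂ → ℂ → ℂ} {r₀ : ℤ}
    (hC : ∀ l r n m, C (l + 1) r n m = C l (r + 1) n m - C l r n (m + 1))
    (h : ∀ r ≥ r₀, HasExpansion (C 0 r) (fun μ n => D r n μ)) (l : ℕ) :
    ∀ r ≥ r₀, HasExpansion (C l r) (fun μ n => (dif ℂ (ℂ → ℂ) ^ l) D r n μ) := by
  induction l with
  | zero => simpa using h
  | succ l ih =>
    intro r hr
    have h1 := (ih r hr).shift_snd 1
    refine ((ih (r + 1) (by omega)).sub h1).congr (fun n m => ?_) fun μ n => ?_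
    · rw [hC]; simp
    · rw [dif_pow_succ', dif_apply]; simp

/-- Here vanishing is known only for large `Re n`, not for large first index. The relation `g (r+1)
n = g r (n+1)` trades one for the other, and each cancelled factor moves the vanishing region by
one. The conclusion holds for `r` large depending on `n`. -/
theorem eq_zero_of_dif_pow_of_re {E : Type*} [AddCommGroup E] {r₀ : ℤ} {H : ℝ} (l : ℕ) :
    ∀ g : ℤ → ℂ → E, (∀ r ≥ r₀, ∀ n, (dif ℂ E ^ l) g r n = 0) →
      (∀ r ≥ r₀, ∀ n : ℂ, H < n.re → g r n = 0) →
      ∀ r ≥ r₀, ∀ n : ℂ, H + l < n.re + (r - r₀) → g r n = 0 := by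
  induction l with
  | zero => intro g hg _ r hr n _; exact hg r hr n
  | succ l ih =>
    intro g hg hH
    have h1 := ih (dif ℂ E g) (fun r hr n => by rw [← dif_pow_succ]; exact hg r hr n)
      (fun r hr n hn => by
        rw [dif_apply, hH _ (by omega) _ hn, hH _ hr _ (by
          rw [Complex.add_re, Complex.one_re]; linarith), sub_zero])
    have key : ∀ t : ℕ, ∀ n : ℂ, H + (l + 1 : ℕ) < n.re + t → g (r₀ + t) n = 0 := by
      intro t
      induction t with
      | zero =>
        intro n hn
        refine hH _ (by simp) _ ?_
        have : (0 : ℝ) ≤ l := l.cast_nonneg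
        push_cast at hn
        linarith
      | succ t iht =>
        intro n hn
        push_cast at hn
        have h2 := h1 (r₀ + t) (by omega) n (by push_cast; linarith)
        rw [dif_apply, iht (n + 1) (by rw [Complex.add_re, Complex.one_re]; push_cast; linarith),
          sub_zero] at h2
        push_cast
        rw [← add_assoc]
        exact h2
    intro r hr n hn
    obtain ⟨t, rfl⟩ : ∃ t : ℕ, r = r₀ + t := ⟨(r - r₀).toNat, by omega⟩
    refine key t n ?_
    push_cast at hn ⊢
    linarith

end

/-! ### Associativity of the series `φ_n`. -/

noncomputable section

variable {V : Type v} [AddCommGroup V] [Module ℂ V] [VertexOperatorAlgebra V]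
  {W₁ W₂ W₃ W₄ W₅ : Type u} [AddCommGroup W₁] [Module ℂ W₁] [AddCommGroup W₂] [Module ℂ W₂]
  [AddCommGroup W₃] [Module ℂ W₃] [AddCommGroup W₄] [Module ℂ W₄] [AddCommGroup W₅] [Module ℂ W₅]
  {S₁ : WeakModule V W₁} {S₂ : WeakModule V W₂} {S₃ : WeakModule V W₃} {S₄ : WeakModule V W₄}
  {S₅ : WeakModule V W₅} {F : IntertwiningOperator S₁ S₂ S₅} {G : IntertwiningOperator S₅ S₃ S₄}

variable (F G) in
/-- Associativity of the iterate of two intertwining operators. -/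
theorem iterate_associativity (f : Module.Dual ℂ W₄) (a : V) (w₁ : W₁) (w₂ : W₂) (w₃ : W₃)
    {l₀ r₀ : ℕ} (hl₀ : ∀ j ≥ (l₀ : ℤ), S₂.Y a j w₂ = 0) (hr₀ : ∀ j ≥ (r₀ : ℤ), S₃.Y a j w₃ = 0)
    (q : ℤ) {l r : ℤ} (hl : l ≥ l₀) (hr : r ≥ r₀) (n m : ℂ) :
    outerOuterSum (fun p n m => f (S₄.Y a p (G.mode (F.mode w₁ n w₂) m w₃))) q l r n m
      = iterIterSum (fun k n m => f (G.mode (F.mode (S₁.Y a k w₁) n w₂) m w₃)) q l r n m := by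
  obtain ⟨t, rfl⟩ : ∃ t : ℕ, r = t := ⟨r.toNat, by omega⟩
  set ψ : ℂ → W₅ →ₗ[ℂ] ℂ := fun m =>
    f ∘ₗ (LinearMap.applyₗ w₃) ∘ₗ (LinearMap.proj m : (ℂ → (W₃ →ₗ[ℂ] W₄)) →ₗ[ℂ] _) ∘ₗ G.mode with hψ
  have hψa : ∀ m x, ψ m x = f (G.mode x m w₃) := fun m x => rfl
  -- For `r ≥ r₀` the modes on `w₃` drop out of the Jacobi identity of `G`, leaving a finite sum of
  -- modes on `F(w₁,z₀)w₂`.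
  have inner : ∀ (l' : ℤ) (n : ℂ),
      outerSum (fun p m => f (S₄.Y a p (G.mode (F.mode w₁ n w₂) m w₃))) l' t m
      = ∑ j ∈ Finset.range (t + 1), ((t.choose j : ℕ) : ℤ) •
          ψ (m + t - j) (S₅.Y a (l' + j) (F.mode w₁ n w₂)) := by
    intro l' n
    have h := G.jacobi_sums a (F.mode w₁ n w₂) w₃ l' t m
    rw [innerSum_eq_zero (fun i => by rw [hr₀ _ (by omega), map_zero]), sub_zero] at h
    have h2 := congrArg f h
    have h3 := map_outerSum f.toAddMonoidHom (G.finDown_mode a (F.mode w₁ n w₂) w₃) l' t m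
    rw [iterSum_natCast, map_sum] at h2
    refine (h3.symm.trans h2).trans (Finset.sum_congr rfl fun j _ => ?_)
    rw [map_zsmul, hψa]
  have hD : ∀ j : ℕ, FinDown fun (p : ℤ) n => ψ (m + t - j) (S₅.Y a p (F.mode w₁ n w₂)) := fun j =>
    (F.finDown_mode a w₁ w₂).map (ψ (m + t - j)).toAddMonoidHom
  have hD' : ∀ j : ℕ, FinDown fun (p : ℤ) n =>
      ψ (m + t - j) (S₅.Y a (p + j) (F.mode w₁ n w₂)) := fun j p n => by
    obtain ⟨K, hK⟩ := hD j (p + j) n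
    exact ⟨K, fun i hi => by
      beta_reduce
      rw [sub_add_eq_add_sub]
      exact hK i hi⟩
  -- For `l ≥ l₀` the modes on `w₂` likewise drop out of the Jacobi identity of `F`.
  have outer : ∀ j : ℕ, outerSum (fun p n => ψ (m + t - j) (S₅.Y a p (F.mode w₁ n w₂))) q (l + j) n
      = iterSum (fun k n => ψ (m + t - j) (F.mode (S₁.Y a k w₁) n w₂)) q (l + j) n := by
    intro j
    have h := F.jacobi_sums a w₁ w₂ q (l + j) n
    rw [innerSum_eq_zero (fun i => by rw [hl₀ _ (by omega), map_zero]), sub_zero] at h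
    have h2 := congrArg (ψ (m + t - j)) h
    have h3 := map_outerSum (ψ (m + t - j)).toAddMonoidHom (F.finDown_mode a w₁ w₂) q (l + j) n
    have h4 := map_iterSum (ψ (m + t - j)).toAddMonoidHom (F.finUp_left a w₁ w₂) q (l + j) n
    exact (h3.symm.trans h2).trans h4
  have lhs : outerOuterSum (fun p n m => f (S₄.Y a p (G.mode (F.mode w₁ n w₂) m w₃))) q l t n m
      = ∑ j ∈ Finset.range (t + 1), ((t.choose j : ℕ) : ℤ) •
        outerSum (fun p n => ψ (m + t - j) (S₅.Y a p (F.mode w₁ n w₂))) q (l + j) n := by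
    simp only [outerOuterSum, inner]
    rw [outerSum_finset_sum hD']
    refine Finset.sum_congr rfl fun j _ => ?_
    rw [outerSum_shift (fun p n => ψ (m + t - j) (S₅.Y a p (F.mode w₁ n w₂)))]
  rw [lhs, iterIterSum, iterSum_natCast]
  refine Finset.sum_congr rfl fun j _ => ?_
  rw [outer]
  rfl

namespace IsIterateExtension

variable {φ : W₂ → W₃ → ℂ → ℂ → (W₁ →ₗ[ℂ] W₄)}

theorem hasExpansion_mode (hφ : IsIterateExtension F G φ) (h₄ : S₄.IsWeightGraded) (w₁ : W₁)
    (w₂ : W₂) (w₃ : W₃) {f : Module.Dual ℂ W₄} (hf : S₄.InGradedDual f) (a : V) (p : ℤ) :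
    HasExpansion (fun n m => f (S₄.Y a p (G.mode (F.mode w₁ n w₂) m w₃)))
      fun m n => f (S₄.Y a p (φ w₂ w₃ n m w₁)) :=
  (hφ.hasExpansion w₁ w₂ w₃ (h₄.inGradedDual_comp_mode hf a p)).congr (fun _ _ => rfl)
    fun _ _ => rfl

theorem derivative_fst (hφ : IsIterateExtension F G φ) (h₄ : S₄.IsWeightGraded) (w₁ : W₁)
    (w₂ : W₂) (w₃ : W₃) (n m : ℂ) :
    φ w₂ w₃ n m (S₁.L (-1) w₁) = (-m) • φ w₂ w₃ n (m - 1) w₁ := by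
  refine h₄.ext fun f hf => ?_
  have h1 := (hφ.hasExpansion w₁ w₂ w₃ hf).derivative
  have h2 := hφ.hasExpansion (S₁.L (-1) w₁) w₂ w₃ hf
  have h3 := h2.unique (h1.congr (fun n m => by simp [F.derivative]) fun _ _ => rfl)
  have := congrFun (congrFun h3 m) n
  rw [this, map_smul, smul_eq_mul]

/-- The iterate's mode expansion satisfies associativity at an order that does not depend on the
vector of `W₁`. -/
theorem assocAt (hφ : IsIterateExtension F G φ) (h₁ : S₁.IsWeightGraded)
    (h₂ : S₂.IsWeightGraded) (h₃ : S₃.IsWeightGraded) (h₄ : S₄.IsWeightGraded)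
    {w₂ : W₂} {w₃ : W₃} (hb : ∃ h : ℝ, ∀ n : ℂ, h < n.re → φ w₂ w₃ n = 0) (a : V) (n : ℂ) :
    ∃ k : ℤ, AssocAt S₁ S₄ (φ w₂ w₃ n) a k := by
  obtain ⟨H, hH⟩ := hb
  obtain ⟨l₀, hl₀⟩ := S₂.exists_nat_bound a w₂
  obtain ⟨r₀, hr₀⟩ := S₃.exists_nat_bound a w₃
  -- This gives `H + l₀ < Re n + (k - r₀)`, the condition for cancelling `(z₃ - z₂)^{l₀}`. The
  -- choice involves neither `w₁` nor the functional, so it is one exponent for the whole operator.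
  obtain ⟨k, hk⟩ := exists_int_gt (H + l₀ - n.re + r₀)
  refine ⟨max k r₀, fun w₁ q m => ?_⟩
  refine h₄.ext fun f hf => ?_
  set ℓ : ℤ → ℂ → ℂ → ℂ := fun p n m => f (S₄.Y a p (G.mode (F.mode w₁ n w₂) m w₃))
  set δ : ℤ → ℂ → ℂ → ℂ := fun p m n => f (S₄.Y a p (φ w₂ w₃ n m w₁))
  set A : ℤ → ℂ → ℂ → ℂ := fun k n m => f (G.mode (F.mode (S₁.Y a k w₁) n w₂) m w₃)
  set α : ℤ → ℂ → ℂ → ℂ := fun k m n => f (φ w₂ w₃ n m (S₁.Y a k w₁))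
  have hδ : ∀ p, HasExpansion (ℓ p) (δ p) := hφ.hasExpansion_mode h₄ w₁ w₂ w₃ hf a
  have hα : ∀ k, HasExpansion (A k) (α k) := fun k => hφ.hasExpansion _ w₂ w₃ hf
  obtain ⟨p₀, hp₀⟩ := h₄.exists_mode_bound hf a
  have hℓ : ∀ p < p₀, ∀ n m, ℓ p n m = 0 := fun p hp n m => hp₀ p hp _
  have hδ0 : ∀ p < p₀, ∀ m n, δ p m n = 0 := fun p hp n m => hp₀ p hp _
  obtain ⟨K, hK⟩ := S₁.exists_nat_bound a w₁
  have hA : ∀ k ≥ (K : ℤ), ∀ n m, A k n m = 0 := fun k hk n m => by simp [A, hK k hk]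
  have hα0 : ∀ k ≥ (K : ℤ), ∀ n m, α k n m = 0 := fun k hk n m => by simp [α, hK k hk]
  have hA' : ∀ (q : ℤ) n, ∃ N : ℤ, ∀ j ≥ N, ∀ k ≥ q, ∀ m, A k (n + j) m = 0 := by
    intro q n
    obtain ⟨N, hN⟩ := exists_uniform_of_eventually
      (p := fun i j => F.mode (S₁.Y a (q + i) w₁) (n + j) w₂ = 0)
      (fun i => F.truncation _ w₂ n) (I := ((K : ℤ) - q).toNat)
      (fun i hi x => by rw [hK _ (by omega)]; simp)
    refine ⟨N, fun j hj k hk m => ?_⟩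
    have := hN (k - q).toNat j hj
    rw [show q + ((k - q).toNat : ℤ) = k by omega] at this
    simp [A, this]
  have e1 := HasExpansion.dif_snd (C := fun l r => outerOuterSum ℓ q l r) (r₀ := r₀)
    (D := fun r n m => outerSum (fun p m => δ p m n) q r m)
    (fun l r n m => by push_cast; exact outerOuterSum_succ_snd hℓ q l r n m)
    (fun r _ => HasExpansion.outerOuterSum hδ hℓ q r) l₀
  have e2 := HasExpansion.dif_snd (C := fun l r => iterIterSum A q l r) (r₀ := r₀)
    (D := fun r n m => iterSum (fun k m => α k m n) q r m)
    (fun l r n m => by push_cast; exact iterIterSum_succ_snd hA hA' q l r n m)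
    (fun r hr => by
      obtain ⟨t, rfl⟩ : ∃ t : ℕ, r = t := ⟨r.toNat, by omega⟩
      exact HasExpansion.iterIterSum hα hA hA' t q) l₀
  set g : ℤ → ℂ → (ℂ → ℂ) := (fun r n m => outerSum (fun p m => δ p m n) q r m)
    - fun r n m => iterSum (fun k m => α k m n) q r m with hg
  -- After multiplication by `(z₃ - z₂)^{l₀}` both sides expand the same iterate, so uniqueness
  -- equates them.
  have hg0 : ∀ r ≥ (r₀ : ℤ), ∀ n, (dif ℂ (ℂ → ℂ) ^ l₀) g r n = 0 := by
    intro r hr n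
    funext m
    have h1 := (e1 r hr).unique ((e2 r hr).congr (fun n m =>
      iterate_associativity F G f a w₁ w₂ w₃ hl₀ hr₀ q le_rfl hr n m) fun _ _ => rfl)
    rw [hg, map_sub]
    exact sub_eq_zero.2 (congrFun (congrFun h1 m) n)
  have hgH : ∀ r ≥ (r₀ : ℤ), ∀ n : ℂ, H < n.re → g r n = 0 := by
    intro r _ n hn
    funext m
    simp only [hg, Pi.sub_apply]
    rw [outerSum_eq_zero fun i => by simp [δ, hH n hn], iterSum_eq_zero fun i => by
      simp [α, hH n hn], sub_zero]
    rfl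
  have hfin := eq_zero_of_dif_pow_of_re l₀ g hg0 hgH (max k r₀) (le_max_right _ _) n (by
    have : (k : ℝ) ≤ ((max k r₀ : ℤ) : ℝ) := by exact_mod_cast le_max_left _ _
    push_cast at this ⊢
    linarith)
  have hfin' := sub_eq_zero.1 (congrFun hfin m)
  have h5 := map_outerSum f.toAddMonoidHom (f := fun p m => S₄.Y a p (φ w₂ w₃ n m w₁))
    (S₄.finDown_comp a fun α => hφ.truncation h₁ h₂ h₃ h₄ w₂ w₃ n α w₁) q (max k r₀) m
  have h6 := map_iterSum f.toAddMonoidHom (S₁.finUp_mode a w₁ (φ w₂ w₃ n)) q (max k r₀) m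
  exact (h5.trans hfin').trans h6.symm

end IsIterateExtension

end

/-! ### The Jacobi identity relating `∘_r` to the modes on `W₂` and `W₃`. -/

noncomputable section

section

variable {ℓ δ : ℤ → ℂ → ℂ → ℂ}

theorem HasExpansion.outerSum_snd (h : ∀ p, HasExpansion (ℓ p) (δ p)) {p₀ : ℤ}
    (hℓ : ∀ p < p₀, ∀ n m, ℓ p n m = 0) (l r : ℤ) :
    HasExpansion (fun n m => outerSum (fun p m => ℓ p n m) l r m)
      (fun μ n => outerSum (fun p n => δ p μ n) l r n) := by
  refine (HasExpansion.finsum (fun i => (-1) ^ i * Ring.choose l i)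
    (fun i => (h (r + l - i)).shift_snd i)
    ⟨(r + l - p₀ + 1).toNat, fun i hi n m => hℓ _ (by omega) _ _⟩).congr
    (fun n m => ?_) fun μ n => ?_ <;> simp [outerSum]

theorem HasExpansion.innerSum_snd (h : ∀ p, HasExpansion (ℓ p) (δ p)) {K : ℤ}
    (hℓ : ∀ p ≥ K, ∀ n m, ℓ p n m = 0) (l r : ℤ) :
    HasExpansion (fun n m => innerSum (fun p m => ℓ p n m) l r m)
      (fun μ n => innerSum (fun p n => δ p μ n) l r n) := by
  refine (HasExpansion.finsum (fun i => (-1) ^ i * Ring.choose l i * (Int.negOnePow l : ℤˣ))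
    (fun i => (h (r + i)).shift_snd (l - i))
    ⟨(K - r).toNat, fun i hi n m => hℓ _ (by omega) _ _⟩).congr
    (fun n m => ?_) fun μ n => ?_ <;> simp [innerSum, add_sub_assoc, mul_assoc]

theorem HasExpansion.iterSum_snd (h : ∀ p, HasExpansion (ℓ p) (δ p)) {K : ℤ}
    (hℓ : ∀ p ≥ K, ∀ n m, ℓ p n m = 0) (l r : ℤ) :
    HasExpansion (fun n m => iterSum (fun p m => ℓ p n m) l r m)
      (fun μ n => iterSum (fun p n => δ p μ n) l r n) := by
  refine (HasExpansion.finsum (fun i => Ring.choose r i)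
    (fun i => (h (l + i)).shift_snd (r - i))
    ⟨(K - l).toNat, fun i hi n m => hℓ _ (by omega) _ _⟩).congr
    (fun n m => ?_) fun μ n => ?_ <;> simp [iterSum, add_sub_assoc]

end

theorem dif_pow_apply_apply {ι κ E : Type*} [Ring ι] [AddCommGroup E] (D : ℤ → ι → κ → E) (q : ℕ)
    (p : ℤ) (m : ι) (n : κ) :
    (dif ι (κ → E) ^ q) D p m n = (dif ι E ^ q) (fun p m => D p m n) p m := by
  induction q generalizing D with
  | zero => rfl
  | succ q ih =>
    rw [dif_pow_succ, dif_pow_succ, ih]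
    rfl

/-- Multiplication by powers of `z₃ - z₁` on both sides of an expansion. -/
theorem HasExpansion.dif_fst {C : ℕ → ℤ → ℂ → ℂ → ℂ} {D : ℤ → ℂ → ℂ → ℂ}
    (hC : ∀ q r n m, C (q + 1) r n m = C q (r + 1) n m - (C q r (n + 1) m + C q r n (m + 1)))
    (h : ∀ r, HasExpansion (C 0 r) (D r)) (q : ℕ) :
    ∀ r, HasExpansion (C q r) ((dif ℂ (ℂ → ℂ) ^ q) D r) := by
  induction q with
  | zero => simpa using h
  | succ q ih =>
    intro r
    refine ((ih (r + 1)).sub (ih r).shift_fst).congr (fun n m => hC _ _ _ _) fun μ n => ?_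
    rw [dif_pow_succ', dif_apply]; rfl

variable {V : Type v} [AddCommGroup V] [Module ℂ V] [VertexOperatorAlgebra V]
  {W₁ W₂ W₃ W₄ W₅ : Type u} [AddCommGroup W₁] [Module ℂ W₁] [AddCommGroup W₂] [Module ℂ W₂]
  [AddCommGroup W₃] [Module ℂ W₃] [AddCommGroup W₄] [Module ℂ W₄] [AddCommGroup W₅] [Module ℂ W₅]
  {S₁ : WeakModule V W₁} {S₂ : WeakModule V W₂} {S₃ : WeakModule V W₃} {S₄ : WeakModule V W₄}
  {S₅ : WeakModule V W₅} {F : IntertwiningOperator S₁ S₂ S₅} {G : IntertwiningOperator S₅ S₃ S₄}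

variable (F G) in
/-- The Jacobi identity of the iterate of two intertwining operators. -/
theorem iterate_jacobi (f : Module.Dual ℂ W₄) (a : V) (w₁ : W₁) (w₂ : W₂) (w₃ : W₃) (l r : ℤ)
    (n m : ℂ) :
    outerSum (fun p m => f (S₄.Y a p (G.mode (F.mode w₁ n w₂) m w₃))) l r m
      - innerSum (fun p m => f (G.mode (F.mode w₁ n w₂) m (S₃.Y a p w₃))) l r m
      - iterSum (fun p m => f (G.mode (F.mode w₁ n (S₂.Y a p w₂)) m w₃)) l r m
      = iterIterSum (fun k n m => f (G.mode (F.mode (S₁.Y a k w₁) n w₂) m w₃)) 0 l r n m := by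
  set ψ : ℂ → W₅ →ₗ[ℂ] ℂ := fun m =>
    f ∘ₗ (LinearMap.applyₗ w₃) ∘ₗ (LinearMap.proj m : (ℂ → (W₃ →ₗ[ℂ] W₄)) →ₗ[ℂ] _) ∘ₗ G.mode with hψ
  have h := congrArg f (G.jacobi_sums a (F.mode w₁ n w₂) w₃ l r m)
  rw [map_sub] at h
  have h1 := map_outerSum f.toAddMonoidHom (G.finDown_mode a (F.mode w₁ n w₂) w₃) l r m
  have h2 := map_innerSum f.toAddMonoidHom (S₃.finUp_mode a w₃ (G.mode (F.mode w₁ n w₂))) l r m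
  have hY := (G.finUp_left a (F.mode w₁ n w₂) w₃).map f.toAddMonoidHom
  have h3 := map_iterSum f.toAddMonoidHom (G.finUp_left a (F.mode w₁ n w₂) w₃) l r m
  have hB : FinUp fun p m => f (G.mode (F.mode w₁ n (S₂.Y a p w₂)) m w₃) :=
    S₂.finUp_mode a w₂ fun m => ψ m ∘ₗ F.mode w₁ n
  have h4 := iterSum_sub hY hB l r m
  -- The Jacobi identity of `G` produces modes on `F(w₁,z₀)w₂`; the commutator formula of `F` splits
  -- these into modes on `w₂` and modes on `w₁`.
  have h5 : (fun (p : ℤ) m => f.toAddMonoidHom (G.mode (S₅.Y a p (F.mode w₁ n w₂)) m w₃)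
      - f (G.mode (F.mode w₁ n (S₂.Y a p w₂)) m w₃))
      = fun j m => iterSum (fun k n => f (G.mode (F.mode (S₁.Y a k w₁) n w₂) m w₃)) 0 j n := by
    funext j m
    have h6 := congrArg (ψ m) (F.commutator a w₁ w₂ j n)
    rw [map_sub] at h6
    exact h6.trans (map_iterSum (ψ m).toAddMonoidHom (F.finUp_left a w₁ w₂) 0 j n)
  rw [h5] at h4
  refine Eq.trans ?_ h4.symm
  congr 1
  exact (congrArg₂ _ h1.symm h2.symm).trans (h.trans h3)

namespace IsIterateExtension

variable {φ : W₂ → W₃ → ℂ → ℂ → (W₁ →ₗ[ℂ] W₄)}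

theorem isGenRightIntertwining (hφ : IsIterateExtension F G φ)
    (hconv : IterateConvergenceExtension F G) (h₁ : S₁.IsWeightGraded)
    (h₂ : S₂.IsWeightGraded) (h₃ : S₃.IsWeightGraded) (h₄ : S₄.IsWeightGraded)
    (w₂ : W₂) (w₃ : W₃) (n : ℂ) : IsGenRightIntertwining S₁ S₄ (φ w₂ w₃ n) :=
  isGenRightIntertwining_iff.2 ⟨fun α w₁ => hφ.truncation h₁ h₂ h₃ h₄ w₂ w₃ n α w₁,
    fun m w₁ => hφ.derivative_fst h₄ w₁ w₂ w₃ n m,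
    fun a => hφ.assocAt h₁ h₂ h₃ h₄ (hφ.exists_bound hconv h₁ h₂ h₃ h₄ w₂ w₃) a n⟩

theorem exists_nat_bound (hφ : IsIterateExtension F G φ)
    (hconv : IterateConvergenceExtension F G) (h₁ : S₁.IsWeightGraded)
    (h₂ : S₂.IsWeightGraded) (h₃ : S₃.IsWeightGraded) (h₄ : S₄.IsWeightGraded)
    (w₂ : W₂) (w₃ : W₃) (n : ℂ) : ∃ N : ℤ, ∀ j ≥ N, φ w₂ w₃ (n + j) = 0 := by
  obtain ⟨H, hH⟩ := hφ.exists_bound hconv h₁ h₂ h₃ h₄ w₂ w₃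
  obtain ⟨N, hN⟩ := exists_int_gt (H - n.re)
  refine ⟨N, fun j hj => hH _ ?_⟩
  have : (N : ℝ) ≤ j := by exact_mod_cast hj
  rw [Complex.add_re, Complex.intCast_re]
  linarith

/-- The Jacobi identity relating `∘_r` to the modes on `W₂` and `W₃`. -/
theorem jacobi_sums (hφ : IsIterateExtension F G φ)
    (hconv : IterateConvergenceExtension F G) (h₁ : S₁.IsWeightGraded)
    (h₂ : S₂.IsWeightGraded) (h₃ : S₃.IsWeightGraded) (h₄ : S₄.IsWeightGraded)
    (a : V) (w₂ : W₂) (w₃ : W₃) (l r : ℤ) (n : ℂ) :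
    outerSum (fun p n => circRight S₁ S₄ a p (φ w₂ w₃ n)) l r n
      - innerSum (fun p n => φ w₂ (S₃.Y a p w₃) n) l r n
      = iterSum (fun p n => φ (S₂.Y a p w₂) w₃ n) l r n := by
  have hbound := hφ.exists_nat_bound hconv h₁ h₂ h₃ h₄
  have hgen := hφ.isGenRightIntertwining hconv h₁ h₂ h₃ h₄
  obtain ⟨K₂, hK₂⟩ := S₂.exists_nat_bound a w₂
  obtain ⟨K₃, hK₃⟩ := S₃.exists_nat_bound a w₃
  have hdown : FinDown fun p n => circRight S₁ S₄ a p (φ w₂ w₃ n) := fun p n => by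
    obtain ⟨I, hI⟩ := exists_nat_ge_of_int (hbound w₂ w₃ n) 0
    exact ⟨I, fun i hi => by
      have := hI i hi
      rw [zero_add] at this
      beta_reduce
      rw [show n + (i : ℂ) = n + ((i : ℤ) : ℂ) by simp, this, circRight_zero_op]⟩
  have hup₃ : FinUp fun p n => φ w₂ (S₃.Y a p w₃) n :=
    FinUp.of_bound fun p (hp : p ≥ K₃) n => by rw [hK₃ p hp, hφ.zero_thd h₄]; rfl
  have hup₂ : FinUp fun p n => φ (S₂.Y a p w₂) w₃ n :=
    FinUp.of_bound fun p (hp : p ≥ K₂) n => by rw [hK₂ p hp, hφ.zero_snd h₄]; rfl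
  rw [← sub_eq_zero]
  funext m
  ext w₁
  rw [Pi.zero_apply, LinearMap.zero_apply]
  refine h₄.ext fun f hf => ?_
  rw [map_zero]
  obtain ⟨K₁, hK₁⟩ := S₁.exists_nat_bound a w₁
  obtain ⟨p₀, hp₀⟩ := h₄.exists_mode_bound hf a
  set ev : ℂ → (ℂ → (W₁ →ₗ[ℂ] W₄)) →+ ℂ := fun m => (f ∘ₗ (LinearMap.applyₗ w₁) ∘ₗ
    (LinearMap.proj m : (ℂ → (W₁ →ₗ[ℂ] W₄)) →ₗ[ℂ] _)).toAddMonoidHom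
  have hev : ∀ m Φ, ev m Φ = f (Φ m w₁) := fun _ _ => rfl
  -- expansions of the three sums
  set δ : ℤ → ℂ → ℂ → ℂ := fun p m n => f (S₄.Y a p (φ w₂ w₃ n m w₁))
  set κ : ℤ → ℂ → ℂ → ℂ := fun p m n => f (circRight S₁ S₄ a p (φ w₂ w₃ n) m w₁)
  set ν : ℤ → ℂ → ℂ → ℂ := fun p m n => f (φ w₂ (S₃.Y a p w₃) n m w₁)
  set β : ℤ → ℂ → ℂ → ℂ := fun p m n => f (φ (S₂.Y a p w₂) w₃ n m w₁)
  set A : ℤ → ℂ → ℂ → ℂ := fun k n m => f (G.mode (F.mode (S₁.Y a k w₁) n w₂) m w₃)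
  have hA : ∀ k ≥ (K₁ : ℤ), ∀ n m, A k n m = 0 := fun k hk n m => by simp [A, hK₁ k hk]
  have hA' : ∀ (q : ℤ) n, ∃ N : ℤ, ∀ j ≥ N, ∀ k ≥ q, ∀ m, A k (n + j) m = 0 := by
    intro q n
    obtain ⟨N, hN⟩ := exists_uniform_of_eventually
      (p := fun i j => F.mode (S₁.Y a (q + i) w₁) (n + j) w₂ = 0)
      (fun i => F.truncation _ w₂ n) (I := ((K₁ : ℤ) - q).toNat)
      (fun i hi x => by rw [hK₁ _ (by omega)]; simp)
    refine ⟨N, fun j hj k hk m => ?_⟩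
    have := hN (k - q).toNat j hj
    rw [show q + ((k - q).toNat : ℤ) = k by omega] at this
    simp [A, this]
  set D : ℤ → ℂ → ℂ → ℂ := fun r m n => outerSum (fun p n => δ p m n) l r n
    - innerSum (fun p n => ν p m n) l r n - iterSum (fun p n => β p m n) l r n with hD
  have hexp : ∀ r, HasExpansion (iterIterSum A 0 l r) (D r) := fun r =>
    (((HasExpansion.outerSum_snd (hφ.hasExpansion_mode h₄ w₁ w₂ w₃ hf a)
        (fun p hp n m => hp₀ p hp _) l r).sub
      (HasExpansion.innerSum_snd (fun p => hφ.hasExpansion w₁ w₂ (S₃.Y a p w₃) hf)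
        (fun p (hp : p ≥ K₃) n m => by rw [hK₃ p hp]; simp) l r)).sub
      (HasExpansion.iterSum_snd (fun p => hφ.hasExpansion w₁ (S₂.Y a p w₂) w₃ hf)
        (fun p (hp : p ≥ K₂) n m => by rw [hK₂ p hp]; simp) l r)).congr
      (fun n m => (iterate_jacobi F G f a w₁ w₂ w₃ l r n m).symm) fun m n => rfl
  -- Multiplication by `(z₃ - z₁)^{K₁}` raises the index of the modes on `w₁` to at least `K₁`,
  -- where they vanish. By uniqueness the expansion `D` is annihilated as well.
  have hdif : ∀ r m n, (dif ℂ (ℂ → ℂ) ^ K₁) D r m n = 0 := by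
    intro r
    refine (HasExpansion.dif_fst (C := fun q r => iterIterSum A q l r) (fun q r n m => ?_) hexp K₁
      r).eq_zero fun n m => ?_
    · have h1 := iterIterSum_succ_snd hA hA' q l r n m
      have h2 := iterIterSum_succ_snd' hA hA' q l r n m
      push_cast
      linear_combination h1 - h2
    · exact iterSum_eq_zero fun i => iterSum_eq_zero fun j => hA _ (by omega) _ _
  -- pass to `∘_r`
  obtain ⟨I, hI⟩ := exists_nat_ge_of_int (hbound w₂ w₃ n) 0
  have hI' : ∀ i : ℕ, I ≤ i → φ w₂ w₃ (n + i) = 0 := fun i hi => by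
    have := hI i hi
    rwa [zero_add, Int.cast_natCast] at this
  -- `g` is `D` with the left modes of `a` replaced by `∘_r`. The difference consists of removed
  -- parts, annihilated by the same power of `X - z₁`.
  set g : ℤ → ℂ → ℂ := fun r m => outerSum (fun p n => κ p m n) l r n
    - innerSum (fun p n => ν p m n) l r n - iterSum (fun p n => β p m n) l r n with hg
  have hσ : (dif ℂ ℂ ^ K₁) (fun r m => ∑ᶠ i : ℕ, ((-1) ^ i * Ring.choose l i : ℤ) •
      f (resRight S₁ a (φ w₂ w₃ (n + i)) w₁ (r + l - i) m)) = 0 := by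
    rw [dif_pow_finsum (fun r m => ⟨I, fun i hi => by simp [hI' i hi, resRight, iterSum]⟩)]
    funext r m
    refine finsum_eq_zero_of_forall fun i => ?_
    have e : (fun (r : ℤ) m => f (resRight S₁ a (φ w₂ w₃ (n + i)) w₁ (r + l - i) m))
        = fun r m => (fun r m => iterSum (fun p m => f (φ w₂ w₃ (n + i) m (S₁.Y a p w₁))) 0 r m)
          (r + (l - i)) (m + 0) := by
      funext r m
      rw [add_zero, ← add_sub_assoc]
      exact map_iterSum f.toAddMonoidHom (S₁.finUp_mode a w₁ (φ w₂ w₃ (n + i))) 0 _ m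
    rw [e, dif_pow_translate, dif_pow_iterSum_eq_zero]
    · simp
    · exact (S₁.finUp_mode a w₁ (φ w₂ w₃ (n + i))).map f.toAddMonoidHom
    · intro j hj m
      rw [hK₁ j (by omega), map_zero, map_zero]
  have hDg : (fun r m => D r m n) = g + fun r m => ∑ᶠ i : ℕ, ((-1) ^ i * Ring.choose l i : ℤ) •
      f (resRight S₁ a (φ w₂ w₃ (n + i)) w₁ (r + l - i) m) := by
    funext r m
    have e : outerSum (fun p n => δ p m n) l r n = outerSum (fun p n => κ p m n) l r n
        + ∑ᶠ i : ℕ, ((-1) ^ i * Ring.choose l i : ℤ) •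
      f (resRight S₁ a (φ w₂ w₃ (n + i)) w₁ (r + l - i) m) := by
      simp only [outerSum]
      rw [← finsum_add_of_eventually]
      · refine finsum_congr fun i => ?_
        rw [← smul_add]
        simp only [δ, κ, circRight_apply, map_sub, sub_add_cancel]
      · exact ⟨I, fun i hi => by simp [κ, hI' i hi, circRight_zero_op]⟩
      · exact ⟨I, fun i hi => by simp [hI' i hi, resRight, iterSum]⟩
    simp only [hD, hg, Pi.add_apply, e]
    ring
  have hg0 : ∀ r m, (dif ℂ ℂ ^ K₁) g r m = 0 := by
    intro r m
    have h1 := hdif r m n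
    rw [dif_pow_apply_apply, hDg, map_add, hσ, add_zero] at h1
    exact h1
  -- All three sums vanish for large `r`: `∘_r` truncates each of the finitely many nonzero
  -- `φ_{n+i}`, and the other two use truncation on `w₃` and of `φ` in `n`. Cancellation then gives
  -- `g = 0`.
  have hglarge : ∃ b : ℤ, ∀ r ≥ b, ∀ m, g r m = 0 := by
    obtain ⟨N₁, hN₁⟩ := exists_uniform_of_eventually
      (p := fun i x => circRight S₁ S₄ a (x + l - i) (φ w₂ w₃ (n + i)) = 0) (fun i => by
        obtain ⟨N, hN⟩ := (hgen w₂ w₃ (n + i)).circRight_eventually a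
        exact ⟨N - l + i, fun x hx => hN _ (by omega)⟩) (I := I)
      (fun i hi x => by rw [hI' i hi, circRight_zero_op])
    obtain ⟨N₂, hN₂⟩ := exists_uniform_of_eventually
      (p := fun i x => φ (S₂.Y a (l + i) w₂) w₃ (n + x - i) = 0) (fun i => by
        obtain ⟨N, hN⟩ := hbound (S₂.Y a (l + i) w₂) w₃ (n - i)
        refine ⟨N, fun x hx => ?_⟩
        rw [add_sub_right_comm]
        exact hN x hx) (I := ((K₂ : ℤ) - l).toNat)
      (fun i hi x => by rw [hK₂ _ (by omega), hφ.zero_snd h₄]; rfl)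
    refine ⟨max (max N₁ N₂) K₃, fun r hr m => ?_⟩
    simp only [hg]
    rw [outerSum_eq_zero (fun i => ?_), innerSum_eq_zero (fun i => ?_), iterSum_eq_zero (fun i => ?_),
      sub_zero, sub_zero]
    · simp only [β]
      rw [hN₂ i r (by omega)]; simp
    · simp only [ν]
      rw [hK₃ _ (by omega), hφ.zero_thd h₄]; simp
    · simp only [κ]
      rw [hN₁ i r (by omega)]; simp
  have hfin := eq_zero_of_dif_pow_eq_zero (a := r) (fun p _ m => hg0 p m) hglarge r le_rfl m
  rw [← hev, map_sub, map_sub, map_outerSum _ hdown, map_innerSum _ hup₃, map_iterSum _ hup₂]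
  exact hfin

end IsIterateExtension

end

/-! ### The weak submodule, the two intertwining operators and the conclusion. -/

noncomputable section

/-- The span of all `φ_n(w₂,w₃,z₁)`. -/
def IsIterateExtension.modeSpan {W₁ W₂ W₃ W₄ : Type*} [AddCommGroup W₁] [Module ℂ W₁]
    [AddCommGroup W₄] [Module ℂ W₄] (φ : W₂ → W₃ → ℂ → ℂ → (W₁ →ₗ[ℂ] W₄)) :
    Submodule ℂ (ℂ → (W₁ →ₗ[ℂ] W₄)) :=
  Submodule.span ℂ {Φ | ∃ (w₂ : W₂) (w₃ : W₃) (n : ℂ), Φ = φ w₂ w₃ n}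

theorem IsIterateExtension.mem_modeSpan {W₁ W₂ W₃ W₄ : Type*} [AddCommGroup W₁] [Module ℂ W₁]
    [AddCommGroup W₄] [Module ℂ W₄] (φ : W₂ → W₃ → ℂ → ℂ → (W₁ →ₗ[ℂ] W₄)) (w₂ : W₂) (w₃ : W₃)
    (n : ℂ) :
    φ w₂ w₃ n ∈ modeSpan φ := Submodule.subset_span ⟨w₂, w₃, n, rfl⟩

variable {V : Type v} [AddCommGroup V] [Module ℂ V] [VertexOperatorAlgebra V]
  {W₁ W₂ W₃ W₄ W₅ : Type u} [AddCommGroup W₁] [Module ℂ W₁] [AddCommGroup W₂] [Module ℂ W₂]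
  [AddCommGroup W₃] [Module ℂ W₃] [AddCommGroup W₄] [Module ℂ W₄] [AddCommGroup W₅] [Module ℂ W₅]
  {S₁ : WeakModule V W₁} {S₂ : WeakModule V W₂} {S₃ : WeakModule V W₃} {S₄ : WeakModule V W₄}
  {S₅ : WeakModule V W₅} {F : IntertwiningOperator S₁ S₂ S₅} {G : IntertwiningOperator S₅ S₃ S₄}

theorem IntertwiningOperator.mode_L_neg_one (I : IntertwiningOperator S₁ S₂ S₃) (w : W₁) (n : ℂ)
    (u : W₂) : I.mode w n (S₂.L (-1) u) = S₃.L (-1) (I.mode w n u) + n • I.mode w (n - 1) u := by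
  have h := I.commutator VertexOperatorAlgebra.conf w u 0 n
  rw [iterSum_zero, ← S₁.L_neg_one, ← S₂.L_neg_one, ← S₃.L_neg_one, I.derivative] at h
  rw [sub_eq_iff_eq_add] at h
  rw [h, LinearMap.smul_apply]
  module

namespace IsIterateExtension

variable {φ : W₂ → W₃ → ℂ → ℂ → (W₁ →ₗ[ℂ] W₄)}

/-- Only differentiation in `z₁` has been carried through expansions. On homogeneous vectors Euler's
relation expresses `z₂ ∂/∂z₂` through `z₁ ∂/∂z₁` and the total degree, so nothing further is needed.
-/
theorem derivative_snd (hφ : IsIterateExtension F G φ) (h₁ : S₁.IsWeightGraded)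
    (h₂ : S₂.IsWeightGraded) (h₃ : S₃.IsWeightGraded) (h₄ : S₄.IsWeightGraded) (w₂ : W₂) (w₃ : W₃)
    (n : ℂ) : φ (S₂.L (-1) w₂) w₃ n = (-n) • φ w₂ w₃ (n - 1) := by
  refine h₂.induction (P := fun w₂ => φ (S₂.L (-1) w₂) w₃ n = (-n) • φ w₂ w₃ (n - 1)) w₂
    (fun k₂ w₂ hw₂ => ?_) ?_ fun x y hx hy => ?_
  rotate_left
  · rw [map_zero, hφ.zero_snd h₄]; simp
  · rw [map_add, hφ.add_snd h₄, hφ.add_snd h₄, Pi.add_apply, hx, hy, Pi.add_apply, smul_add]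
  refine h₃.induction (P := fun w₃ => φ (S₂.L (-1) w₂) w₃ n = (-n) • φ w₂ w₃ (n - 1)) w₃
    (fun k₃ w₃ hw₃ => ?_) ?_ fun x y hx hy => ?_
  rotate_left
  · rw [hφ.zero_thd h₄, hφ.zero_thd h₄]; simp
  · rw [hφ.add_thd h₄, hφ.add_thd h₄, Pi.add_apply, hx, hy, Pi.add_apply, smul_add]
  funext m
  refine h₁.linearMap_ext fun k₁ w₁ hw₁ => ?_
  rw [← sub_eq_zero]
  refine h₄.eq_zero_of_forall fun f hf => ?_
  obtain ⟨k, hk⟩ := hf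
  have hf : S₄.InGradedDual f := WeakModule.IsHomogeneousFunctional.inGradedDual ⟨k, hk⟩
  set σ := k₁ + k₂ + k₃ - 2 - k with hσ
  set c : ℂ → ℂ → ℂ := fun n m => f (G.mode (F.mode w₁ n w₂) m w₃) with hc
  have hcσ : ∀ n m, n + m ≠ σ → c n m = 0 := fun n m hnm =>
    hk _ (fun h0 => hnm (by rw [hσ, ← h0]; ring)) _ (iterate_mem hw₁ hw₂ hw₃ n m)
  have e0 := hφ.hasExpansion w₁ w₂ w₃ hf
  have e1 := e0.derivative.shift_fst
  have e2 := (hφ.hasExpansion w₁ (S₂.L (-1) w₂) w₃ hf).shift_snd 1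
  -- On the iterate, `z₁ ∂/∂z₀` plus `z₂` times the insertion of `L(-1)w₂` equals `z₀ ∂/∂z₀ + z₂
  -- ∂/∂z₂`, since inserting `L(-1)w₂` is `∂/∂z₂ - ∂/∂z₀`. The total degree is `-(σ + 2)`.
  have e3 := (e1.add e2).unique ((e0.smul (-(σ + 2))).congr (fun n m => ?_) fun _ _ => rfl)
  · have h1 := congrFun (congrFun e3 m) (n - 1)
    simp only [add_sub_cancel_right, Int.cast_one, sub_add_cancel] at h1
    simp only [Pi.smul_apply, LinearMap.smul_apply, map_sub, map_smul, smul_eq_mul]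
    by_cases hmn : m + (n - 1) = σ
    · rw [← hmn] at h1
      linear_combination h1
    · rw [e0.homogeneous hcσ hmn] at h1 ⊢
      linear_combination h1
  · simp only [add_sub_cancel_right, Int.cast_one, F.mode_L_neg_one, map_add, Pi.add_apply,
      LinearMap.add_apply, G.derivative, map_smul, LinearMap.smul_apply, Pi.smul_apply,
      smul_eq_mul]
    by_cases hnm : n + m = σ
    · rw [← hnm]; ring
    · have h0 := hcσ n m hnm
      simp only [hc] at h0
      rw [h0]; ring

theorem mem_genRightHomogeneous (hφ : IsIterateExtension F G φ)
    (hconv : IterateConvergenceExtension F G) (h₁ : S₁.IsWeightGraded)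
    (h₂ : S₂.IsWeightGraded) (h₃ : S₃.IsWeightGraded) (h₄ : S₄.IsWeightGraded)
    (w₂ : W₂) (w₃ : W₃) (n : ℂ) : φ w₂ w₃ n ∈ genRightHomogeneous S₁ S₄ := by
  refine h₂.induction (P := fun w₂ => φ w₂ w₃ n ∈ genRightHomogeneous S₁ S₄) w₂
    (fun k₂ w₂ hw₂ => ?_) ?_ fun x y hx hy => ?_
  rotate_left
  · rw [hφ.zero_snd h₄]; exact Submodule.zero_mem _
  · rw [hφ.add_snd h₄]; exact Submodule.add_mem _ hx hy
  refine h₃.induction (P := fun w₃ => φ w₂ w₃ n ∈ genRightHomogeneous S₁ S₄) w₃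
    (fun k₃ w₃ hw₃ => ?_) ?_ fun x y hx hy => ?_
  rotate_left
  · rw [hφ.zero_thd h₄]; exact Submodule.zero_mem _
  · rw [hφ.add_thd h₄]; exact Submodule.add_mem _ hx hy
  refine Submodule.subset_span ⟨hφ.isGenRightIntertwining hconv h₁ h₂ h₃ h₄ w₂ w₃ n,
    k₂ + k₃ - n - 1, fun m k₁ w₁ hw₁ => ?_⟩
  convert hφ.mem h₄ hw₁ hw₂ hw₃ n m using 2
  ring

/-- At `l = 0` the Jacobi identity is a commutator formula, writing `a_p ∘ φ_n` as a finite
combination of series `φ` with modes of `a` applied to `w₂` or `w₃`. -/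
theorem circRight_mem_modeSpan (hφ : IsIterateExtension F G φ)
    (hconv : IterateConvergenceExtension F G) (h₁ : S₁.IsWeightGraded)
    (h₂ : S₂.IsWeightGraded) (h₃ : S₃.IsWeightGraded) (h₄ : S₄.IsWeightGraded) (a : V) (p : ℤ)
    {Φ : ℂ → (W₁ →ₗ[ℂ] W₄)} (hΦ : Φ ∈ modeSpan φ) : circRight S₁ S₄ a p Φ ∈ modeSpan φ := by
  induction hΦ using Submodule.span_induction with
  | mem Φ hΦ =>
    obtain ⟨w₂, w₃, n, rfl⟩ := hΦ
    have h := hφ.jacobi_sums hconv h₁ h₂ h₃ h₄ a w₂ w₃ 0 p n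
    rw [outerSum_zero, innerSum_zero, sub_eq_iff_eq_add] at h
    rw [h]
    refine Submodule.add_mem _ ?_ (mem_modeSpan φ _ _ _)
    exact finsum_induction (· ∈ modeSpan φ) (Submodule.zero_mem _) (fun _ _ => Submodule.add_mem _)
      fun i => zsmul_mem (mem_modeSpan φ _ _ _) _
  | zero => rw [circRight_zero_op]; exact Submodule.zero_mem _
  | add x y _ _ hx hy => rw [circRight_add_op]; exact Submodule.add_mem _ hx hy
  | smul c x _ hx => rw [circRight_smul_op]; exact Submodule.smul_mem _ _ hx

end IsIterateExtension

/-- The weak module `G_r^o(W₁,W₂)` under `∘_r`. -/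
def genRightHomogeneousModule (S₁ : WeakModule V W₁) (S₂ : WeakModule V W₂) :
    WeakModule V (genRightHomogeneous S₁ S₂) :=
  circModule (genRightHomogeneous S₁ S₂) genRightHomogeneous_le_genRight
    fun _ _ _ h => genRightHomogeneous_circRight_mem h

/-- The Jacobi identity may be checked after an injective linear map. -/
theorem jacobiIdentity_of_injective {E : Type*} [AddCommGroup E] [Module ℂ E]
    (I : W₁ →ₗ[ℂ] ℂ → (W₂ →ₗ[ℂ] W₃)) (ι : W₃ →ₗ[ℂ] E) (hι : Function.Injective ι)
    (ht : ∀ w u (α : ℂ), ∃ N : ℤ, ∀ j : ℤ, j ≥ N → I w (α + j) u = 0)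
    (h : ∀ a w u l m n, outerSum (fun p n => ι (S₃.Y a p (I w n u))) l m n
      - innerSum (fun p n => ι (I w n (S₂.Y a p u))) l m n
      = iterSum (fun p n => ι (I (S₁.Y a p w) n u)) l m n) :
    JacobiIdentity S₁.Y S₂.Y S₃.Y I := by
  intro a w u l m n
  have hd : FinDown fun p n => S₃.Y a p (I w n u) := S₃.finDown_comp a (ht w u)
  have hu : FinUp fun p n => I w n (S₂.Y a p u) := S₂.finUp_mode a u (I w)
  have hY : FinUp fun p n => I (S₁.Y a p w) n u := by
    obtain ⟨N, hN⟩ := S₁.truncation a w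
    exact FinUp.of_bound fun p hp n => by rw [hN p hp, map_zero]; rfl
  refine (jacobi_sums_iff hd hu l m n).2 (hι ?_)
  rw [map_sub]
  exact (congrArg₂ _ (map_outerSum ι.toAddMonoidHom hd l m n)
    (map_innerSum ι.toAddMonoidHom hu l m n)).trans ((h a w u l m n).trans
      (map_iterSum ι.toAddMonoidHom hY l m n).symm)

/-- The modes of `A ↦ A(z)w₁` on a weak submodule of `G_r^o(W₁,W₂)`. -/
def naturalMode (M : WeakSubmodule (genRightHomogeneousModule S₁ S₂)) :
    W₁ →ₗ[ℂ] ℂ → (M.toSubmodule →ₗ[ℂ] W₂) where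
  toFun := fun w m =>
    { toFun := fun A => ((A : genRightHomogeneous S₁ S₂) : ℂ → (W₁ →ₗ[ℂ] W₂)) m w
      map_add' := fun _ _ => rfl
      map_smul' := fun _ _ => rfl }
  map_add' := fun w w' => by ext m A; simp
  map_smul' := fun c w => by ext m A; simp

/-- The natural intertwining operator `A ↦ A(z)w₁` on a weak submodule of `G_r^o(W₁,W₂)`. -/
def naturalIntertwiningOperator (M : WeakSubmodule (genRightHomogeneousModule S₁ S₂)) :
    IntertwiningOperator S₁ M.weakModule S₂ where
  mode := naturalMode M
  truncation := fun w A α =>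
    (genRightHomogeneous_le_genRight A.1.2 : IsGenRightIntertwining S₁ S₂ _).truncation α w
  derivative := fun w n => by
    ext A
    exact (genRightHomogeneous_le_genRight A.1.2 : IsGenRightIntertwining S₁ S₂ _).derivative n w
  jacobi := by
    refine jacobiIdentity_of_injective (S₁ := S₁) (S₂ := M.weakModule) (S₃ := S₂)
      (naturalMode M) LinearMap.id Function.injective_id ?_ ?_
    · intro w A α
      exact (genRightHomogeneous_le_genRight A.1.2 : IsGenRightIntertwining S₁ S₂ _).truncation α w
    · intro a w A l m n
      have hA : IsGenRightIntertwining S₁ S₂ (A.1 : ℂ → (W₁ →ₗ[ℂ] W₂)) :=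
        genRightHomogeneous_le_genRight A.1.2
      have hj := hA.jacobi_sums a w l m n
      have e1 : ∀ p n, naturalMode M w n (M.weakModule.Y a p A) = circRight S₁ S₂ a p A.1 n w :=
        fun p n => rfl
      simp only [LinearMap.id_apply, e1]
      exact hj

namespace IsIterateExtension

variable {φ : W₂ → W₃ → ℂ → ℂ → (W₁ →ₗ[ℂ] W₄)}

/-- The span of all `φ_n(w₂,w₃,z₁)` as a weak submodule of `G_r^o`. -/
def weakSubmodule (hφ : IsIterateExtension F G φ)
    (hconv : IterateConvergenceExtension F G) (h₁ : S₁.IsWeightGraded)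
    (h₂ : S₂.IsWeightGraded) (h₃ : S₃.IsWeightGraded) (h₄ : S₄.IsWeightGraded) :
    WeakSubmodule (genRightHomogeneousModule S₁ S₄) where
  toSubmodule := (modeSpan φ).comap (genRightHomogeneous S₁ S₄).subtype
  stable := fun a n _ hΦ => hφ.circRight_mem_modeSpan hconv h₁ h₂ h₃ h₄ a n hΦ

/-- The weak submodule was defined as a preimage inside `G_r^o`; it loses nothing because every
`φ_n` already lies there. -/
theorem map_weakSubmodule (hφ : IsIterateExtension F G φ)
    (hconv : IterateConvergenceExtension F G) (h₁ : S₁.IsWeightGraded)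
    (h₂ : S₂.IsWeightGraded) (h₃ : S₃.IsWeightGraded) (h₄ : S₄.IsWeightGraded) :
    (hφ.weakSubmodule hconv h₁ h₂ h₃ h₄).toSubmodule.map (genRightHomogeneous S₁ S₄).subtype
      = modeSpan φ := by
  refine (Submodule.map_comap_eq _ _).trans ?_
  rw [Submodule.range_subtype, inf_eq_right]
  refine Submodule.span_le.2 ?_
  rintro _ ⟨w₂, w₃, n, rfl⟩
  exact hφ.mem_genRightHomogeneous hconv h₁ h₂ h₃ h₄ w₂ w₃ n

/-- The modes `w₂ ⊗ w₃ ↦ φ_n(w₂,w₃,z₁)`. -/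
def extensionMode (hφ : IsIterateExtension F G φ)
    (hconv : IterateConvergenceExtension F G) (h₁ : S₁.IsWeightGraded)
    (h₂ : S₂.IsWeightGraded) (h₃ : S₃.IsWeightGraded) (h₄ : S₄.IsWeightGraded) :
    W₂ →ₗ[ℂ] ℂ → (W₃ →ₗ[ℂ] (hφ.weakSubmodule hconv h₁ h₂ h₃ h₄).toSubmodule) where
  toFun := fun w₂ n =>
    { toFun := fun w₃ => ⟨⟨φ w₂ w₃ n, hφ.mem_genRightHomogeneous hconv h₁ h₂ h₃ h₄ w₂ w₃ n⟩,
        mem_modeSpan φ w₂ w₃ n⟩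
      map_add' := fun x y => Subtype.ext <| Subtype.ext <| by
        show φ w₂ (x + y) n = φ w₂ x n + φ w₂ y n
        rw [hφ.add_thd h₄]; rfl
      map_smul' := fun c x => Subtype.ext <| Subtype.ext <| by
        show φ w₂ (c • x) n = c • φ w₂ x n
        rw [hφ.smul_thd h₄]; rfl }
  map_add' := fun x y => by
    funext n
    refine LinearMap.ext fun w₃ => Subtype.ext <| Subtype.ext ?_
    show φ (x + y) w₃ n = φ x w₃ n + φ y w₃ n
    rw [hφ.add_snd h₄]; rfl
  map_smul' := fun c x => by
    funext n
    refine LinearMap.ext fun w₃ => Subtype.ext <| Subtype.ext ?_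
    show φ (c • x) w₃ n = c • φ x w₃ n
    rw [hφ.smul_snd h₄]; rfl

/-- The intertwining operator `w₂ ⊗ w₃ ↦ φ(w₂,w₃;z₁,z₂)`. -/
def intertwiningOperator (hφ : IsIterateExtension F G φ)
    (hconv : IterateConvergenceExtension F G) (h₁ : S₁.IsWeightGraded)
    (h₂ : S₂.IsWeightGraded) (h₃ : S₃.IsWeightGraded) (h₄ : S₄.IsWeightGraded) :
    IntertwiningOperator S₂ S₃ (hφ.weakSubmodule hconv h₁ h₂ h₃ h₄).weakModule where
  mode := hφ.extensionMode hconv h₁ h₂ h₃ h₄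
  truncation := fun w₂ w₃ α => by
    obtain ⟨N, hN⟩ := hφ.exists_nat_bound hconv h₁ h₂ h₃ h₄ w₂ w₃ α
    exact ⟨N, fun j hj => Subtype.ext <| Subtype.ext <| hN j hj⟩
  derivative := fun w₂ n =>
    LinearMap.ext fun w₃ => Subtype.ext <| Subtype.ext <| hφ.derivative_snd h₁ h₂ h₃ h₄ w₂ w₃ n
  jacobi := jacobiIdentity_of_injective _
    ((genRightHomogeneous S₁ S₄).subtype ∘ₗ
      (hφ.weakSubmodule hconv h₁ h₂ h₃ h₄).toSubmodule.subtype)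
    (Subtype.val_injective.comp Subtype.val_injective)
    (fun w₂ w₃ α => by
      obtain ⟨N, hN⟩ := hφ.exists_nat_bound hconv h₁ h₂ h₃ h₄ w₂ w₃ α
      exact ⟨N, fun j hj => Subtype.ext <| Subtype.ext <| hN j hj⟩)
    fun a w₂ w₃ l m n => hφ.jacobi_sums hconv h₁ h₂ h₃ h₄ a w₂ w₃ l m n

end IsIterateExtension

end

theorem proposition3p13 {V : Type v} [AddCommGroup V] [Module ℂ V] [VertexOperatorAlgebra V]
    {W₁ W₂ W₃ W₁₂ W₁₂₃ : Type u}
    [AddCommGroup W₁] [Module ℂ W₁] [AddCommGroup W₂] [Module ℂ W₂] [AddCommGroup W₃] [Module ℂ W₃]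
    [AddCommGroup W₁₂] [Module ℂ W₁₂] [AddCommGroup W₁₂₃] [Module ℂ W₁₂₃]
    (D : ModuleCategory)
    (S₁ : WeakModule V W₁) (S₂ : WeakModule V W₂) (S₃ : WeakModule V W₃)
    (S₁₂ : WeakModule V W₁₂) (S₁₂₃ : WeakModule V W₁₂₃)
    (h₁ : D.Mem S₁) (h₂ : D.Mem S₂) (h₃ : D.Mem S₃)
    (F₁₂ : IntertwiningOperator S₁ S₂ S₁₂) (hF₁₂ : IsModuleTensorProduct D F₁₂)
    (F₁₂₃ : IntertwiningOperator S₁₂ S₃ S₁₂₃) (hF₁₂₃ : IsModuleTensorProduct D F₁₂₃)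
    (hconv : IterateConvergenceExtension F₁₂ F₁₂₃) :
    -- the series `φ` exists and is unique
    (∃! φ : W₂ → W₃ → ℂ → ℂ → (W₁ →ₗ[ℂ] W₁₂₃), IsIterateExtension F₁₂ F₁₂₃ φ) ∧
    ∀ φ : W₂ → W₃ → ℂ → ℂ → (W₁ →ₗ[ℂ] W₁₂₃), IsIterateExtension F₁₂ F₁₂₃ φ →
      -- `φ_n(w₂,w₃,z₁) = 0` when `Re n` is large
      (∀ (w₂ : W₂) (w₃ : W₃), ∃ h : ℝ, ∀ n : ℂ, h < n.re → φ w₂ w₃ n = 0) ∧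
      -- `G_r^o(W₁, W₁₂₃)` is a weak module under `∘_r`
      ∃ G : WeakModule V (genRightHomogeneous S₁ S₁₂₃),
        (∀ (a : V) (m : ℤ) (Φ : genRightHomogeneous S₁ S₁₂₃),
          (G.Y a m Φ : ℂ → (W₁ →ₗ[ℂ] W₁₂₃)) = circRight S₁ S₁₂₃ a m Φ) ∧
        -- the span `M` of all `φ_n(w₂,w₃,z₁)` is a weak submodule of it
        ∃ M : WeakSubmodule G,
          M.toSubmodule.map (genRightHomogeneous S₁ S₁₂₃).subtype
            = Submodule.span ℂ {Φ | ∃ (w₂ : W₂) (w₃ : W₃) (n : ℂ), Φ = φ w₂ w₃ n} ∧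
          -- the natural intertwining operator `I₁` and the intertwining operator `I₂`
          ∃ I₁ : IntertwiningOperator S₁ M.weakModule S₁₂₃,
            (∀ (w₁ : W₁) (m : ℂ) (A : M.toSubmodule), I₁.mode w₁ m A =
              ((A : genRightHomogeneous S₁ S₁₂₃) : ℂ → (W₁ →ₗ[ℂ] W₁₂₃)) m w₁) ∧
          ∃ I₂ : IntertwiningOperator S₂ S₃ M.weakModule,
            (∀ (w₂ : W₂) (n : ℂ) (w₃ : W₃),
              ((I₂.mode w₂ n w₃ : genRightHomogeneous S₁ S₁₂₃) : ℂ → (W₁ →ₗ[ℂ] W₁₂₃))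
                = φ w₂ w₃ n) ∧
            -- `E^{12}` turns the iterate of `F₁₂, F₁₂₃` into the product of `I₁, I₂`
            (∀ (w₁ : W₁) (w₂ : W₂) (w₃ : W₃) (w' : Module.Dual ℂ W₁₂₃), S₁₂₃.InGradedDual w' →
              IsIterateExpansion (iterateCoeff F₁₂ F₁₂₃ w₁ w₂ w₃ w')
                (fun m n => w' (I₁.mode w₁ m (I₂.mode w₂ n w₃)))) := by
  have g₁ := h₁.isWeightGraded
  have g₂ := h₂.isWeightGraded
  have g₃ := h₃.isWeightGraded
  -- That `W₁₂₃` belongs to the category is part of being a tensor product in it.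
  have g₄ := hF₁₂₃.1.isWeightGraded
  refine ⟨hconv.existsUnique g₁ g₂ g₃ g₄, fun φ hφ =>
    ⟨fun w₂ w₃ => hφ.exists_bound hconv g₁ g₂ g₃ g₄ w₂ w₃, genRightHomogeneousModule S₁ S₁₂₃,
      fun _ _ _ => rfl, hφ.weakSubmodule hconv g₁ g₂ g₃ g₄,
      hφ.map_weakSubmodule hconv g₁ g₂ g₃ g₄, naturalIntertwiningOperator _, fun _ _ _ => rfl,
      hφ.intertwiningOperator hconv g₁ g₂ g₃ g₄, fun _ _ _ => rfl,
      fun w₁ w₂ w₃ f hf => hφ w₁ w₂ w₃ f hf⟩⟩
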